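/- Let $c_1,\dots,c_L$ be integers with $c_1=0$, and let $(Z_n)_{n\ge 0}$ be a nondecreasing sequence of positive integers with $Z_n\to\infty$ satisfying $$Z_{n+1}=c_1Z_n+c_2Z_{n-1}+\cdots+c_LZ_{n+1-L}\qquad(n\ge L-1)$$ (a zero linear recurrence, ZLRR). Assume that the characteristic polynomial $x^L-c_1x^{L-1}-\cdots-c_L$ has a real root $\lambda$ that is simple and such that all other complex roots have modulus strictly less than $|\lambda|$, and that $\lambda$ governs the growth of the sequence, in the sense that $Z_n/\lambda^n\not\to 0$ (this is automatic if all $c_i\ge 0$). The greedy decomposition of an integer $m\ge 0$ is obtained by repeatedly choosing the largest index $j$ with $Z_j\le m$, subtracting $Z_j$, and continuing with the remainder until it is $0$. It has the form $m=Z_{j_1}+\cdots+Z_{j_k}$ with $j_1\ge j_2\ge\cdots\ge j_k$; $k=k(m)$ is the number of greedy summands (with $k(0)=0$), and $j_1-j_2,\ \dots,\ j_{k-1}-j_k$ are the gaps of $m$. Assume that the initial conditions make the greedy representation complete, i.e. the greedy algorithm represents every positive integer (equivalently $Z_0=1$). Then: 1. (Gaussian number of summands.) There are constants $C_1,C_2>0$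 such that, both for $m$ uniform in $[0,Z_N)$ and for $m$ uniform in $[Z_N,Z_{N+1})$, the random variable $K_N=k(m)$ satisfies, as $N\to\infty$, $\mathbb E[K_N]=C_1N+O(1)$ and $\mathrm{Var}(K_N)=C_2N+O(1)$, and $(K_N-\mathbb E[K_N])/\sqrt{\mathrm{Var}(K_N)}$ converges in distribution to the standard normal law $\mathcal N(0,1)$. 2. (Geometric decay of gaps.) For $g\ge 0$ let $P_N(g)$ be the proportion of gaps of length $g$ among all gaps in the greedy decompositions of all integers $m\in[Z_N,Z_{N+1})$. Then the limit $p_g=\lim_{N\to\infty}P_N(g)$ exists for every $g\ge 0$, $\sum_{g\ge 0}p_g=1$, $\lambda>1$, and there is a constant $C>0$ with $p_g\sim C\lambda^{-g}$ as $g\to\infty$. -/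

import Mathlib

open Filter Topology Asymptotics ProbabilityTheory

namespace GreedyZLRR

/-- The characteristic polynomial of an integer linear recurrence, over the complex numbers. -/
noncomputable def complexCharPoly (E : LinearRecurrence ℤ) : Polynomial ℂ :=
  E.charPoly.map (Int.castRingHom ℂ)

/-- `Z` is generated by the zero linear recurrence `E`: it is a nondecreasing sequence of positive
integers tending to infinity with `Z (n+1) = c₁ Z n + ⋯ + c_L Z (n+1-L)` and `c₁ = 0`.
In Mathlib's indexing `Z (n+L) = ∑ i, E.coeffs i * Z (n+i)`, so that `c_j = E.coeffs (L-j)` and `c₁`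
is the coefficient with the last index `L-1`. -/
structure IsZLRR (E : LinearRecurrence ℤ) (Z : ℕ → ℕ) : Prop where
  recurrence : E.IsSolution (fun n => (Z n : ℤ))
  leading_zero : ∀ i : Fin E.order, (i : ℕ) + 1 = E.order → E.coeffs i = 0
  pos : ∀ n, 0 < Z n
  mono : Monotone Z
  tendsto : Tendsto Z atTop atTop

/-- `lam` is a simple root of the characteristic polynomial, and every other complex root has
strictly smaller modulus. -/
structure IsDominantRoot (E : LinearRecurrence ℤ) (lam : ℝ) : Prop where
  simple : (complexCharPoly E).rootMultiplicity (lam : ℂ) = 1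
  dominant : ∀ z : ℂ, (complexCharPoly E).IsRoot z → z ≠ (lam : ℂ) → ‖z‖ < |lam|

/-- The largest index `j` with `Z j ≤ m` (when `Z` tends to infinity and there is such a `j`). -/
noncomputable def topIndex (Z : ℕ → ℕ) (m : ℕ) : ℕ := sSup {j | Z j ≤ m}

/-- The indices `[j₁, j₂, …]` chosen by the greedy algorithm, in the order of choice: subtract
`Z j` with the largest `j` such that `Z j ≤ m` and continue with the remainder, until it is zero
(or until no term can be subtracted any more). -/
noncomputable def greedy (Z : ℕ → ℕ) (m : ℕ) : List ℕ :=
  if _h : 0 < Z (topIndex Z m) ∧ Z (topIndex Z m) ≤ m then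
    topIndex Z m :: greedy Z (m - Z (topIndex Z m))
  else []
termination_by m
decreasing_by omega

/-- The greedy algorithm represents every positive integer. -/
def CompleteGreedy (Z : ℕ → ℕ) : Prop :=
  ∀ m : ℕ, 1 ≤ m → ((greedy Z m).map Z).sum = m

/-- The number `k(m)` of greedy summands of `m`. -/
noncomputable def numSummands (Z : ℕ → ℕ) (m : ℕ) : ℕ := (greedy Z m).length

/-- The gaps `j₁ - j₂, j₂ - j₃, …` between consecutive entries of a list of indices. -/
def gaps (l : List ℕ) : List ℕ := List.zipWith (fun a b => a - b) l l.tail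

/-- Expectation of `k(m)` for `m` uniform in `U`. -/
noncomputable def meanSummands (Z : ℕ → ℕ) (U : Finset ℕ) : ℝ :=
  (∑ m ∈ U, (numSummands Z m : ℝ)) / U.card

/-- Variance of `k(m)` for `m` uniform in `U`. -/
noncomputable def varSummands (Z : ℕ → ℕ) (U : Finset ℕ) : ℝ :=
  (∑ m ∈ U, ((numSummands Z m : ℝ) - meanSummands Z U) ^ 2) / U.card

open Classical in
/-- The distribution function at `x` of `(k(m) - 𝔼 k) / √(Var k)` for `m` uniform in `U`. -/
noncomputable def normalizedCDF (Z : ℕ → ℕ) (U : Finset ℕ) (x : ℝ) : ℝ :=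
  ((U.filter fun m =>
      ((numSummands Z m : ℝ) - meanSummands Z U) / Real.sqrt (varSummands Z U) ≤ x).card : ℝ)
    / U.card

/-- For `m` uniform in `U N`, the mean and the variance of the number of greedy summands are
`C₁ N + O(1)` and `C₂ N + O(1)`, and the normalized number of summands converges in distribution
to the standard normal law. -/
structure GaussianSummands (Z : ℕ → ℕ) (U : ℕ → Finset ℕ) (C₁ C₂ : ℝ) : Prop where
  mean : (fun N : ℕ => meanSummands Z (U N) - C₁ * N) =O[atTop] (fun _ => (1 : ℝ))
  var : (fun N : ℕ => varSummands Z (U N) - C₂ * N) =O[atTop] (fun _ => (1 : ℝ))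
  clt : ∀ x : ℝ, Tendsto (fun N => normalizedCDF Z (U N) x) atTop (𝓝 (cdf (gaussianReal 0 1) x))

/-- The proportion of gaps of length `g` among all gaps in the greedy decompositions of the
integers in `[Z N, Z (N+1))`. -/
noncomputable def gapProb (Z : ℕ → ℕ) (N g : ℕ) : ℝ :=
  (∑ m ∈ Finset.Ico (Z N) (Z (N + 1)), ((gaps (greedy Z m)).count g : ℝ)) /
    (∑ m ∈ Finset.Ico (Z N) (Z (N + 1)), ((gaps (greedy Z m)).length : ℝ))

end GreedyZLRR

/-! Since `lam` is a simple dominant root that governs the growth, Z_n = a λ^n + O(r^n) with a > 0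
and 1 < r < λ. After that only this growth, monotonicity and positivity of `Z` are used.

Put b = 1/λ and let 1 = Σ b^{d_i} be the quasi-greedy (never terminating) expansion of 1. Then Z_N
is close to Σ Z_{N-d_i}, and [0, Z_N) splits, up to few exceptions, into consecutive blocks of
lengths Z_{N-d_0}, Z_{N-d_1}, …. An integer of the i-th block is decomposed greedily as N-d_0, …,
N-d_{i-1} followed by the greedy decomposition of an integer below Z_{N-d_i}. Maximality of the
expansion is exactly what makes these concatenations greedy to leading order. Hence every statistic,
summed over m < Z_N and divided by a λ^N, satisfies a renewal equation x_N ≈ Σ b^{d_i} x_{N-d_i} +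
forcing, with error O(N^2 (r/λ)^N) for bounded statistics (`ExpGrowth.exists_renewal`). The limiting
model is a renewal process: with probability b^{d_i} the index drops by d_i and i summands are
gained.

Summands. With c = E[i]/E[d], the excess ξ_i = i - c d_i has mean zero. A renewal theorem with
exponential rate (`exists_limit_of_convolution`, by generating functions) makes the centred first
moment converge exponentially fast. The cross term in the second moment is then negligible, and the
variance grows at the rate c₂ = E[ξ^2]/E[d] > 0. For the limit law, exp(-c₂θ^2 n/2) solves the
renewal equation of the characteristic function up to O(q^n + |θ|^3). At θ of order n^{-1/2} the
accumulated error n|θ|^3 vanishes, and Lévy's continuity theorem applies. The window [Z_N, Z_{N+1})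
is an affine combination of two initial intervals.

Gaps. The number of gaps of length g obeys a renewal equation whose forcing converges to `gapRate`:
gaps inside the prefix, plus the gap joining the prefix to the rest. Hence it grows linearly.
Dividing by the total number of gaps gives p_g = `gapRate` / E[i]. Summing the explicit series over
g, or multiplying it by λ^g and letting g → ∞, gives total mass one and the geometric decay. -/

namespace GreedyZLRR

/-! ### Exponential growth from the dominant root -/

/-- The sequence `Z` has purely exponential growth `a * lam ^ n` with an exponentially smaller
error. -/
structure ExpGrowth (Z : ℕ → ℕ) (a lam r C : ℝ) : Prop where
  mono : Monotone Z
  pos : ∀ n, 0 < Z n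
  a_pos : 0 < a
  one_lt_r : 1 < r
  r_lt : r < lam
  err : ∀ n, |(Z n : ℝ) - a * lam ^ n| ≤ C * r ^ n

/-- The shift operator on complex sequences. -/
noncomputable def shift : Module.End ℂ (ℕ → ℂ) where
  toFun u := fun n => u (n + 1)
  map_add' _ _ := rfl
  map_smul' _ _ := rfl

theorem shift_apply (u : ℕ → ℂ) (n : ℕ) : shift u n = u (n + 1) := rfl

theorem shift_pow_apply (k : ℕ) (u : ℕ → ℂ) (n : ℕ) : (shift ^ k) u n = u (n + k) := by
  induction k generalizing n with
  | zero => simp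
  | succ k ih =>
    rw [pow_succ', Module.End.mul_apply, shift_apply, ih]
    congr 1; omega

theorem norm_le_of_first_order {u w : ℕ → ℂ} {z : ℂ} {r C : ℝ} (hz : ‖z‖ < r)
    (hw : ∀ n, ‖w n‖ ≤ C * r ^ n) (h : ∀ n, u (n + 1) = z * u n + w n) :
    ∃ C', ∀ n, ‖u n‖ ≤ C' * r ^ n := by
  have hr : 0 < r := (norm_nonneg z).trans_lt hz
  have hrz : 0 < r - ‖z‖ := sub_pos.2 hz
  -- This constant D satisfies ‖z‖ D + C ≤ r D, which is what the induction step consumes.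
  refine ⟨max ‖u 0‖ (C / (r - ‖z‖)), fun n => ?_⟩
  set D := max ‖u 0‖ (C / (r - ‖z‖)) with hD
  have hC : C ≤ D * (r - ‖z‖) := by
    rw [← div_le_iff₀ hrz]; exact le_max_right _ _
  induction n with
  | zero => rw [pow_zero, mul_one]; exact le_max_left _ _
  | succ n ih =>
    rw [h]
    calc ‖z * u n + w n‖ ≤ ‖z‖ * (D * r ^ n) + C * r ^ n := by
          refine (norm_add_le _ _).trans (add_le_add ?_ (hw n))
          rw [norm_mul]; gcongr
      _ = (‖z‖ * D + C) * r ^ n := by ring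
      _ ≤ (r * D) * r ^ n := by
          gcongr; linarith
      _ = D * r ^ (n + 1) := by ring

/-- The roots are peeled off one at a time, each factor being a first-order recurrence with forcing
already bounded. The strict inequality ‖z‖ < r absorbs the polynomial factors that repeated roots
would produce. -/
theorem norm_le_of_aeval_shift (s : Multiset ℂ) {r : ℝ} (hs : ∀ z ∈ s, ‖z‖ < r)
    (u : ℕ → ℂ)
    (hu : Polynomial.aeval shift (s.map fun z => Polynomial.X - Polynomial.C z).prod u = 0) :
    ∃ C, ∀ n, ‖u n‖ ≤ C * r ^ n := by
  induction s using Multiset.induction_on generalizing u with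
  | empty =>
    refine ⟨0, fun n => ?_⟩
    have : u = 0 := by simpa using hu
    simp [this]
  | cons z s ih =>
    rw [Multiset.map_cons, Multiset.prod_cons, mul_comm, map_mul, Module.End.mul_apply] at hu
    obtain ⟨C, hC⟩ := ih (fun y hy => hs y (Multiset.mem_cons_of_mem hy)) _ hu
    refine norm_le_of_first_order (hs z (Multiset.mem_cons_self _ _)) hC fun n => ?_
    simp [shift_apply, Algebra.algebraMap_eq_smul_one]

theorem aeval_shift_charPoly {E : LinearRecurrence ℤ} {u : ℕ → ℤ} (hu : E.IsSolution u) :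
    Polynomial.aeval shift (complexCharPoly E) (fun n => (u n : ℂ)) = 0 := by
  have h1 : complexCharPoly E = Polynomial.X ^ E.order -
      ∑ i : Fin E.order, Polynomial.C ((E.coeffs i : ℂ)) * Polynomial.X ^ (i : ℕ) := by
    simp [complexCharPoly, LinearRecurrence.charPoly, Polynomial.map_sum,
      ← Polynomial.C_mul_X_pow_eq_monomial]
  rw [h1]
  funext n
  have := hu n
  simp only [map_sub, map_sum, map_mul, map_pow, Polynomial.aeval_X, Polynomial.aeval_C,
    LinearMap.sub_apply, Pi.sub_apply, LinearMap.sum_apply, Finset.sum_apply,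
    Module.End.mul_apply, Module.algebraMap_end_apply, Pi.smul_apply, shift_pow_apply, smul_eq_mul,
    Pi.zero_apply, this]
  push_cast
  simp

/-- Dividing the characteristic polynomial by X - λ leaves, by simplicity, only roots of modulus
below |λ|. This cofactor annihilates the sequence u(n+1) - λ u(n). -/
theorem exists_bound_first_difference {E : LinearRecurrence ℤ} {u : ℕ → ℤ} {lam : ℝ}
    (hu : E.IsSolution u) (hlam : IsDominantRoot E lam) (hne : lam ≠ 0) :
    ∃ r C, r < |lam| ∧ 0 < r ∧
      ∀ n, ‖(u (n + 1) : ℂ) - lam * u n‖ ≤ C * r ^ n := by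
  have hmonic : (complexCharPoly E).Monic := (E.charPoly_monic).map _
  have hroots : ((lam : ℂ)) ∈ (complexCharPoly E).roots := by
    rw [← Multiset.one_le_count_iff_mem, Polynomial.count_roots, hlam.simple]
  obtain ⟨s, hs⟩ := Multiset.exists_cons_of_mem hroots
  have hcount : (lam : ℂ) ∉ s := by
    have h1 := hlam.simple
    rw [← Polynomial.count_roots, hs, Multiset.count_cons_self] at h1
    rw [← Multiset.count_eq_zero]; omega
  have hsmall : ∀ z ∈ s, ‖z‖ < |lam| := fun z hz => by
    refine hlam.dominant z ?_ (fun h => hcount (h ▸ hz))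
    have : z ∈ (complexCharPoly E).roots := hs ▸ Multiset.mem_cons_of_mem hz
    exact (Polynomial.mem_roots'.1 this).2
  have hex : ∃ r, r < |lam| ∧ 0 < r ∧ ∀ z ∈ s, ‖z‖ < r := by
    clear hs hcount
    induction s using Multiset.induction_on with
    | empty => exact ⟨|lam| / 2, by have := abs_pos.2 hne; linarith,
        by have := abs_pos.2 hne; linarith, by simp⟩
    | cons z s ih =>
      obtain ⟨r, h1, h2, h3⟩ := ih fun y hy => hsmall y (Multiset.mem_cons_of_mem hy)
      obtain ⟨r', h4, h5⟩ := exists_between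
        (max_lt h1 (hsmall z (Multiset.mem_cons_self _ _)))
      refine ⟨r', h5, h2.trans (lt_of_le_of_lt (le_max_left _ _) h4), fun y hy => ?_⟩
      rcases Multiset.mem_cons.1 hy with rfl | hy
      · exact lt_of_le_of_lt (le_max_right _ _) h4
      · exact (h3 y hy).trans (lt_of_le_of_lt (le_max_left _ _) h4)
  obtain ⟨r, hr1, hr2, hr3⟩ := hex
  have hprod : complexCharPoly E = (s.map fun z => Polynomial.X - Polynomial.C z).prod *
      (Polynomial.X - Polynomial.C (lam : ℂ)) := by
    have h := (IsAlgClosed.splits (complexCharPoly E)).eq_prod_roots_of_monic hmonic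
    rw [hs, Multiset.map_cons, Multiset.prod_cons, mul_comm] at h
    exact h
  have h0 := aeval_shift_charPoly hu
  rw [hprod, map_mul, Module.End.mul_apply] at h0
  obtain ⟨C, hC⟩ := norm_le_of_aeval_shift s hr3 _ h0
  refine ⟨r, C, hr1, hr2, fun n => ?_⟩
  have := hC n
  simpa [shift_apply, Algebra.algebraMap_eq_smul_one] using this

theorem exists_limit_ratio {u : ℕ → ℝ} {lam r C : ℝ} (hr : 0 < r) (hrl : r < |lam|)
    (h : ∀ n, |u (n + 1) - lam * u n| ≤ C * r ^ n) :
    ∃ a C', Tendsto (fun n => u n / lam ^ n) atTop (𝓝 a) ∧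
      ∀ n, |u n - a * lam ^ n| ≤ C' * r ^ n := by
  have hl : 0 < |lam| := hr.trans hrl
  have hl0 : lam ≠ 0 := abs_pos.1 hl
  have hq : r / |lam| < 1 := (div_lt_one hl).2 hrl
  have hd : ∀ n, dist (u n / lam ^ n) (u (n + 1) / lam ^ (n + 1)) ≤
      C / |lam| * (r / |lam|) ^ n := fun n => by
    rw [dist_comm, Real.dist_eq]
    have : u (n + 1) / lam ^ (n + 1) - u n / lam ^ n = (u (n + 1) - lam * u n) / lam ^ (n + 1) := by
      field_simp
      ring
    rw [this, abs_div, abs_pow, div_le_iff₀ (by positivity)]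
    calc _ ≤ _ := h n
      _ = _ := by rw [div_pow, pow_succ]; field_simp
  obtain ⟨a, ha⟩ := cauchySeq_tendsto_of_complete (cauchySeq_of_le_geometric _ _ hq hd)
  refine ⟨a, C / |lam| / (1 - r / |lam|), ha, fun n => ?_⟩
  have := dist_le_of_le_geometric_of_tendsto _ _ hq hd ha n
  rw [Real.dist_eq] at this
  have h2 : u n - a * lam ^ n = (u n / lam ^ n - a) * lam ^ n := by field_simp
  rw [h2, abs_mul, abs_pow]
  calc _ ≤ C / |lam| * (r / |lam|) ^ n / (1 - r / |lam|) * |lam| ^ n := by gcongr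
    _ = _ := by rw [div_pow]; field_simp

theorem IsZLRR.exists_expGrowth {E : LinearRecurrence ℤ} {Z : ℕ → ℕ} {lam : ℝ} (hZ : IsZLRR E Z)
    (hlam : IsDominantRoot E lam)
    (hgrowth : ¬ Tendsto (fun n : ℕ => (Z n : ℝ) / lam ^ n) atTop (𝓝 0)) :
    ∃ a r C, ExpGrowth Z a lam r C := by
  have hne : lam ≠ 0 := by
    rintro rfl
    refine hgrowth (tendsto_const_nhds.congr' ?_)
    filter_upwards [eventually_ge_atTop 1] with n hn
    rw [zero_pow (by omega), div_zero]
  obtain ⟨r, C, hr1, hr0, hb⟩ := exists_bound_first_difference hZ.recurrence hlam hne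
  have hb' : ∀ n, |(Z (n + 1) : ℝ) - lam * Z n| ≤ C * r ^ n := fun n => by
    have := hb n
    rw [← Real.norm_eq_abs, ← Complex.norm_real]
    simpa using this
  obtain ⟨a, C', ha, -⟩ := exists_limit_ratio (u := fun n => (Z n : ℝ)) hr0 hr1 hb'
  have ha0 : a ≠ 0 := fun h => hgrowth (h ▸ ha)
  -- For negative λ the quotients Z_n/λ^n alternate in sign, which forces their limit to be zero.
  have hpos : 0 < lam := by
    by_contra hcon
    have hneg : lam < 0 := lt_of_le_of_ne (not_lt.1 hcon) hne
    have he : Tendsto (fun n : ℕ => 2 * n) atTop atTop :=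
      tendsto_atTop_mono (fun n => by simp only [id]; omega) tendsto_id
    have ho : Tendsto (fun n : ℕ => 2 * n + 1) atTop atTop := (tendsto_add_atTop_nat 1).comp he
    have h1 : 0 ≤ a := ge_of_tendsto' (ha.comp he) fun n => by
      simp only [Function.comp, pow_mul]; positivity
    have h2 : a ≤ 0 := le_of_tendsto' (ha.comp ho) fun n => by
      simp only [Function.comp]
      refine div_nonpos_of_nonneg_of_nonpos (Nat.cast_nonneg _) ?_
      exact (Odd.pow_neg ⟨n, rfl⟩ hneg).le
    exact ha0 (le_antisymm h2 h1)
  have hapos : 0 < a := lt_of_le_of_ne (ge_of_tendsto' ha fun n => by positivity) ha0.symm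
  have hone : 1 < lam := by
    by_contra hcon
    have h1 : Tendsto (fun n => (Z n : ℝ)) atTop atTop :=
      tendsto_natCast_atTop_atTop.comp hZ.tendsto
    have h2 : Tendsto (fun n => (Z n : ℝ) / lam ^ n) atTop atTop :=
      tendsto_atTop_mono (fun n => by
        rw [le_div_iff₀ (by positivity)]
        exact mul_le_of_le_one_right (Nat.cast_nonneg _) (pow_le_one₀ hpos.le (not_lt.1 hcon))) h1
    exact not_tendsto_nhds_of_tendsto_atTop h2 a ha
  rw [abs_of_pos hpos] at hr1
  -- The error rate is raised above 1, so that bounded errors are also O(r'^n).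
  obtain ⟨r', h1, h2⟩ := exists_between (max_lt hone hr1)
  have hr1' : 1 < r' := lt_of_le_of_lt (le_max_left _ _) h1
  have hrr : r ≤ r' := ((le_max_right _ _).trans_lt h1).le
  have hC0 : 0 ≤ C := by
    have := (abs_nonneg _).trans (hb' 0); simpa using this
  have hb'' : ∀ n, |(Z (n + 1) : ℝ) - lam * Z n| ≤ C * r' ^ n := fun n =>
    (hb' n).trans (by gcongr)
  obtain ⟨a', C'', ha', hC''⟩ := exists_limit_ratio (u := fun n => (Z n : ℝ))
    (by linarith) (by rwa [abs_of_pos hpos]) hb''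
  obtain rfl := tendsto_nhds_unique ha ha'
  exact ⟨a, r', C'', hZ.mono, hZ.pos, hapos, hr1', h2, hC''⟩

/-! ### The quasi-greedy expansion of 1 -/

/-- `1 = ∑ i, b ^ d i` is the quasi-greedy (that is, the lexicographically largest infinite)
expansion of `1` in powers of `b`, with remainders `R`. -/
structure QuasiGreedy (b : ℝ) (d : ℕ → ℕ) (R : ℕ → ℝ) : Prop where
  b_pos : 0 < b
  b_lt : b < 1
  zero : R 0 = 1
  succ : ∀ i, R (i + 1) = R i - b ^ d i
  lt : ∀ i, b ^ d i < R i
  le : ∀ i, R i * b ≤ b ^ d i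
  one_le : ∀ i, 1 ≤ d i

theorem exists_quasiGreedy {b : ℝ} (hb : 0 < b) (hb1 : b < 1) : ∃ d R, QuasiGreedy b d R := by
  -- The digit is the least exponent n with b^n < x. Strictness keeps the remainder positive, so the
  -- expansion never stops; minimality gives x b ≤ b^n; and x ≤ 1 excludes n = 0.
  have hdig : ∀ x : ℝ, 0 < x → x ≤ 1 → ∃ n : ℕ, 1 ≤ n ∧ b ^ n < x ∧ x * b ≤ b ^ n := by
    intro x hx hx1
    have hex := exists_pow_lt_of_lt_one hx hb1
    classical
    have hpos : 1 ≤ Nat.find hex := by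
      rw [Nat.one_le_iff_ne_zero, Ne, Nat.find_eq_zero]
      simpa using hx1
    refine ⟨Nat.find hex, hpos, Nat.find_spec hex, ?_⟩
    have := Nat.find_min hex (m := Nat.find hex - 1) (by omega)
    have h2 : b ^ (Nat.find hex) = b ^ (Nat.find hex - 1) * b := by
      rw [← pow_succ]; congr 1; omega
    rw [h2]
    gcongr
    exact not_lt.1 this
  choose! dig h1 h2 h3 using hdig
  let R : ℕ → ℝ := fun i => Nat.rec 1 (fun _ x => x - b ^ dig x) i
  have hR : ∀ i, 0 < R i ∧ R i ≤ 1 := by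
    intro i
    induction i with
    | zero => exact ⟨one_pos, le_refl _⟩
    | succ i ih =>
      have h : R (i + 1) = R i - b ^ dig (R i) := rfl
      have h4 := h2 _ ih.1 ih.2
      have : 0 < b ^ dig (R i) := by positivity
      constructor <;> linarith [ih.2]
  exact ⟨fun i => dig (R i), R, hb, hb1, rfl, fun i => rfl, fun i => h2 _ (hR i).1 (hR i).2,
    fun i => h3 _ (hR i).1 (hR i).2, fun i => h1 _ (hR i).1 (hR i).2⟩

/-- The number of indices `i` with `d i ≤ N`, for monotone `d`. -/
noncomputable def cnt (d : ℕ → ℕ) (N : ℕ) : ℕ := sInf {i | N < d i}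

namespace QuasiGreedy

variable {b : ℝ} {d : ℕ → ℕ} {R : ℕ → ℝ}

theorem pos (h : QuasiGreedy b d R) (i : ℕ) : 0 < R i :=
  (pow_pos h.b_pos _).trans (h.lt i)

theorem antitone (h : QuasiGreedy b d R) : Antitone R :=
  antitone_nat_of_succ_le fun i => by
    rw [h.succ]; linarith [pow_pos h.b_pos (d i)]

/-- Each digit removes at least the fraction b of the current remainder. -/
theorem le_pow (h : QuasiGreedy b d R) (i : ℕ) : R i ≤ (1 - b) ^ i := by
  induction i with
  | zero => simp [h.zero]
  | succ i ih =>
    have := h.b_lt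
    calc R (i + 1) ≤ R i * (1 - b) := by rw [h.succ]; linarith [h.le i]
      _ ≤ (1 - b) ^ i * (1 - b) := by gcongr
      _ = _ := by ring

theorem tendsto_zero (h : QuasiGreedy b d R) : Tendsto R atTop (𝓝 0) :=
  squeeze_zero (fun i => (h.pos i).le) h.le_pow
    (tendsto_pow_atTop_nhds_zero_of_lt_one (by linarith [h.b_lt]) (by linarith [h.b_pos]))

theorem monotone (h : QuasiGreedy b d R) : Monotone d :=
  monotone_nat_of_le_succ fun i => by
    have h1 : b ^ (d (i + 1) + 1) < b ^ d i :=
      calc b ^ (d (i + 1) + 1) = b ^ d (i + 1) * b := pow_succ _ _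
        _ < R (i + 1) * b := mul_lt_mul_of_pos_right (h.lt _) h.b_pos
        _ ≤ R i * b := mul_le_mul_of_nonneg_right (h.antitone (Nat.le_succ i)) h.b_pos.le
        _ ≤ _ := h.le i
    have := (pow_lt_pow_iff_right_of_lt_one₀ h.b_pos h.b_lt).1 h1
    omega

theorem d_zero (h : QuasiGreedy b d R) : d 0 = 1 := by
  have h1 := h.le 0
  rw [h.zero, one_mul] at h1
  have h2 : b ^ 1 ≤ b ^ d 0 := by simpa using h1
  exact le_antisymm ((pow_le_pow_iff_right_of_lt_one₀ h.b_pos h.b_lt).1 h2) (h.one_le 0)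

/-- From b^{d_i} < R_i ≤ (1-b)^i the digits d_i grow at least linearly in i. This bounds the number
of blocks by O(N) and turns moments of the index i into moments of d_i. -/
theorem exists_index_lt (h : QuasiGreedy b d R) : ∃ c : ℕ, 1 ≤ c ∧ ∀ i, i < c * d i := by
  have h1 : 0 < 1 - b := by linarith [h.b_lt]
  obtain ⟨c, hc⟩ := exists_pow_lt_of_lt_one h.b_pos (show 1 - b < 1 by linarith [h.b_pos])
  have hc1 : 1 ≤ c := by
    rw [Nat.one_le_iff_ne_zero]
    rintro rfl
    simp only [pow_zero] at hc; linarith [h.b_lt]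
  refine ⟨c, hc1, fun i => ?_⟩
  by_contra hcon
  have h2 : b ^ d i < (1 - b) ^ (c * d i) :=
    ((h.lt i).trans_le (h.le_pow i)).trans_le
      (pow_le_pow_of_le_one h1.le (by linarith [h.b_pos]) (not_lt.1 hcon))
  rw [pow_mul] at h2
  exact absurd (h2.trans_le (pow_le_pow_left₀ (by positivity) hc.le _)) (lt_irrefl _)

theorem lt_cnt_iff (h : QuasiGreedy b d R) {i N : ℕ} : i < cnt d N ↔ d i ≤ N := by
  obtain ⟨c, hc1, hc⟩ := h.exists_index_lt
  have hne : {i | N < d i}.Nonempty := by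
    refine ⟨c * N, ?_⟩
    have := hc (c * N)
    exact lt_of_mul_lt_mul_left this (Nat.zero_le _)
  constructor
  · intro hi
    by_contra hcon
    exact Nat.notMem_of_lt_sInf (s := {i | N < d i}) hi (not_le.1 hcon)
  · intro hi
    by_contra hcon
    have h1 : N < d (cnt d N) := Nat.sInf_mem hne
    have h2 := h.monotone (not_lt.1 hcon)
    omega

theorem lt_d_cnt (h : QuasiGreedy b d R) (N : ℕ) : N < d (cnt d N) := by
  by_contra hcon
  exact absurd (h.lt_cnt_iff.2 (not_lt.1 hcon)) (lt_irrefl _)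

/-- The first omitted digit exceeds N, so truncating the expansion of Z_N at index 0 costs only O(1)
after multiplication by λ^N. -/
theorem remainder_cnt_le (h : QuasiGreedy b d R) (N : ℕ) : R (cnt d N) ≤ b ^ N := by
  have h2 : R (cnt d N) * b ≤ b ^ N * b := by
    refine (h.le _).trans ?_
    rw [← pow_succ]
    exact pow_le_pow_of_le_one h.b_pos.le h.b_lt.le (h.lt_d_cnt N)
  exact le_of_mul_le_mul_right h2 h.b_pos

theorem cnt_le (h : QuasiGreedy b d R) {c : ℕ} (hc : ∀ i, i < c * d i) (N : ℕ) :
    cnt d N ≤ c * (N + 1) := by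
  by_contra hcon
  have h1 := h.lt_cnt_iff.1 (not_le.1 hcon)
  have h2 := hc (c * (N + 1))
  have h3 := lt_of_mul_lt_mul_left h2 (Nat.zero_le _)
  omega

theorem sum_range (h : QuasiGreedy b d R) (n : ℕ) : ∑ i ∈ Finset.range n, b ^ d i = 1 - R n := by
  induction n with
  | zero => simp [h.zero]
  | succ n ih => rw [Finset.sum_range_succ, ih, h.succ]; ring

theorem hasSum (h : QuasiGreedy b d R) : HasSum (fun i => b ^ d i) 1 := by
  rw [hasSum_iff_tendsto_nat_of_nonneg (fun i => (pow_pos h.b_pos _).le)]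
  simp_rw [h.sum_range]
  simpa using h.tendsto_zero.const_sub 1

theorem summable_pow_mul (h : QuasiGreedy b d R) {x : ℝ} (hx0 : 0 ≤ x) (hx1 : x < 1) (k : ℕ) :
    Summable fun i => x ^ d i * (d i : ℝ) ^ k := by
  obtain ⟨c, hc1, hc⟩ := h.exists_index_lt
  obtain ⟨x', h1, h2⟩ := exists_between hx1
  have hx' : 0 < x' := hx0.trans_lt h1
  have hx'0 : x' ≠ 0 := hx'.ne'
  have hc0 : (c : ℝ) ≠ 0 := by positivity
  -- Part of the decay, from x to x', absorbs the power of d_i; the rest, with y^c = x' and i < c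
  -- d_i, becomes a geometric series in i.
  set y := x' ^ ((c : ℝ)⁻¹) with hy
  have hy0 : 0 < y := Real.rpow_pos_of_pos hx' _
  have hy1 : y < 1 := Real.rpow_lt_one hx'.le h2 (by positivity)
  have hyc : y ^ c = x' := Real.rpow_inv_natCast_pow hx'.le (by omega)
  have hlim : Tendsto (fun n : ℕ => (n : ℝ) ^ k * (x / x') ^ n) atTop (𝓝 0) :=
    tendsto_pow_const_mul_const_pow_of_abs_lt_one k (by
      rw [abs_of_nonneg (by positivity), div_lt_one hx']; exact h1)
  obtain ⟨M, hM⟩ := hlim.bddAbove_range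
  have hM' : ∀ n : ℕ, (n : ℝ) ^ k * (x / x') ^ n ≤ M := fun n => hM ⟨n, rfl⟩
  have hM0 : 0 ≤ M := le_trans (by positivity) (hM' 0)
  refine Summable.of_nonneg_of_le (fun i => by positivity) (fun i => ?_)
    ((summable_geometric_of_lt_one hy0.le hy1).mul_left M)
  calc x ^ d i * (d i : ℝ) ^ k = ((d i : ℝ) ^ k * (x / x') ^ d i) * x' ^ d i := by
        rw [div_pow]; field_simp
    _ ≤ M * x' ^ d i := by gcongr; exact hM' _
    _ = M * y ^ (c * d i) := by rw [← hyc, pow_mul]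
    _ ≤ M * y ^ i := by
        gcongr M * ?_
        exact pow_le_pow_of_le_one hy0.le hy1.le (hc i).le

theorem summable_mul (h : QuasiGreedy b d R) {f : ℕ → ℝ} {A : ℝ} {k : ℕ}
    (hf : ∀ i, |f i| ≤ A * (d i : ℝ) ^ k) : Summable fun i => b ^ d i * f i := by
  refine Summable.of_norm_bounded ((h.summable_pow_mul h.b_pos.le h.b_lt k).mul_left A) fun i => ?_
  rw [Real.norm_eq_abs, abs_mul, abs_of_pos (pow_pos h.b_pos _)]
  have := mul_le_mul_of_nonneg_left (hf i) (pow_pos h.b_pos (d i)).le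
  linarith

/-- Truncated sums `∑ i, b ^ d i * f i * y (N - d i)` converge exponentially fast when `y` does. -/
theorem exists_abs_sum_sub_le (h : QuasiGreedy b d R) {f y : ℕ → ℝ} {q y₀ A D : ℝ} {k : ℕ}
    (hq : b < q) (hq1 : q ≤ 1) (hf : ∀ i, |f i| ≤ A * (d i : ℝ) ^ k)
    (hy : ∀ n, |y n - y₀| ≤ D * q ^ n) :
    ∃ K, ∀ N, |∑ i ∈ Finset.range (cnt d N), b ^ d i * f i * y (N - d i) -
      y₀ * ∑' i, b ^ d i * f i| ≤ K * q ^ N := by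
  have hb := h.b_pos
  have hq0 : 0 < q := hb.trans hq
  have hD : 0 ≤ D := by have := (abs_nonneg _).trans (hy 0); simpa using this
  have hsum := h.summable_pow_mul (x := b / q) (by positivity) ((div_lt_one hq0).2 hq) k
  refine ⟨∑' i, (D + |y₀|) * A * ((b / q) ^ d i * (d i : ℝ) ^ k), fun N => ?_⟩
  have h1 : ∑ i ∈ Finset.range (cnt d N), b ^ d i * f i * y (N - d i) =
      ∑' i, if d i ≤ N then b ^ d i * f i * y (N - d i) else 0 := by
    rw [tsum_eq_sum (s := Finset.range (cnt d N))]
    · refine Finset.sum_congr rfl fun i hi => ?_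
      rw [if_pos (h.lt_cnt_iff.1 (Finset.mem_range.1 hi))]
    · intro i hi
      rw [if_neg]
      rwa [Finset.mem_range, h.lt_cnt_iff] at hi
  have hs1 : Summable fun i => if d i ≤ N then b ^ d i * f i * y (N - d i) else 0 := by
    refine summable_of_ne_finset_zero (s := Finset.range (cnt d N)) fun i hi => ?_
    rw [if_neg]
    rwa [Finset.mem_range, h.lt_cnt_iff] at hi
  rw [h1, ← tsum_mul_left, ← hs1.tsum_sub ((h.summable_mul hf).mul_left y₀), ← Real.norm_eq_abs,
    mul_comm _ (q ^ N)]
  refine tsum_of_norm_bounded (((hsum.mul_left ((D + |y₀|) * A)).hasSum).mul_left (q ^ N))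
    fun i => ?_
  have hpow : q ^ d i * (b / q) ^ d i = b ^ d i := by rw [← mul_pow]; congr 1; field_simp
  -- In both cases q^N times a summable term appears. For d_i ≤ N the error of y costs q^{N-d_i},
  -- and b^{d_i} = q^{d_i} (b/q)^{d_i} supplies the missing factor. For d_i > N the omitted term is
  -- paid for by q^{d_i} ≤ q^N.
  split_ifs with hi
  · have e1 : q ^ N = q ^ (N - d i) * q ^ d i := by rw [← pow_add]; congr 1; omega
    have e2 : b ^ d i * f i * y (N - d i) - y₀ * (b ^ d i * f i) =
      b ^ d i * (f i * (y (N - d i) - y₀)) := by ring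
    rw [e2, Real.norm_eq_abs, abs_mul, abs_of_pos (pow_pos hb _), abs_mul]
    have hA : 0 ≤ A * (d i : ℝ) ^ k := (abs_nonneg _).trans (hf i)
    calc b ^ d i * (|f i| * |y (N - d i) - y₀|)
        ≤ b ^ d i * ((A * (d i : ℝ) ^ k) * (D * q ^ (N - d i))) := by
          gcongr; exacts [hf i, hy _]
      _ ≤ b ^ d i * ((A * (d i : ℝ) ^ k) * ((D + |y₀|) * q ^ (N - d i))) := by
          gcongr; linarith [abs_nonneg y₀]
      _ = q ^ N * ((D + |y₀|) * A * ((b / q) ^ d i * (d i : ℝ) ^ k)) := by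
          rw [e1, ← hpow]; ring
  · have hA : 0 ≤ A * (d i : ℝ) ^ k := (abs_nonneg _).trans (hf i)
    rw [zero_sub, norm_neg, Real.norm_eq_abs, abs_mul, abs_mul, abs_of_pos (pow_pos hb _)]
    calc |y₀| * (b ^ d i * |f i|) ≤ |y₀| * (b ^ d i * (A * (d i : ℝ) ^ k)) := by
          gcongr; exact hf i
      _ ≤ (D + |y₀|) * (b ^ d i * (A * (d i : ℝ) ^ k)) := by gcongr; linarith
      _ = q ^ d i * ((D + |y₀|) * A * ((b / q) ^ d i * (d i : ℝ) ^ k)) := by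
          rw [← hpow]; ring
      _ ≤ _ := by
          have : 0 ≤ (D + |y₀|) * A * ((b / q) ^ d i * (d i : ℝ) ^ k) := by
            have e : (D + |y₀|) * A * ((b / q) ^ d i * (d i : ℝ) ^ k) =
              (D + |y₀|) * (b / q) ^ d i * (A * (d i : ℝ) ^ k) := by ring
            rw [e]; positivity
          exact mul_le_mul_of_nonneg_right
            (pow_le_pow_of_le_one hq0.le hq1 (not_le.1 hi).le) this

theorem sum_range_le_one (h : QuasiGreedy b d R) (n : ℕ) :
    ∑ i ∈ Finset.range n, b ^ d i ≤ 1 := by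
  rw [h.sum_range]; linarith [h.pos n]

/-- A subsolution of the renewal equation is bounded by the accumulated forcing terms. -/
theorem le_sum_of_renewal (h : QuasiGreedy b d R) {x e : ℕ → ℝ} (he : ∀ n, 0 ≤ e n)
    (hx : ∀ N, x N ≤ ∑ i ∈ Finset.range (cnt d N), b ^ d i * x (N - d i) + e N) (N : ℕ) :
    x N ≤ ∑ k ∈ Finset.range (N + 1), e k := by
  induction N using Nat.strong_induction_on with
  | _ N ih =>
    have hs : 0 ≤ ∑ k ∈ Finset.range N, e k := Finset.sum_nonneg fun k _ => he k
    rw [Finset.sum_range_succ]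
    refine (hx N).trans (add_le_add_left ?_ _)
    calc _ ≤ ∑ i ∈ Finset.range (cnt d N), b ^ d i * ∑ k ∈ Finset.range N, e k := by
          refine Finset.sum_le_sum fun i hi => ?_
          have h1 := h.lt_cnt_iff.1 (Finset.mem_range.1 hi)
          have h2 := h.one_le i
          refine mul_le_mul_of_nonneg_left ?_ (pow_pos h.b_pos _).le
          refine (ih (N - d i) (by omega)).trans ?_
          refine Finset.sum_le_sum_of_subset_of_nonneg ?_ fun k _ _ => he k
          exact Finset.range_subset_range.2 (by omega)
      _ ≤ 1 * ∑ k ∈ Finset.range N, e k := by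
          rw [← Finset.sum_mul]
          exact mul_le_mul_of_nonneg_right (h.sum_range_le_one _) hs
      _ = _ := one_mul _

/-- Summation by parts against the weights `b ^ d i`. -/
theorem hasSum_mul_partial_sum (h : QuasiGreedy b d R) {u : ℕ → ℝ} (hu0 : ∀ i, 0 ≤ u i)
    (hu1 : ∀ i, u i ≤ 1) {s : ℝ}
    (hs : HasSum (fun i => b ^ d i * ∑ l ∈ Finset.range i, u l) s) :
    HasSum (fun l => u l * R (l + 1)) s := by
  rw [hasSum_iff_tendsto_nat_of_nonneg (fun i => mul_nonneg (hu0 i) (h.pos _).le)]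
  -- Abel summation with b^{d_n} = R_n - R_{n+1}. The boundary term is at most n(1-b)^n.
  have h1 : ∀ n, ∑ l ∈ Finset.range n, u l * R (l + 1) =
      ∑ i ∈ Finset.range n, b ^ d i * ∑ l ∈ Finset.range i, u l +
        R n * ∑ l ∈ Finset.range n, u l := by
    intro n
    induction n with
    | zero => simp
    | succ n ih =>
      simp only [Finset.sum_range_succ, ih]
      have := h.succ n
      have e : b ^ d n = R n - R (n + 1) := by linarith
      rw [e]; ring
  simp_rw [h1]
  have h2 : Tendsto (fun n => R n * ∑ l ∈ Finset.range n, u l) atTop (𝓝 0) := by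
    have h3 : Tendsto (fun n : ℕ => (n : ℝ) * (1 - b) ^ n) atTop (𝓝 0) :=
      tendsto_self_mul_const_pow_of_lt_one (by linarith [h.b_lt]) (by linarith [h.b_pos])
    refine squeeze_zero (fun n => mul_nonneg (h.pos n).le (Finset.sum_nonneg fun l _ => hu0 l))
      (fun n => ?_) h3
    rw [mul_comm]
    have h4 : ∑ l ∈ Finset.range n, u l ≤ n := by
      refine (Finset.sum_le_card_nsmul _ _ 1 fun l _ => hu1 l).trans (by simp)
    exact mul_le_mul h4 (h.le_pow n) (h.pos n).le (Nat.cast_nonneg _)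
  simpa using hs.tendsto_sum_nat.add h2

end QuasiGreedy

/-! ### Greedy decompositions and splitting into blocks -/

theorem topIndex_eq {Z : ℕ → ℕ} (hmono : Monotone Z) {n m : ℕ} (h1 : Z n ≤ m)
    (h2 : m < Z (n + 1)) : topIndex Z m = n := by
  have hub : ∀ j ∈ {j | Z j ≤ m}, j ≤ n := fun j hj => by
    by_contra hcon
    have : Z (n + 1) ≤ Z j := hmono (by omega)
    have h3 : Z j ≤ m := hj
    omega
  exact le_antisymm (csSup_le ⟨n, h1⟩ hub) (le_csSup ⟨n, hub⟩ h1)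

theorem greedy_of_le {Z : ℕ → ℕ} (hmono : Monotone Z) (hpos : ∀ n, 0 < Z n) {n m : ℕ}
    (h1 : Z n ≤ m) (h2 : m < Z (n + 1)) : greedy Z m = n :: greedy Z (m - Z n) := by
  rw [greedy, topIndex_eq hmono h1 h2, dif_pos ⟨hpos n, h1⟩]

theorem greedy_of_lt {Z : ℕ → ℕ} (hmono : Monotone Z) {m : ℕ} (h : m < Z 0) :
    greedy Z m = [] := by
  rw [greedy, dif_neg]
  rintro ⟨-, h2⟩
  exact absurd (h.trans_le (hmono (Nat.zero_le _))) (not_lt.2 h2)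

theorem exists_index {Z : ℕ → ℕ} {m : ℕ} (h0 : Z 0 ≤ m) {N : ℕ} (hN : m < Z N) :
    ∃ n < N, Z n ≤ m ∧ m < Z (n + 1) := by
  induction N with
  | zero => omega
  | succ N ih =>
    by_cases h : m < Z N
    · obtain ⟨n, hn, h1⟩ := ih h
      exact ⟨n, by omega, h1⟩
    · exact ⟨N, by omega, not_lt.1 h, hN⟩

theorem length_greedy_le {Z : ℕ → ℕ} (hmono : Monotone Z) (hpos : ∀ n, 0 < Z n) {Q : ℕ}
    (hQ : ∀ n, Z (n + 1) ≤ Q * Z n) (N m : ℕ) (hm : m < Z N) :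
    (greedy Z m).length ≤ Q * N := by
  -- The quotient m / Z N accounts for the repeated use of index N; below Z N, each smaller index is
  -- charged at most Q uses.
  suffices h : ∀ N m, m < Z (N + 1) → (greedy Z m).length ≤ m / Z N + Q * N by
    cases N with
    | zero => simp [greedy_of_lt hmono hm]
    | succ N =>
      have h1 := h N m hm
      have h2 : m / Z N ≤ Q := by
        rw [Nat.div_le_iff_le_mul_add_pred (hpos N)]
        have := hQ N
        rw [mul_comm] at this
        omega
      rw [mul_add]; omega
  intro N
  induction N with
  | zero =>
    intro m
    induction m using Nat.strong_induction_on with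
    | _ m ih =>
      intro hm
      by_cases h0 : m < Z 0
      · simp [greedy_of_lt hmono h0]
      · have h1 := not_lt.1 h0
        have h2 := ih (m - Z 0) (by have := hpos 0; omega) (by omega)
        rw [greedy_of_le hmono hpos h1 hm, List.length_cons, Nat.div_eq_sub_div (hpos 0) h1]
        omega
  | succ N ihN =>
    intro m
    induction m using Nat.strong_induction_on with
    | _ m ih =>
      intro hm
      by_cases h0 : m < Z (N + 1)
      · have h1 := ihN m h0
        have h2 : m / Z N ≤ Q := by
          rw [Nat.div_le_iff_le_mul_add_pred (hpos N)]
          have := hQ N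
          rw [mul_comm] at this
          omega
        have : Q * (N + 1) = Q * N + Q := by ring
        refine le_trans ?_ (Nat.le_add_left _ _)
        omega
      · have h1 := not_lt.1 h0
        have h2 := ih (m - Z (N + 1)) (by have := hpos (N + 1); omega) (by omega)
        rw [greedy_of_le hmono hpos h1 hm, List.length_cons, Nat.div_eq_sub_div (hpos _) h1]
        omega

section Sums

variable {E : Type} [NormedAddCommGroup E]

/-- The sum of `Φ` over the greedy decompositions of all integers below `x`. -/
noncomputable def greedySum (Z : ℕ → ℕ) (Φ : List ℕ → E) (x : ℕ) : E :=
  ∑ m ∈ Finset.range x, Φ (greedy Z m)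

/-- All integers from Z n up to Z (n+1) have first greedy index n, so a translate of an initial
interval contributes with n prepended, as long as it does not reach past Z (n+1). -/
theorem greedySum_add {Z : ℕ → ℕ} (hmono : Monotone Z) (hpos : ∀ n, 0 < Z n) (Φ : List ℕ → E)
    {n t : ℕ} (h : Z n + t ≤ Z (n + 1)) :
    greedySum Z Φ (Z n + t) = greedySum Z Φ (Z n) + greedySum Z (fun l => Φ (n :: l)) t := by
  rw [greedySum, Finset.sum_range_add]
  congr 1
  refine Finset.sum_congr rfl fun m hm => ?_
  have := Finset.mem_range.1 hm
  rw [greedy_of_le hmono hpos (n := n) (by omega) (by omega), Nat.add_sub_cancel_left]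

theorem norm_greedySum_sub_le {Z : ℕ → ℕ} {Φ : List ℕ → E} {B : ℝ} (hB : ∀ l, ‖Φ l‖ ≤ B)
    {x y : ℕ} (hxy : x ≤ y) :
    ‖greedySum Z Φ y - greedySum Z Φ x‖ ≤ B * ((y : ℝ) - x) := by
  rw [greedySum, greedySum, Finset.sum_range_sub_sum_range hxy]
  refine (norm_sum_le_of_le _ fun m _ => hB _).trans ?_
  have hc : ((Finset.range y).filter fun k => x ≤ k).card = y - x := by
    have : ((Finset.range y).filter fun k => x ≤ k) = Finset.Ico x y := by
      ext k; simp; omega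
    rw [this, Nat.card_Ico]
  rw [Finset.sum_const, hc, nsmul_eq_mul, Nat.cast_sub hxy, mul_comm]

theorem norm_greedySum_sub_le_abs {Z : ℕ → ℕ} {Φ : List ℕ → E} {B : ℝ} (hB : ∀ l, ‖Φ l‖ ≤ B)
    (x y : ℕ) : ‖greedySum Z Φ y - greedySum Z Φ x‖ ≤ B * |(y : ℝ) - x| := by
  rcases le_total x y with h | h
  · have h' : (x : ℝ) ≤ y := by exact_mod_cast h
    rw [abs_of_nonneg (by linarith)]
    exact norm_greedySum_sub_le hB h
  · have h' : (y : ℝ) ≤ x := by exact_mod_cast h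
    rw [norm_sub_rev, abs_sub_comm, abs_of_nonneg (by linarith)]
    exact norm_greedySum_sub_le hB h

/-- Only the at most δ integers beyond Z (n+1) violate the exact splitting; each is charged B in
either of the two sums. -/
theorem norm_greedySum_add_sub_le {Z : ℕ → ℕ} (hmono : Monotone Z) (hpos : ∀ n, 0 < Z n)
    {Φ : List ℕ → E} {B δ : ℝ} (hB : ∀ l, ‖Φ l‖ ≤ B) (hδ : 0 ≤ δ) {n t : ℕ}
    (h : (Z n : ℝ) + t - Z (n + 1) ≤ δ) :
    ‖greedySum Z Φ (Z n + t) - greedySum Z Φ (Z n) - greedySum Z (fun l => Φ (n :: l)) t‖ ≤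
      2 * B * δ := by
  have hB0 : 0 ≤ B := (norm_nonneg _).trans (hB [])
  rcases le_total (Z n + t) (Z (n + 1)) with h1 | h1
  · rw [greedySum_add hmono hpos Φ h1]
    simp only [add_sub_cancel_left, sub_self, norm_zero]
    positivity
  · have hle := hmono (Nat.le_succ n)
    obtain ⟨t₀, ht₀⟩ := Nat.exists_eq_add_of_le hle
    rw [Nat.succ_eq_add_one] at ht₀
    have h2 := greedySum_add hmono hpos Φ (n := n) (t := t₀) ht₀.ge
    have ht : t₀ ≤ t := by omega
    have h3 := norm_greedySum_sub_le (Z := Z) hB (show Z n + t₀ ≤ Z n + t by omega)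
    have h4 := norm_greedySum_sub_le (Z := Z) (fun l => hB (n :: l)) ht
    have e : greedySum Z Φ (Z n + t) - greedySum Z Φ (Z n) - greedySum Z (fun l => Φ (n :: l)) t =
        (greedySum Z Φ (Z n + t) - greedySum Z Φ (Z n + t₀)) -
          (greedySum Z (fun l => Φ (n :: l)) t - greedySum Z (fun l => Φ (n :: l)) t₀) := by
      rw [h2]; abel
    rw [e]
    refine (norm_sub_le _ _).trans ((add_le_add h3 h4).trans ?_)
    have h5 : (t : ℝ) - t₀ ≤ δ := by
      rw [ht₀] at h; push_cast at h; linarith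
    push_cast
    have := mul_le_mul_of_nonneg_left h5 hB0
    linarith

/-- The first `i` indices `N - d 0, N - d 1, …`. -/
def expPrefix (d : ℕ → ℕ) (N i : ℕ) : List ℕ := (List.range i).map fun l => N - d l

theorem expPrefix_succ (d : ℕ → ℕ) (N i : ℕ) :
    expPrefix d N (i + 1) = expPrefix d N i ++ [N - d i] := by
  simp [expPrefix, List.range_succ]

/-- The blocks are peeled off from the left. The hypothesis says that the blocks from i on, placed
one after another, overshoot Z (N - d i + 1) by at most δ, so prepending N - d i stays greedy
outside δ integers. -/
theorem norm_greedySum_sum_sub_le {Z : ℕ → ℕ} (hmono : Monotone Z) (hpos : ∀ n, 0 < Z n)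
    {Φ : List ℕ → E} {B δ : ℝ} (hB : ∀ l, ‖Φ l‖ ≤ B) (hδ : 0 ≤ δ) {d : ℕ → ℕ} {N j : ℕ}
    (h : ∀ i < j, (∑ l ∈ Finset.Ico i j, (Z (N - d l) : ℝ)) - Z (N - d i + 1) ≤ δ) :
    ‖greedySum Z Φ (∑ l ∈ Finset.range j, Z (N - d l)) - ∑ i ∈ Finset.range j,
      greedySum Z (fun l => Φ (expPrefix d N i ++ l)) (Z (N - d i))‖ ≤ j * (2 * B * δ) := by
  suffices hs : ∀ k ≤ j, ‖greedySum Z Φ (∑ l ∈ Finset.range j, Z (N - d l)) -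
      ∑ i ∈ Finset.range k, greedySum Z (fun l => Φ (expPrefix d N i ++ l)) (Z (N - d i)) -
      greedySum Z (fun l => Φ (expPrefix d N k ++ l)) (∑ l ∈ Finset.Ico k j, Z (N - d l))‖ ≤
      k * (2 * B * δ) by
    have := hs j le_rfl
    simpa [greedySum] using this
  intro k
  induction k with
  | zero => intro _; simp [expPrefix]
  | succ k ih =>
    intro hk
    have h1 := ih (by omega)
    have h2 := h k (by omega)
    rw [Finset.sum_eq_sum_Ico_succ_bot (by omega)] at h1 h2
    have h3 := norm_greedySum_add_sub_le hmono hpos (Φ := fun l => Φ (expPrefix d N k ++ l))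
      (B := B) (δ := δ) (fun l => hB _) hδ (n := N - d k)
      (t := ∑ l ∈ Finset.Ico (k + 1) j, Z (N - d l)) (by push_cast; exact h2)
    have e : (fun l => Φ (expPrefix d N k ++ (N - d k) :: l)) =
        fun l => Φ (expPrefix d N (k + 1) ++ l) := by
      funext l; rw [expPrefix_succ, List.append_assoc, List.singleton_append]
    rw [e] at h3
    rw [Finset.sum_range_succ]
    have := norm_add_le_of_le h1 h3
    push_cast
    convert this using 1
    · congr 1; abel
    · ring

end Sums

/-! ### The approximate renewal equation -/

section Core

variable {E : Type} [NormedAddCommGroup E]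

/-- There are O(N) blocks, and each total of block lengths is known up to O(N r^N), being a sum of
O(N) terms of `Z`. The product of the two gives the factor (N+1)^2 r^N. -/
theorem ExpGrowth.exists_norm_greedySum_sub_le {Z : ℕ → ℕ} {a lam r C : ℝ}
    (hZ : ExpGrowth Z a lam r C) {d : ℕ → ℕ} {R : ℕ → ℝ} (hd : QuasiGreedy lam⁻¹ d R) :
    ∃ K, ∀ (N : ℕ) (B : ℝ) (Φ : List ℕ → E), (∀ l, ‖Φ l‖ ≤ B) →
      ‖greedySum Z Φ (Z N) - ∑ i ∈ Finset.range (cnt d N),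
        greedySum Z (fun l => Φ (expPrefix d N i ++ l)) (Z (N - d i))‖ ≤
      K * B * ((N : ℝ) + 1) ^ 2 * r ^ N := by
  have hr : 1 < r := hZ.one_lt_r
  have hl : 1 < lam := hr.trans hZ.r_lt
  have hl0 : lam ≠ 0 := by positivity
  have ha := hZ.a_pos
  have hC : 0 ≤ C := by have := (abs_nonneg _).trans (hZ.err 0); simpa using this
  obtain ⟨c, hc1, hc⟩ := hd.exists_index_lt
  have hc1' : (1 : ℝ) ≤ c := by exact_mod_cast hc1
  refine ⟨a + 2 * C * c + c * (2 * (2 * C * c)), fun N B Φ hB => ?_⟩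
  have hB0 : 0 ≤ B := (norm_nonneg _).trans (hB [])
  set j := cnt d N with hj
  have hjle : (j : ℝ) ≤ c * (N + 1) := by exact_mod_cast hd.cnt_le hc N
  have hlt : ∀ i < j, d i ≤ N := fun i hi => hd.lt_cnt_iff.1 hi
  have hrN : 1 ≤ r ^ N := one_le_pow₀ hr.le
  have herr : ∀ n ≤ N, |(Z n : ℝ) - a * lam ^ n| ≤ C * r ^ N := fun n hn =>
    (hZ.err n).trans (by gcongr; exact hr.le)
  have hpow : ∀ i < j, lam ^ (N - d i) = lam ^ N * lam⁻¹ ^ d i := fun i hi => by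
    rw [inv_pow, pow_sub₀ _ hl0 (hlt i hi)]
  have htail : ∀ i ≤ j, |∑ l ∈ Finset.Ico i j, (Z (N - d l) : ℝ) -
      a * lam ^ N * (R i - R j)| ≤ C * c * (N + 1) * r ^ N := by
    intro i hi
    have e : a * lam ^ N * (R i - R j) = ∑ l ∈ Finset.Ico i j, a * lam ^ (N - d l) := by
      have h1 : R i - R j = ∑ l ∈ Finset.Ico i j, lam⁻¹ ^ d l := by
        rw [Finset.sum_Ico_eq_sub _ hi, hd.sum_range, hd.sum_range]; ring
      rw [h1, Finset.mul_sum]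
      refine Finset.sum_congr rfl fun l hl' => ?_
      rw [hpow l (Finset.mem_Ico.1 hl').2]; ring
    rw [e, ← Finset.sum_sub_distrib]
    refine (Finset.abs_sum_le_sum_abs _ _).trans
      ((Finset.sum_le_card_nsmul _ _ _ fun l _ => herr _ (Nat.sub_le _ _)).trans ?_)
    rw [Nat.card_Ico, nsmul_eq_mul]
    have h2 : ((j - i : ℕ) : ℝ) ≤ c * (N + 1) := by
      refine le_trans ?_ hjle; exact_mod_cast Nat.sub_le _ _
    have h3 : 0 ≤ C * r ^ N := by positivity
    calc _ ≤ (c * (N + 1)) * (C * r ^ N) := by gcongr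
      _ = _ := by ring
  have hbase : C * r ^ N ≤ C * c * (N + 1) * r ^ N := by
    have h1 : (1 : ℝ) ≤ c * (N + 1) := by
      have : (0 : ℝ) ≤ N := Nat.cast_nonneg _
      nlinarith
    calc C * r ^ N = C * 1 * r ^ N := by ring
      _ ≤ C * (c * (N + 1)) * r ^ N := by gcongr
      _ = _ := by ring
  set δ := 2 * C * c * (N + 1) * r ^ N with hδ
  have hδ0 : 0 ≤ δ := by positivity
  have hδ2 : δ = C * c * (N + 1) * r ^ N + C * c * (N + 1) * r ^ N := by rw [hδ]; ring
  have hstep := norm_greedySum_sum_sub_le hZ.mono hZ.pos (Φ := Φ) (B := B) (δ := δ) hB hδ0 (d := d)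
    (N := N) (j := j) (fun i hi => by
      have h1 := (abs_le.1 (htail i hi.le)).2
      have h2 := (abs_le.1 (herr (N - d i + 1) (by have := hlt i hi; have := hd.one_le i; omega))).1
      have h3 : a * lam ^ N * (R i - R j) ≤ a * lam ^ (N - d i + 1) := by
        rw [pow_succ, hpow i hi, mul_assoc, mul_assoc]
        -- Maximality of the digit d i: to leading order, the blocks from i on fit below Z (N - d i
        -- + 1).
        have h4 : R i ≤ lam⁻¹ ^ d i * lam := by
          have := hd.le i
          rwa [← div_eq_mul_inv, div_le_iff₀ (by linarith)] at this
        have h5 := hd.pos j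
        gcongr
        linarith
      linarith)
  have hZN : |(Z N : ℝ) - (∑ l ∈ Finset.range j, Z (N - d l) : ℕ)| ≤ a + δ := by
    have h1 := htail 0 (Nat.zero_le _)
    rw [hd.zero, ← Finset.range_eq_Ico] at h1
    have h2 := herr N le_rfl
    have h3 : a * lam ^ N * R j ≤ a := by
      have h7 : lam ^ N * lam⁻¹ ^ N = 1 := by rw [← mul_pow, mul_inv_cancel₀ hl0, one_pow]
      calc a * lam ^ N * R j ≤ a * lam ^ N * lam⁻¹ ^ N := by gcongr; exact hd.remainder_cnt_le N
        _ = a := by rw [mul_assoc, h7, mul_one]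
    have h8 : 0 ≤ a * lam ^ N * R j := by have := hd.pos j; positivity
    push_cast
    rw [abs_le] at h1 h2 ⊢
    constructor <;> linarith [h1.1, h1.2, h2.1, h2.2]
  have hfirst := norm_greedySum_sub_le_abs (Z := Z) hB (∑ l ∈ Finset.range j, Z (N - d l)) (Z N)
  have := norm_add_le_of_le hfirst hstep
  rw [sub_add_sub_cancel] at this
  refine this.trans ?_
  have hN1 : (1 : ℝ) ≤ N + 1 := by have : (0 : ℝ) ≤ N := Nat.cast_nonneg _; linarith
  have hN2 : (N : ℝ) + 1 ≤ (N + 1) ^ 2 := by nlinarith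
  have i1 : B * a ≤ B * (a * ((N + 1) ^ 2 * r ^ N)) := by
    have : 1 ≤ ((N : ℝ) + 1) ^ 2 * r ^ N := one_le_mul_of_one_le_of_one_le (hN1.trans hN2) hrN
    gcongr; exact le_mul_of_one_le_right ha.le this
  have i2 : B * δ ≤ B * (2 * C * c * (N + 1) ^ 2 * r ^ N) := by rw [hδ]; gcongr
  have i3 : (j : ℝ) * (2 * B * δ) ≤ c * (N + 1) * (2 * B * δ) := by gcongr
  calc _ ≤ B * (a + δ) + j * (2 * B * δ) := by gcongr
    _ ≤ B * (a * ((N + 1) ^ 2 * r ^ N)) + B * (2 * C * c * (N + 1) ^ 2 * r ^ N) +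
        c * (N + 1) * (2 * B * δ) := by linarith
    _ = _ := by rw [hδ]; ring

theorem ExpGrowth.exists_ratio_bound {Z : ℕ → ℕ} {a lam r C : ℝ}
    (hZ : ExpGrowth Z a lam r C) : ∃ Q : ℕ, ∀ n, Z (n + 1) ≤ Q * Z n := by
  have hr : 1 < r := hZ.one_lt_r
  have hl : 1 < lam := hr.trans hZ.r_lt
  have hC : 0 ≤ C := by have := (abs_nonneg _).trans (hZ.err 0); simpa using this
  have ha := hZ.a_pos
  have hlim : Tendsto (fun n : ℕ => C * (r / lam) ^ n) atTop (𝓝 (C * 0)) :=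
    (tendsto_pow_atTop_nhds_zero_of_lt_one (by positivity)
      ((div_lt_one (by linarith)).2 hZ.r_lt)).const_mul C
  rw [mul_zero] at hlim
  obtain ⟨n₀, hn₀⟩ := eventually_atTop.1 (hlim.eventually (gt_mem_nhds (half_pos ha)))
  obtain ⟨Q₁, hQ₁⟩ := exists_nat_ge ((a * lam + C * r) / (a / 2) * 1)
  obtain ⟨Q₂, hQ₂⟩ : ∃ Q₂, ∀ n < n₀, Z (n + 1) ≤ Q₂ := by
    refine ⟨Z n₀, fun n hn => hZ.mono hn⟩
  refine ⟨max Q₁ Q₂, fun n => ?_⟩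
  by_cases hn : n < n₀
  · calc Z (n + 1) ≤ Q₂ * 1 := by rw [mul_one]; exact hQ₂ n hn
      _ ≤ max Q₁ Q₂ * Z n := Nat.mul_le_mul (le_max_right _ _) (hZ.pos n)
  · have h1 := hn₀ n (not_lt.1 hn)
    have h2 : C * r ^ n ≤ a / 2 * lam ^ n := by
      have : C * r ^ n = C * (r / lam) ^ n * lam ^ n := by rw [div_pow]; field_simp
      rw [this]; gcongr
    have h3 : a / 2 * lam ^ n ≤ Z n := by
      have := (abs_le.1 (hZ.err n)).1
      linarith
    have h4 : (Z (n + 1) : ℝ) ≤ (a * lam + C * r) * lam ^ n := by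
      have h5 := (abs_le.1 (hZ.err (n + 1))).2
      have h6 : C * r ^ (n + 1) ≤ C * r * lam ^ n := by
        rw [pow_succ, mul_comm (r ^ n), ← mul_assoc]
        gcongr
        exact hZ.r_lt.le
      have h7 : a * lam ^ (n + 1) = a * lam * lam ^ n := by ring
      linarith
    have h8 : (Z (n + 1) : ℝ) ≤ Q₁ * Z n := by
      rw [mul_one, div_le_iff₀ (by positivity)] at hQ₁
      calc (Z (n + 1) : ℝ) ≤ (a * lam + C * r) * lam ^ n := h4
        _ ≤ Q₁ * (a / 2) * lam ^ n := by gcongr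
        _ = Q₁ * (a / 2 * lam ^ n) := by ring
        _ ≤ Q₁ * Z n := by gcongr
    have h9 : Z (n + 1) ≤ Q₁ * Z n := by exact_mod_cast h8
    exact h9.trans (Nat.mul_le_mul_right _ (le_max_left _ _))

theorem greedySum_congr {Z : ℕ → ℕ} {Φ Ψ : List ℕ → E} {x : ℕ}
    (h : ∀ m < x, Φ (greedy Z m) = Ψ (greedy Z m)) : greedySum Z Φ x = greedySum Z Ψ x :=
  Finset.sum_congr rfl fun m hm => h m (Finset.mem_range.1 hm)

variable [NormedSpace ℝ E]

/-- The sum of `Φ` over the greedy decompositions of all integers below `Z n`, normalized by the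
asymptotic value `a * lam ^ n` of `Z n`. -/
noncomputable def greedyMean (Z : ℕ → ℕ) (a lam : ℝ) (Φ : List ℕ → E) (n : ℕ) : E :=
  (a * lam ^ n)⁻¹ • greedySum Z Φ (Z n)

/-- The renewal equation for statistics of greedy decompositions, up to an exponentially small
error. -/
theorem ExpGrowth.exists_renewal {Z : ℕ → ℕ} {a lam r C : ℝ}
    (hZ : ExpGrowth Z a lam r C) {d : ℕ → ℕ} {R : ℕ → ℝ} (hd : QuasiGreedy lam⁻¹ d R) :
    ∃ (K : ℝ) (L : ℕ), ∀ (N : ℕ) (B : ℝ) (Φ : List ℕ → E),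
      (∀ l, l.length ≤ L * (N + 1) → ‖Φ l‖ ≤ B) →
      ‖greedyMean Z a lam Φ N - ∑ i ∈ Finset.range (cnt d N), lam⁻¹ ^ d i •
        greedyMean Z a lam (fun l => Φ (expPrefix d N i ++ l)) (N - d i)‖ ≤
      K * B * ((N : ℝ) + 1) ^ 2 * (r / lam) ^ N := by
  obtain ⟨K, hK⟩ := hZ.exists_norm_greedySum_sub_le (E := E) hd
  obtain ⟨Q, hQ⟩ := hZ.exists_ratio_bound
  obtain ⟨c, hc1, hc⟩ := hd.exists_index_lt
  have hl : 1 < lam := hZ.one_lt_r.trans hZ.r_lt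
  have hl0 : lam ≠ 0 := by positivity
  have ha := hZ.a_pos
  refine ⟨K / a, c + Q, fun N B Φ hΦ => ?_⟩
  have hB0 : 0 ≤ B := (norm_nonneg _).trans (hΦ [] (by simp))
  -- Cutting `Φ` off at long lists makes it globally bounded without changing it on any list that
  -- occurs, since both prefixes and greedy decompositions have length O(N + 1).
  let Ψ : List ℕ → E := fun l => if l.length ≤ (c + Q) * (N + 1) then Φ l else 0
  have hΨ : ∀ l, ‖Ψ l‖ ≤ B := fun l => by
    by_cases h : l.length ≤ (c + Q) * (N + 1)
    · simp only [Ψ, if_pos h]; exact hΦ l h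
    · simp only [Ψ, if_neg h, norm_zero]; exact hB0
  have h1 := hK N B Ψ hΨ
  have e1 : greedySum Z Ψ (Z N) = greedySum Z Φ (Z N) := greedySum_congr fun m hm => by
    refine if_pos ((length_greedy_le hZ.mono hZ.pos hQ N m hm).trans ?_)
    exact Nat.mul_le_mul (Nat.le_add_left _ _) (Nat.le_succ _)
  have e2 : ∀ i ∈ Finset.range (cnt d N),
      greedySum Z (fun l => Ψ (expPrefix d N i ++ l)) (Z (N - d i)) =
      greedySum Z (fun l => Φ (expPrefix d N i ++ l)) (Z (N - d i)) := fun i hi => by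
    refine greedySum_congr fun m hm => if_pos ?_
    have h2 := length_greedy_le hZ.mono hZ.pos hQ _ m hm
    have h3 : i ≤ c * (N + 1) := (Finset.mem_range.1 hi).le.trans (hd.cnt_le hc N)
    have h4 : Q * (N - d i) ≤ Q * (N + 1) := Nat.mul_le_mul_left _ (by omega)
    rw [List.length_append, expPrefix, List.length_map, List.length_range, add_mul]
    omega
  rw [e1, Finset.sum_congr rfl e2] at h1
  have e3 : greedyMean Z a lam Φ N - ∑ i ∈ Finset.range (cnt d N), lam⁻¹ ^ d i •
        greedyMean Z a lam (fun l => Φ (expPrefix d N i ++ l)) (N - d i) =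
      (a * lam ^ N)⁻¹ • (greedySum Z Φ (Z N) - ∑ i ∈ Finset.range (cnt d N),
        greedySum Z (fun l => Φ (expPrefix d N i ++ l)) (Z (N - d i))) := by
    rw [smul_sub, Finset.smul_sum, greedyMean]
    congr 1
    refine Finset.sum_congr rfl fun i hi => ?_
    rw [greedyMean, smul_smul]
    congr 1
    have hle := hd.lt_cnt_iff.1 (Finset.mem_range.1 hi)
    rw [pow_sub₀ _ hl0 hle, inv_pow]
    field_simp
  rw [e3, norm_smul, norm_inv, Real.norm_eq_abs, abs_of_pos (by positivity)]
  calc _ ≤ (a * lam ^ N)⁻¹ * (K * B * ((N : ℝ) + 1) ^ 2 * r ^ N) := by gcongr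
    _ = _ := by rw [div_pow]; field_simp

end Core

/-! ### A renewal theorem with exponential rate -/

open Metric in
-- By uniqueness of power series at 0, the given series is the Taylor series of F, so its radius of
-- convergence exceeds 1.
theorem exists_norm_coeff_le {u : ℕ → ℂ} {F : ℂ → ℂ} {ρ : ℝ} (hρ : 1 < ρ)
    (hF : DifferentiableOn ℂ F (ball 0 ρ))
    (hu : ∀ z : ℂ, ‖z‖ < 1 → HasSum (fun n => u n * z ^ n) (F z)) :
    ∃ K q, 0 < q ∧ q < 1 ∧ ∀ n, ‖u n‖ ≤ K * q ^ n := by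
  obtain ⟨s, hs1, hs2⟩ := exists_between hρ
  obtain ⟨t, ht1, ht2⟩ := exists_between hs1
  lift s to NNReal using by linarith
  lift t to NNReal using by linarith
  have hs0 : 0 < s := by
    have : (0 : ℝ) < s := by linarith
    exact_mod_cast this
  have h1 := (hF.mono (closedBall_subset_ball hs2)).hasFPowerSeriesOnBall hs0
  have h2 : HasFPowerSeriesOnBall F (FormalMultilinearSeries.ofScalars ℂ u) 0 1 := by
    refine ⟨?_, one_pos, fun {y} hy => ?_⟩
    · refine ENNReal.le_of_forall_nnreal_lt fun x hx => ?_
      refine FormalMultilinearSeries.le_radius_of_tendsto _ (l := 0) ?_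
      have hx1 : (x : ℝ) < 1 := by exact_mod_cast hx
      have h3 := (hu (x : ℂ) (by simpa using hx1)).summable.norm.tendsto_atTop_zero
      refine h3.congr fun n => ?_
      simp
    · have hy1 : ‖y‖ < 1 := by
        have : (1 : ENNReal) = ENNReal.ofReal 1 := by simp
        rw [this, Metric.eball_ofReal, mem_ball_zero_iff] at hy
        exact hy
      have := hu y hy1
      rw [zero_add]
      simpa only [FormalMultilinearSeries.ofScalars_apply_eq, smul_eq_mul] using this
  have h3 := h1.hasFPowerSeriesAt.eq_formalMultilinearSeries h2.hasFPowerSeriesAt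
  have h4 : (t : ENNReal) < (FormalMultilinearSeries.ofScalars ℂ u).radius := by
    rw [← h3]
    refine lt_of_lt_of_le ?_ h1.r_le
    exact_mod_cast ht2
  obtain ⟨K, hK, hK'⟩ := (FormalMultilinearSeries.ofScalars ℂ u).norm_mul_pow_le_of_lt_radius h4
  refine ⟨K, (t : ℝ)⁻¹, by positivity, inv_lt_one_of_one_lt₀ ht1, fun n => ?_⟩
  have := hK' n
  rw [FormalMultilinearSeries.ofScalars_norm] at this
  rw [inv_pow, ← div_eq_mul_inv, le_div_iff₀ (by positivity)]
  exact this

open Metric in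
theorem differentiableOn_tsum_pow {u : ℕ → ℂ} {K q ρ : ℝ} (hq : 0 < q) (hρ : 0 < ρ)
    (hqρ : q * ρ < 1) (hu : ∀ n, ‖u n‖ ≤ K * q ^ n) :
    DifferentiableOn ℂ (fun z => ∑' n, u n * z ^ n) (ball 0 ρ) := by
  refine Complex.differentiableOn_tsum_of_summable_norm (u := fun n => K * (q * ρ) ^ n)
    ((summable_geometric_of_lt_one (by positivity) hqρ).mul_left K) (fun n => by fun_prop)
    isOpen_ball fun n z hz => ?_
  rw [mem_ball_zero_iff] at hz
  rw [norm_mul, norm_pow, mul_pow, ← mul_assoc]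
  have := (norm_nonneg _).trans (hu n)
  gcongr
  exact hu n

/-- Aperiodicity: taking real parts, equality would force Re z^n = 1 whenever b n > 0. The case n =
1 already gives z = 1. -/
theorem tsum_mul_pow_ne_one {b : ℕ → ℝ} (hb : ∀ n, 0 ≤ b n) (hb1 : 0 < b 1) (hbs : HasSum b 1)
    {z : ℂ} (hz : ‖z‖ ≤ 1) (hz1 : z ≠ 1) (hs : Summable fun n => (b n : ℂ) * z ^ n) :
    ∑' n, (b n : ℂ) * z ^ n ≠ 1 := by
  intro h
  have h1 : HasSum (fun n => (b n : ℂ) * z ^ n) 1 := h ▸ hs.hasSum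
  have h2 := hbs.sub (Complex.hasSum_re h1)
  simp only [Complex.re_ofReal_mul, Complex.one_re, sub_self] at h2
  have h3 : ∀ n, 0 ≤ b n - b n * (z ^ n).re := fun n => by
    have h4 : (z ^ n).re ≤ 1 := (Complex.re_le_norm _).trans (by
      rw [norm_pow]; exact pow_le_one₀ (norm_nonneg _) hz)
    have := mul_le_mul_of_nonneg_left h4 (hb n)
    linarith
  have h5 := congrFun ((hasSum_zero_iff_of_nonneg h3).1 h2) 1
  simp only [pow_one, Pi.zero_apply] at h5
  have h6 : z.re = 1 := by
    have : b 1 * (1 - z.re) = 0 := by linarith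
    rcases mul_eq_zero.1 this with h7 | h7 <;> linarith
  have h8 : z.im = 0 := by
    have h9 := Complex.sq_norm z
    rw [Complex.normSq_apply, h6] at h9
    have : ‖z‖ ^ 2 ≤ 1 := pow_le_one₀ (norm_nonneg _) hz
    have : z.im * z.im ≤ 0 := by linarith
    nlinarith [mul_self_nonneg z.im]
  exact hz1 (Complex.ext (by simpa using h6) (by simpa using h8))

open Metric in
/-- An exponential form of the renewal theorem: bounded solutions of a renewal equation with
exponentially small forcing and exponentially decaying weights converge exponentially fast. -/
theorem exists_limit_of_convolution {b x e : ℕ → ℝ} {K K' q M : ℝ} (hb : ∀ n, 0 ≤ b n)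
    (hb0 : b 0 = 0) (hb1 : 0 < b 1) (hbs : HasSum b 1) (hq0 : 0 < q) (hq1 : q < 1)
    (hbq : ∀ n, b n ≤ K * q ^ n) (hx : ∀ n, |x n| ≤ M)
    (heq : ∀ n, x n = ∑ p ∈ Finset.HasAntidiagonal.antidiagonal n, b p.1 * x p.2 + e n)
    (he : ∀ n, |e n| ≤ K' * q ^ n) :
    ∃ x₀ D s, 0 < s ∧ s < 1 ∧ ∀ n, |x n - x₀| ≤ D * s ^ n := by
  obtain ⟨ρ, hρ1, hρ2⟩ := exists_between ((one_lt_inv₀ hq0).2 hq1)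
  have hqρ : q * ρ < 1 := by
    calc q * ρ < q * q⁻¹ := by gcongr
      _ = 1 := mul_inv_cancel₀ hq0.ne'
  have hbq' : ∀ n, ‖(b n : ℂ)‖ ≤ K * q ^ n := fun n => by
    rw [Complex.norm_real, Real.norm_eq_abs, abs_of_nonneg (hb n)]; exact hbq n
  have heq' : ∀ n, ‖(e n : ℂ)‖ ≤ K' * q ^ n := fun n => by
    rw [Complex.norm_real]; exact he n
  have hAd := differentiableOn_tsum_pow hq0 (by linarith) hqρ hbq'
  have hEd := differentiableOn_tsum_pow hq0 (by linarith) hqρ heq'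
  have hsb : ∀ z : ℂ, ‖z‖ ≤ 1 → Summable fun n => ‖(b n : ℂ) * z ^ n‖ := fun z hz => by
    refine Summable.of_nonneg_of_le (fun n => norm_nonneg _) (fun n => ?_) hbs.summable
    rw [norm_mul, norm_pow, Complex.norm_real, Real.norm_eq_abs, abs_of_nonneg (hb n)]
    exact mul_le_of_le_one_right (hb n) (pow_le_one₀ (norm_nonneg _) hz)
  set A : ℂ → ℂ := fun z => ∑' n, (b n : ℂ) * z ^ n with hA
  set F : ℂ → ℂ := fun z => ∑' n, (e n : ℂ) * z ^ n with hF
  set f : ℂ → ℂ := fun z => 1 - A z with hf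
  have hf1 : f 1 = 0 := by
    have : A 1 = 1 := by
      simp only [hA, one_pow, mul_one]
      rw [← Complex.ofReal_tsum, hbs.tsum_eq, Complex.ofReal_one]
    simp only [hf, this, sub_self]
  have hfd : DifferentiableOn ℂ f (ball 0 ρ) := hAd.const_sub 1
  have hmem : (1 : ℂ) ∈ ball (0 : ℂ) ρ := by simpa using hρ1
  -- B(z) = (1 - A(z))/(z - 1), with the derivative as value at 1, divides out the zero at 1.
  set B : ℂ → ℂ := dslope f 1 with hB
  have hBd : DifferentiableOn ℂ B (ball 0 ρ) :=
    (Complex.differentiableOn_dslope (isOpen_ball.mem_nhds hmem)).2 hfd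
  have hBf : ∀ z, (z - 1) * B z = f z := fun z => by
    have := sub_smul_dslope f 1 z
    rwa [hf1, sub_zero, smul_eq_mul] at this
  -- Because b 0 = 0, A(t) ≤ t on (0,1), hence |1 - A(t)| ≥ 1 - t. Letting t tend to 1 shows B(1) ≠
  -- 0, so the zero of 1 - A at 1 is simple.
  have hreal : ∀ t : ℝ, 0 < t → t < 1 → 1 ≤ ‖B t‖ := by
    intro t ht0 ht1
    have h1 : A t = ((∑' n, b n * t ^ n : ℝ) : ℂ) := by
      simp only [hA]; push_cast; rfl
    have hs : Summable fun n => b n * t ^ n :=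
      Summable.of_nonneg_of_le (fun n => mul_nonneg (hb n) (by positivity))
        (fun n => mul_le_of_le_one_right (hb n) (pow_le_one₀ ht0.le ht1.le)) hbs.summable
    have h2 : ∑' n, b n * t ^ n ≤ t := by
      have h3 : ∑' n, b n * t ^ n ≤ ∑' n, b n * t := by
        refine hs.tsum_le_tsum (fun n => ?_) (hbs.summable.mul_right t)
        rcases Nat.eq_zero_or_pos n with rfl | hn
        · simp [hb0]
        · exact mul_le_mul_of_nonneg_left (pow_le_of_le_one ht0.le ht1.le (by omega)) (hb n)
      rwa [tsum_mul_right, hbs.tsum_eq, one_mul] at h3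
    have h4 := hBf t
    have h5 : f t = ((1 - ∑' n, b n * t ^ n : ℝ) : ℂ) := by
      simp only [hf, h1]; push_cast; rfl
    have h6 : ‖f t‖ = 1 - ∑' n, b n * t ^ n := by
      rw [h5, Complex.norm_real, Real.norm_eq_abs, abs_of_nonneg (by linarith)]
    have h7 : ‖((t : ℂ) - 1)‖ = 1 - t := by
      rw [← Complex.ofReal_one, ← Complex.ofReal_sub, Complex.norm_real, Real.norm_eq_abs,
        abs_sub_comm, abs_of_nonneg (by linarith)]
    have h8 : (1 - t) * ‖B t‖ = 1 - ∑' n, b n * t ^ n := by rw [← h6, ← h4, norm_mul, h7]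
    by_contra hcon
    have := mul_lt_mul_of_pos_left (not_le.1 hcon) (show 0 < 1 - t by linarith)
    linarith
  have hB1 : B 1 ≠ 0 := by
    have hc : ContinuousAt B 1 := (hBd.differentiableAt (isOpen_ball.mem_nhds hmem)).continuousAt
    have ht : Tendsto (fun t : ℝ => (t : ℂ)) (𝓝[<] 1) (𝓝 1) := by
      have := Complex.continuous_ofReal.tendsto (1 : ℝ)
      rw [Complex.ofReal_one] at this
      exact this.mono_left nhdsWithin_le_nhds
    have h1 : 1 ≤ ‖B 1‖ := by
      refine ge_of_tendsto (hc.tendsto.comp ht).norm ?_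
      filter_upwards [Ioo_mem_nhdsLT (zero_lt_one' ℝ)] with t ht
      exact hreal t ht.1 ht.2
    intro h
    rw [h, norm_zero] at h1
    linarith
  have hBne : ∀ z : ℂ, ‖z‖ ≤ 1 → B z ≠ 0 := by
    intro z hz
    by_cases hz1 : z = 1
    · rw [hz1]; exact hB1
    · intro h
      have h1 := hBf z
      rw [h, mul_zero] at h1
      refine tsum_mul_pow_ne_one hb hb1 hbs hz hz1 (hsb z hz).of_norm ?_
      exact (sub_eq_zero.1 h1.symm).symm
  -- B has no zero on the compact closed unit disc, hence none on a slightly larger disc.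
  have hU : IsOpen (ball 0 ρ ∩ B ⁻¹' {0}ᶜ) :=
    hBd.continuousOn.isOpen_inter_preimage isOpen_ball isOpen_compl_singleton
  obtain ⟨η, hη, hsub⟩ := (isCompact_closedBall (0 : ℂ) 1).exists_thickening_subset_open hU
    (fun z hz => by
      rw [mem_closedBall_zero_iff] at hz
      exact ⟨by rw [mem_ball_zero_iff]; linarith, hBne z hz⟩)
  rw [thickening_closedBall hη zero_le_one] at hsub
  have hG : DifferentiableOn ℂ (fun z => -(F z / B z)) (ball 0 (η + 1)) :=
    ((hEd.mono fun z hz => (hsub hz).1).div (hBd.mono fun z hz => (hsub hz).1)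
      fun z hz => (hsub hz).2).neg
  -- The first differences of x have generating function (1-z)X(z) = -F(z)/B(z), which extends past
  -- the unit circle. They therefore decay geometrically, and x converges at that rate.
  let u : ℕ → ℂ := fun n => (x n : ℂ) - if n = 0 then 0 else (x (n - 1) : ℂ)
  have hsx : ∀ z : ℂ, ‖z‖ < 1 → Summable fun n => ‖(x n : ℂ) * z ^ n‖ := fun z hz => by
    refine Summable.of_nonneg_of_le (fun n => norm_nonneg _) (fun n => ?_)
      ((summable_geometric_of_lt_one (norm_nonneg z) hz).mul_left M)
    rw [norm_mul, norm_pow, Complex.norm_real, Real.norm_eq_abs]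
    gcongr
    exact hx n
  have hu : ∀ z : ℂ, ‖z‖ < 1 → HasSum (fun n => u n * z ^ n) (-(F z / B z)) := by
    intro z hz
    have hX := (hsx z hz).of_norm.hasSum
    set X := ∑' n, (x n : ℂ) * z ^ n with hXdef
    have hz1 : z ≠ 1 := by rintro rfl; simp at hz
    have hprod : A z * X = X - F z := by
      have hAX : A z * X = ∑' n, ∑ p ∈ Finset.HasAntidiagonal.antidiagonal n,
          ((b p.1 : ℂ) * z ^ p.1) * ((x p.2 : ℂ) * z ^ p.2) :=
        tsum_mul_tsum_eq_tsum_sum_antidiagonal_of_summable_norm (hsb z hz.le) (hsx z hz)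
      have hFs : Summable fun n => (e n : ℂ) * z ^ n := by
        refine Summable.of_norm_bounded (g := fun n => K' * q ^ n)
          ((summable_geometric_of_lt_one hq0.le hq1).mul_left K') fun n => ?_
        rw [norm_mul, norm_pow]
        exact (mul_le_of_le_one_right (norm_nonneg _) (pow_le_one₀ (norm_nonneg _) hz.le)).trans
          (heq' n)
      rw [hAX, hXdef, hF, ← (hsx z hz).of_norm.tsum_sub hFs]
      refine tsum_congr fun n => ?_
      have h1 : (x n : ℂ) - e n = ∑ p ∈ Finset.HasAntidiagonal.antidiagonal n, (b p.1 : ℂ) * x p.2 := by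
        rw [heq n]; push_cast; ring
      rw [← sub_mul, h1, Finset.sum_mul]
      refine Finset.sum_congr rfl fun p hp => ?_
      rw [← Finset.HasAntidiagonal.mem_antidiagonal.1 hp, pow_add]; ring
    have hval : -(F z / B z) = X - z * X := by
      have h2 : (z - 1) * B z * X = F z := by
        rw [hBf]
        simp only [hf]
        rw [sub_mul, hprod]; ring
      have h3 := hBne z hz.le
      field_simp
      rw [← h2]; ring
    rw [hval]
    have hshift : HasSum (fun n => (if n = 0 then 0 else (x (n - 1) : ℂ)) * z ^ n) (z * X) := by
      rw [← hasSum_nat_add_iff' 1]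
      simp only [Finset.range_one, Finset.sum_singleton, if_true, zero_mul, sub_zero,
        Nat.add_eq_zero_iff, one_ne_zero, and_false, if_false, Nat.add_sub_cancel]
      refine (hX.mul_left z).congr_fun fun n => ?_
      rw [pow_succ]; ring
    simpa only [u, sub_mul] using hX.sub hshift
  obtain ⟨D, s, hs0, hs1, hD⟩ := exists_norm_coeff_le (by linarith) hG hu
  have hdist : ∀ n, dist (x n) (x (n + 1)) ≤ D * s * s ^ n := fun n => by
    have h1 := hD (n + 1)
    simp only [u, Nat.add_eq_zero_iff, one_ne_zero, and_false, if_false, Nat.add_sub_cancel] at h1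
    rw [← Complex.ofReal_sub, Complex.norm_real] at h1
    rw [dist_comm, Real.dist_eq]
    refine h1.trans_eq ?_
    ring
  obtain ⟨x₀, hx₀⟩ := cauchySeq_tendsto_of_complete (cauchySeq_of_le_geometric _ _ hs1 hdist)
  refine ⟨x₀, D * s / (1 - s), s, hs0, hs1, fun n => ?_⟩
  have := dist_le_of_le_geometric_of_tendsto _ _ hs1 hdist hx₀ n
  rw [Real.dist_eq] at this
  refine this.trans_eq ?_
  ring

/-- Bounded approximate solutions of the renewal equation converge exponentially fast. -/
theorem QuasiGreedy.exists_limit {b : ℝ} {d : ℕ → ℕ} {R : ℕ → ℝ} (h : QuasiGreedy b d R)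
    {x : ℕ → ℝ} {K q M : ℝ} (hbq : b < q) (hq1 : q < 1) (hx : ∀ n, |x n| ≤ M)
    (heq : ∀ N, |x N - ∑ i ∈ Finset.range (cnt d N), b ^ d i * x (N - d i)| ≤ K * q ^ N) :
    ∃ x₀ D s, 0 < s ∧ s < 1 ∧ ∀ n, |x n - x₀| ≤ D * s ^ n := by
  have hq0 : 0 < q := h.b_pos.trans hbq
  -- Equal digits are grouped, so that the renewal sum becomes a convolution with w. The digit d 0 =
  -- 1 gives w 1 > 0, the aperiodicity needed below.
  let w : ℕ → ℝ := fun n => ∑ i ∈ Finset.range (cnt d n), if d i = n then b ^ d i else 0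
  have hw : ∀ n, 0 ≤ w n := fun n => Finset.sum_nonneg fun i _ => by
    split_ifs
    · exact (pow_pos h.b_pos _).le
    · exact le_rfl
  have hwN : ∀ N n, n ≤ N →
      ∑ i ∈ Finset.range (cnt d N), (if d i = n then b ^ d i else 0) = w n := by
    intro N n hn
    refine (Finset.sum_subset ?_ ?_).symm
    · intro i hi
      rw [Finset.mem_range, h.lt_cnt_iff] at hi ⊢
      omega
    · intro i _ hi
      rw [Finset.mem_range, h.lt_cnt_iff] at hi
      rw [if_neg (by omega)]
  have hconv : ∀ N, ∑ i ∈ Finset.range (cnt d N), b ^ d i * x (N - d i) =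
      ∑ p ∈ Finset.HasAntidiagonal.antidiagonal N, w p.1 * x p.2 := by
    intro N
    rw [Finset.Nat.sum_antidiagonal_eq_sum_range_succ (fun i j => w i * x j)]
    have h1 : ∀ n ∈ Finset.range (N + 1), w n * x (N - n) =
        ∑ i ∈ Finset.range (cnt d N), if d i = n then b ^ d i * x (N - n) else 0 := fun n hn => by
      rw [← hwN N n (by have := Finset.mem_range.1 hn; omega), Finset.sum_mul]
      refine Finset.sum_congr rfl fun i _ => ?_
      split_ifs <;> simp
    rw [Finset.sum_congr rfl h1, Finset.sum_comm]
    refine Finset.sum_congr rfl fun i hi => ?_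
    have h2 := h.lt_cnt_iff.1 (Finset.mem_range.1 hi)
    rw [Finset.sum_ite_eq, if_pos (Finset.mem_range.2 (by omega))]
  have hsumw : ∀ N, ∑ n ∈ Finset.range (N + 1), w n = 1 - R (cnt d N) := by
    intro N
    rw [← h.sum_range, ← Finset.sum_congr rfl fun n hn =>
      hwN N n (by have := Finset.mem_range.1 hn; omega), Finset.sum_comm]
    refine Finset.sum_congr rfl fun i hi => ?_
    have h2 := h.lt_cnt_iff.1 (Finset.mem_range.1 hi)
    rw [Finset.sum_ite_eq, if_pos (Finset.mem_range.2 (by omega))]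
  have hRle := h.remainder_cnt_le
  have hws : HasSum w 1 := by
    rw [hasSum_iff_tendsto_nat_of_nonneg hw, ← tendsto_add_atTop_iff_nat 1]
    simp_rw [hsumw]
    have : Tendsto (fun N => R (cnt d N)) atTop (𝓝 0) :=
      squeeze_zero (fun N => (h.pos _).le) hRle
        (tendsto_pow_atTop_nhds_zero_of_lt_one h.b_pos.le h.b_lt)
    simpa using this.const_sub 1
  -- The weight w (k+1) is a difference of two remainders, hence at most R (cnt d k) ≤ b^k.
  have hwle : ∀ n, w n ≤ q⁻¹ * q ^ n := by
    intro n
    rcases Nat.eq_zero_or_pos n with rfl | hn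
    · have : w 0 = 0 := Finset.sum_eq_zero fun i _ => if_neg (by have := h.one_le i; omega)
      rw [this]; positivity
    · obtain ⟨k, rfl⟩ : ∃ k, n = k + 1 := ⟨n - 1, by omega⟩
      have h1 := hsumw (k + 1)
      rw [Finset.sum_range_succ, hsumw k] at h1
      have h2 := hRle k
      have h3 := h.pos (cnt d (k + 1))
      have h4 : b ^ k ≤ q ^ k := pow_le_pow_left₀ h.b_pos.le hbq.le k
      have h5 : q⁻¹ * q ^ (k + 1) = q ^ k := by rw [pow_succ]; field_simp
      rw [h5]; linarith
  refine exists_limit_of_convolution (b := w) (x := x)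
    (e := fun N => x N - ∑ i ∈ Finset.range (cnt d N), b ^ d i * x (N - d i)) hw ?_ ?_ hws hq0 hq1
    hwle hx (fun n => ?_) heq
  · exact Finset.sum_eq_zero fun i _ => if_neg (by have := h.one_le i; omega)
  · refine Finset.sum_pos' (fun i _ => ?_) ⟨0, ?_, ?_⟩
    · split_ifs
      · exact (pow_pos h.b_pos _).le
      · exact le_rfl
    · rw [Finset.mem_range, h.lt_cnt_iff, h.d_zero]
    · rw [if_pos h.d_zero]; exact pow_pos h.b_pos _
  · simp only [hconv]; ring

theorem exists_pow_mul_pow_le {x q : ℝ} (hx : 0 < x) (hxq : x < q) (k : ℕ) :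
    ∃ K, ∀ N : ℕ, ((N : ℝ) + 1) ^ k * x ^ N ≤ K * q ^ N := by
  have hq : 0 < q := hx.trans hxq
  have hlim : Tendsto (fun n : ℕ => (n : ℝ) ^ k * (x / q) ^ n) atTop (𝓝 0) :=
    tendsto_pow_const_mul_const_pow_of_abs_lt_one k (by
      rw [abs_of_nonneg (by positivity), div_lt_one hq]; exact hxq)
  obtain ⟨M, hM⟩ := hlim.bddAbove_range
  refine ⟨M * (q / x), fun N => ?_⟩
  have h1 : ((N + 1 : ℕ) : ℝ) ^ k * (x / q) ^ (N + 1) ≤ M := hM ⟨N + 1, rfl⟩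
  push_cast at h1
  calc ((N : ℝ) + 1) ^ k * x ^ N
      = (((N : ℝ) + 1) ^ k * (x / q) ^ (N + 1)) * ((q / x) * q ^ N) := by
        rw [div_pow, pow_succ, pow_succ]; field_simp
    _ ≤ M * ((q / x) * q ^ N) := by gcongr
    _ = _ := by ring

/-! ### Constants of the limiting renewal process -/

/-- The mean step of the limiting renewal process. -/
noncomputable def stepMean (b : ℝ) (d : ℕ → ℕ) : ℝ := ∑' i, b ^ d i * (d i : ℝ)

/-- The mean number of summands gained per step of the limiting renewal process. -/
noncomputable def indexMean (b : ℝ) (d : ℕ → ℕ) : ℝ := ∑' i, b ^ d i * (i : ℝ)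

/-- The mean number of summands per unit of index. -/
noncomputable def meanRate (b : ℝ) (d : ℕ → ℕ) : ℝ := indexMean b d / stepMean b d

/-- The centred reward of the `i`-th kind of step. -/
noncomputable def excess (b : ℝ) (d : ℕ → ℕ) (i : ℕ) : ℝ := i - meanRate b d * d i

/-- The variance of the number of summands per unit of index. -/
noncomputable def varRate (b : ℝ) (d : ℕ → ℕ) : ℝ :=
  (∑' i, b ^ d i * excess b d i ^ 2) / stepMean b d

namespace QuasiGreedy

variable {b : ℝ} {d : ℕ → ℕ} {R : ℕ → ℝ}

theorem summable_step (h : QuasiGreedy b d R) : Summable fun i => b ^ d i * (d i : ℝ) :=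
  h.summable_mul (f := fun i => (d i : ℝ)) (A := 1) (k := 1) fun i => by simp

theorem exists_index_le (h : QuasiGreedy b d R) : ∃ c : ℝ, 0 ≤ c ∧ ∀ i : ℕ, (i : ℝ) ≤ c * d i := by
  obtain ⟨c, -, hc⟩ := h.exists_index_lt
  exact ⟨c, Nat.cast_nonneg _, fun i => by exact_mod_cast (hc i).le⟩

theorem summable_index (h : QuasiGreedy b d R) : Summable fun i => b ^ d i * (i : ℝ) := by
  obtain ⟨c, -, hc⟩ := h.exists_index_le
  exact h.summable_mul (f := fun i => (i : ℝ)) (A := c) (k := 1) fun i => by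
    rw [pow_one, abs_of_nonneg (Nat.cast_nonneg _)]; exact hc i

theorem stepMean_pos (h : QuasiGreedy b d R) : 0 < stepMean b d :=
  h.summable_step.tsum_pos (fun i => mul_nonneg (pow_pos h.b_pos _).le (Nat.cast_nonneg _)) 0 (by
    rw [h.d_zero]; have := h.b_pos; positivity)

theorem indexMean_pos (h : QuasiGreedy b d R) : 0 < indexMean b d :=
  h.summable_index.tsum_pos (fun i => mul_nonneg (pow_pos h.b_pos _).le (Nat.cast_nonneg _)) 1 (by
    have := h.b_pos; positivity)

theorem meanRate_pos (h : QuasiGreedy b d R) : 0 < meanRate b d :=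
  div_pos h.indexMean_pos h.stepMean_pos

theorem exists_excess_le (h : QuasiGreedy b d R) :
    ∃ A, 0 ≤ A ∧ ∀ i, |excess b d i| ≤ A * d i := by
  obtain ⟨c, hc0, hc⟩ := h.exists_index_le
  have hm := h.meanRate_pos
  refine ⟨c + meanRate b d, by positivity, fun i => ?_⟩
  have h1 : (0 : ℝ) ≤ i := Nat.cast_nonneg i
  have h2 : 0 ≤ meanRate b d * d i := by positivity
  have h3 := hc i
  rw [excess, abs_le]
  constructor <;> nlinarith

theorem tsum_excess (h : QuasiGreedy b d R) : ∑' i, b ^ d i * excess b d i = 0 := by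
  have e : ∀ i, b ^ d i * excess b d i = b ^ d i * (i : ℝ) - meanRate b d * (b ^ d i * d i) :=
    fun i => by rw [excess]; ring
  simp_rw [e]
  rw [h.summable_index.tsum_sub (h.summable_step.mul_left _), tsum_mul_left]
  change indexMean b d - indexMean b d / stepMean b d * stepMean b d = 0
  rw [div_mul_cancel₀ _ h.stepMean_pos.ne', sub_self]

theorem exists_excess_sq_le (h : QuasiGreedy b d R) :
    ∃ A, ∀ i, |excess b d i ^ 2| ≤ A * (d i : ℝ) ^ 2 := by
  obtain ⟨A, hA, hA'⟩ := h.exists_excess_le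
  refine ⟨A ^ 2, fun i => ?_⟩
  rw [abs_pow, ← mul_pow]
  exact pow_le_pow_left₀ (abs_nonneg _) (hA' i) 2

/-- The step i = 0 gains no summand and costs one unit of index, so its excess is minus the mean
rate, which is nonzero. -/
theorem varRate_pos (h : QuasiGreedy b d R) : 0 < varRate b d := by
  obtain ⟨A, hA⟩ := h.exists_excess_sq_le
  refine div_pos ?_ h.stepMean_pos
  refine (h.summable_mul hA).tsum_pos
    (fun i => mul_nonneg (pow_pos h.b_pos _).le (sq_nonneg _)) 0 ?_
  have h1 : excess b d 0 = -meanRate b d := by rw [excess, h.d_zero]; simp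
  have h2 := h.meanRate_pos
  have h3 := h.b_pos
  rw [h1, neg_sq]; positivity

theorem varRate_mul_stepMean (h : QuasiGreedy b d R) :
    ∑' i, b ^ d i * excess b d i ^ 2 = varRate b d * stepMean b d := by
  rw [varRate, div_mul_cancel₀ _ h.stepMean_pos.ne']

/-- Approximate solutions of the renewal equation are bounded. -/
theorem exists_bound_of_renewal (h : QuasiGreedy b d R) {x : ℕ → ℝ} {K q : ℝ} (hq0 : 0 < q)
    (hq1 : q < 1)
    (heq : ∀ N, |x N - ∑ i ∈ Finset.range (cnt d N), b ^ d i * x (N - d i)| ≤ K * q ^ N) :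
    ∃ M, ∀ n, |x n| ≤ M := by
  have hK : 0 ≤ K := by have := (abs_nonneg _).trans (heq 0); simpa using this
  refine ⟨K * (1 - q)⁻¹, fun n => ?_⟩
  refine (h.le_sum_of_renewal (x := fun n => |x n|) (e := fun n => K * q ^ n)
    (fun n => by positivity) (fun N => ?_) n).trans ?_
  · have h1 := heq N
    have h2 : |∑ i ∈ Finset.range (cnt d N), b ^ d i * x (N - d i)| ≤
        ∑ i ∈ Finset.range (cnt d N), b ^ d i * |x (N - d i)| := by
      refine (Finset.abs_sum_le_sum_abs _ _).trans_eq (Finset.sum_congr rfl fun i _ => ?_)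
      rw [abs_mul, abs_of_pos (pow_pos h.b_pos _)]
    have h3 := abs_sub_abs_le_abs_sub (x N)
      (∑ i ∈ Finset.range (cnt d N), b ^ d i * x (N - d i))
    linarith
  · rw [← Finset.mul_sum]
    gcongr
    rw [← tsum_geometric_of_lt_one hq0.le hq1]
    exact (summable_geometric_of_lt_one hq0.le hq1).sum_le_tsum _ fun i _ => by positivity

end QuasiGreedy

/-! ### First and second moments -/

section Moments

theorem inv_lt_of_expGrowth {Z : ℕ → ℕ} {a lam r C q : ℝ} (hZ : ExpGrowth Z a lam r C)
    (hq : r / lam < q) : lam⁻¹ < q := by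
  have hr := hZ.one_lt_r
  have hl : 0 < lam := by linarith [hZ.r_lt]
  refine lt_of_le_of_lt ?_ hq
  rw [inv_eq_one_div]
  gcongr

theorem ExpGrowth.one_lt {Z : ℕ → ℕ} {a lam r C : ℝ} (hZ : ExpGrowth Z a lam r C) : 1 < lam :=
  hZ.one_lt_r.trans hZ.r_lt

/-- For statistics of polynomial size, all powers of N + 1 are absorbed by enlarging r/λ to q. -/
theorem ExpGrowth.exists_renewal_of_le {E : Type} [NormedAddCommGroup E] [NormedSpace ℝ E]
    {Z : ℕ → ℕ} {a lam r C q : ℝ}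
    (hZ : ExpGrowth Z a lam r C) {d : ℕ → ℕ} {R : ℕ → ℝ} (hd : QuasiGreedy lam⁻¹ d R)
    (hq : r / lam < q) (k : ℕ) :
    ∃ (K : ℝ) (L : ℕ), ∀ (N : ℕ) (A : ℝ) (Φ : List ℕ → E),
      (∀ l, l.length ≤ L * (N + 1) → ‖Φ l‖ ≤ A * ((N : ℝ) + 1) ^ k) →
      ‖greedyMean Z a lam Φ N - ∑ i ∈ Finset.range (cnt d N), lam⁻¹ ^ d i •
        greedyMean Z a lam (fun l => Φ (expPrefix d N i ++ l)) (N - d i)‖ ≤ K * A * q ^ N := by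
  obtain ⟨K, L, hK⟩ := hZ.exists_renewal (E := E) hd
  have hx : 0 < r / lam := div_pos (by linarith [hZ.one_lt_r]) (by linarith [hZ.one_lt])
  obtain ⟨K', hK'⟩ := exists_pow_mul_pow_le hx hq (k + 2)
  refine ⟨|K| * K', L, fun N A Φ hΦ => (hK N _ Φ hΦ).trans ?_⟩
  have h0 := (norm_nonneg _).trans (hΦ [] (by simp))
  have hA : 0 ≤ A := nonneg_of_mul_nonneg_left h0 (by positivity)
  calc _ ≤ |K| * (A * ((N : ℝ) + 1) ^ k) * ((N : ℝ) + 1) ^ 2 * (r / lam) ^ N := by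
        gcongr; exact le_abs_self K
    _ = |K| * A * (((N : ℝ) + 1) ^ (k + 2) * (r / lam) ^ N) := by ring
    _ ≤ |K| * A * (K' * q ^ N) := by
        have := hK' N
        gcongr
    _ = _ := by ring

variable {Z : ℕ → ℕ} {a lam r C q : ℝ} {d : ℕ → ℕ} {R : ℕ → ℝ}

/-- The ratio of `Z n` to its asymptotic value `a * lam ^ n`. -/
noncomputable def massRatio (Z : ℕ → ℕ) (a lam : ℝ) (n : ℕ) : ℝ := Z n / (a * lam ^ n)

theorem ExpGrowth.exists_massRatio_sub_le (hZ : ExpGrowth Z a lam r C) (hq : r / lam < q) :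
    ∃ K, ∀ n, |massRatio Z a lam n - 1| ≤ K * q ^ n := by
  have ha := hZ.a_pos
  have hr : 0 < r := by linarith [hZ.one_lt_r]
  have hl : 0 < lam := by linarith [hZ.one_lt]
  have hC : 0 ≤ C := by have := (abs_nonneg _).trans (hZ.err 0); simpa using this
  refine ⟨C / a, fun n => ?_⟩
  have e : massRatio Z a lam n - 1 = (Z n - a * lam ^ n) / (a * lam ^ n) := by
    rw [massRatio]; field_simp
  rw [e, abs_div, abs_of_pos (show 0 < a * lam ^ n by positivity)]
  calc _ ≤ C * r ^ n / (a * lam ^ n) := by gcongr; exact hZ.err n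
    _ = C / a * (r / lam) ^ n := by rw [div_pow]; field_simp
    _ ≤ _ := by gcongr

theorem ExpGrowth.massRatio_pos (hZ : ExpGrowth Z a lam r C) (n : ℕ) :
    0 < massRatio Z a lam n := by
  have ha := hZ.a_pos
  have hl : 0 < lam := by linarith [hZ.one_lt]
  have := hZ.pos n
  rw [massRatio]; positivity

theorem greedyMean_real (Z : ℕ → ℕ) (a lam : ℝ) (Φ : List ℕ → ℝ) (n : ℕ) :
    greedyMean Z a lam Φ n = (∑ m ∈ Finset.range (Z n), Φ (greedy Z m)) / (a * lam ^ n) := by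
  rw [greedyMean, greedySum, smul_eq_mul, div_eq_inv_mul]

/-- The normalized sum of `k(m) - c * n` over `m < Z n`. -/
noncomputable def firstMoment (Z : ℕ → ℕ) (a lam c : ℝ) (n : ℕ) : ℝ :=
  greedyMean Z a lam (fun l => (l.length : ℝ) - c * n) n

/-- The normalized sum of `(k(m) - c * n) ^ 2` over `m < Z n`. -/
noncomputable def secondMoment (Z : ℕ → ℕ) (a lam c : ℝ) (n : ℕ) : ℝ :=
  greedyMean Z a lam (fun l => ((l.length : ℝ) - c * n) ^ 2) n

theorem length_expPrefix (d : ℕ → ℕ) (N i : ℕ) : (expPrefix d N i).length = i := by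
  simp [expPrefix]

theorem length_prefix_sub (c : ℝ) {N i : ℕ} (hi : d i ≤ N) (l : List ℕ) :
    ((expPrefix d N i ++ l).length : ℝ) - c * N =
      ((l.length : ℝ) - c * (N - d i : ℕ)) + ((i : ℝ) - c * d i) := by
  rw [List.length_append, length_expPrefix, Nat.cast_sub hi]
  push_cast
  ring

theorem abs_length_sub_le {c : ℝ} (hc : 0 ≤ c) {L N : ℕ} {l : List ℕ}
    (hl : l.length ≤ L * (N + 1)) : |(l.length : ℝ) - c * N| ≤ (L + c) * ((N : ℝ) + 1) := by
  have h1 : (l.length : ℝ) ≤ L * (N + 1) := by exact_mod_cast hl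
  have h2 : (0 : ℝ) ≤ l.length := Nat.cast_nonneg _
  have h3 : (0 : ℝ) ≤ c * N := by positivity
  have h4 : (0 : ℝ) ≤ L * ((N : ℝ) + 1) := by positivity
  rw [abs_le]; constructor <;> nlinarith

/-- Centring at `meanRate` turns the reward i into its excess, whose mean is zero. As `massRatio`
tends to 1 exponentially fast, the forcing is exponentially small. -/
theorem ExpGrowth.exists_firstMoment_renewal (hZ : ExpGrowth Z a lam r C)
    (hd : QuasiGreedy lam⁻¹ d R) (hq : r / lam < q) (hq1 : q < 1) :
    ∃ K, ∀ N, |firstMoment Z a lam (meanRate lam⁻¹ d) N - ∑ i ∈ Finset.range (cnt d N),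
      lam⁻¹ ^ d i * firstMoment Z a lam (meanRate lam⁻¹ d) (N - d i)| ≤ K * q ^ N := by
  set c := meanRate lam⁻¹ d with hc
  have hc0 : 0 ≤ c := hd.meanRate_pos.le
  obtain ⟨K, L, hK⟩ := hZ.exists_renewal_of_le (E := ℝ) hd hq 1
  obtain ⟨K₁, hK₁⟩ := hZ.exists_massRatio_sub_le hq
  obtain ⟨A, hA, hA'⟩ := hd.exists_excess_le
  obtain ⟨K₂, hK₂⟩ := hd.exists_abs_sum_sub_le (f := excess lam⁻¹ d) (k := 1)
    (inv_lt_of_expGrowth hZ hq) hq1.le (by simpa using hA') hK₁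
  refine ⟨K * (L + c) + K₂, fun N => ?_⟩
  have h1 := hK N (L + c) (fun l => (l.length : ℝ) - c * N) fun l hl => by
    rw [pow_one]; exact abs_length_sub_le hc0 hl
  have h2 := hK₂ N
  rw [hd.tsum_excess, mul_zero, sub_zero] at h2
  have e : ∀ i ∈ Finset.range (cnt d N), lam⁻¹ ^ d i •
      greedyMean Z a lam (fun l => ((expPrefix d N i ++ l).length : ℝ) - c * N) (N - d i) =
      lam⁻¹ ^ d i * firstMoment Z a lam c (N - d i) +
        lam⁻¹ ^ d i * excess lam⁻¹ d i * massRatio Z a lam (N - d i) := fun i hi => by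
    have hi' := hd.lt_cnt_iff.1 (Finset.mem_range.1 hi)
    simp_rw [length_prefix_sub c hi', firstMoment, greedyMean_real, Finset.sum_add_distrib,
      massRatio, excess, ← hc, Finset.sum_const, Finset.card_range, nsmul_eq_mul, smul_eq_mul]
    ring
  rw [Finset.sum_congr rfl e, Finset.sum_add_distrib, Real.norm_eq_abs] at h1
  rw [abs_le] at h1 h2 ⊢
  simp only [firstMoment] at h1 ⊢
  constructor <;> linarith [h1.1, h1.2, h2.1, h2.2]

theorem ExpGrowth.exists_firstMoment_limit (hZ : ExpGrowth Z a lam r C)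
    (hd : QuasiGreedy lam⁻¹ d R) :
    ∃ x₀ D s, 0 < s ∧ s < 1 ∧
      ∀ n, |firstMoment Z a lam (meanRate lam⁻¹ d) n - x₀| ≤ D * s ^ n := by
  have hl := hZ.one_lt
  obtain ⟨q, hq, hq1⟩ := exists_between ((div_lt_one (by linarith)).2 hZ.r_lt)
  obtain ⟨K, hK⟩ := hZ.exists_firstMoment_renewal hd hq hq1
  have hbq := inv_lt_of_expGrowth hZ hq
  obtain ⟨M, hM⟩ := hd.exists_bound_of_renewal (hd.b_pos.trans hbq) hq1 hK
  exact hd.exists_limit hbq hq1 hM hK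

/-- Expanding the square, the cross term pairs the mean-zero excess with the first moment, which
converges exponentially, so it is negligible. The squared excess contributes the forcing c₂ ·
`stepMean`, which the linear profile c₂ N reproduces. -/
theorem ExpGrowth.exists_secondMoment_bound (hZ : ExpGrowth Z a lam r C)
    (hd : QuasiGreedy lam⁻¹ d R) :
    ∃ M, ∀ n, |secondMoment Z a lam (meanRate lam⁻¹ d) n - varRate lam⁻¹ d * n| ≤ M := by
  have hl := hZ.one_lt
  obtain ⟨x₀, D, s, hs0, hs1, hD⟩ := hZ.exists_firstMoment_limit hd
  have hD0 : 0 ≤ D := by have := (abs_nonneg _).trans (hD 0); simpa using this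
  obtain ⟨q, hq', hq1⟩ := exists_between (max_lt ((div_lt_one (by linarith)).2 hZ.r_lt) hs1)
  have hq : r / lam < q := (le_max_left _ _).trans_lt hq'
  have hsq : s < q := (le_max_right _ _).trans_lt hq'
  have hbq := inv_lt_of_expGrowth hZ hq
  have hb0 := hd.b_pos
  have hq0 : 0 < q := hb0.trans hbq
  set c := meanRate lam⁻¹ d with hc
  set c₂ := varRate lam⁻¹ d with hc₂
  have hc0 : 0 ≤ c := hd.meanRate_pos.le
  obtain ⟨K, L, hK⟩ := hZ.exists_renewal_of_le (E := ℝ) hd hq 2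
  obtain ⟨K₁, hK₁⟩ := hZ.exists_massRatio_sub_le hq
  obtain ⟨A, hA, hA'⟩ := hd.exists_excess_le
  obtain ⟨A₂, hA₂⟩ := hd.exists_excess_sq_le
  obtain ⟨K₂, hK₂⟩ := hd.exists_abs_sum_sub_le (f := excess lam⁻¹ d) (k := 1)
    (y := firstMoment Z a lam c) (y₀ := x₀) (D := D) hbq hq1.le (by simpa using hA')
    (fun n => (hD n).trans (by gcongr))
  obtain ⟨K₃, hK₃⟩ := hd.exists_abs_sum_sub_le (f := fun i => excess lam⁻¹ d i ^ 2) (k := 2)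
    hbq hq1.le hA₂ hK₁
  obtain ⟨K₄, hK₄⟩ := hd.exists_abs_sum_sub_le (f := fun i => (d i : ℝ)) (k := 1) (A := 1)
    (y := fun _ => 1) (y₀ := 1) (D := 0) hbq hq1.le (by simp) (by simp)
  obtain ⟨K₅, hK₅⟩ := exists_pow_mul_pow_le hb0 hbq 1
  refine hd.exists_bound_of_renewal (K := K * (L + c) ^ 2 + 2 * K₂ + K₃ + |c₂| * (K₄ + K₅))
    hq0 hq1 fun N => ?_
  have h1 := hK N ((L + c) ^ 2) (fun l => ((l.length : ℝ) - c * N) ^ 2) fun l hl => by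
    rw [norm_pow, ← mul_pow]
    exact pow_le_pow_left₀ (norm_nonneg _) (abs_length_sub_le hc0 hl) 2
  have h2 := hK₂ N
  have h3 := hK₃ N
  have h4 := hK₄ N
  rw [hd.tsum_excess, mul_zero, sub_zero] at h2
  rw [hd.varRate_mul_stepMean, one_mul, ← hc₂] at h3
  have e : ∀ i ∈ Finset.range (cnt d N), lam⁻¹ ^ d i •
      greedyMean Z a lam (fun l => (((expPrefix d N i ++ l).length : ℝ) - c * N) ^ 2) (N - d i) =
      lam⁻¹ ^ d i * secondMoment Z a lam c (N - d i) +
      2 * (lam⁻¹ ^ d i * excess lam⁻¹ d i * firstMoment Z a lam c (N - d i)) +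
        lam⁻¹ ^ d i * excess lam⁻¹ d i ^ 2 * massRatio Z a lam (N - d i) := fun i hi => by
    have hi' := hd.lt_cnt_iff.1 (Finset.mem_range.1 hi)
    simp_rw [length_prefix_sub c hi', add_sq, firstMoment, secondMoment, greedyMean_real,
      Finset.sum_add_distrib,
      massRatio, excess, ← hc, ← Finset.sum_mul, ← Finset.mul_sum, Finset.sum_const,
      Finset.card_range, nsmul_eq_mul, smul_eq_mul]
    ring
  rw [Finset.sum_congr rfl e, Finset.sum_add_distrib, Finset.sum_add_distrib, ← Finset.mul_sum,
    Real.norm_eq_abs] at h1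
  -- Subtracting c₂ N changes the renewal defect by -c₂ · `stepMean`, up to the truncation terms N R
  -- and the tail of the mean step.
  have e2 : ∑ i ∈ Finset.range (cnt d N), lam⁻¹ ^ d i *
      (secondMoment Z a lam c (N - d i) - c₂ * (N - d i : ℕ)) =
      ∑ i ∈ Finset.range (cnt d N), lam⁻¹ ^ d i * secondMoment Z a lam c (N - d i) -
      c₂ * (N * (1 - R (cnt d N)) - ∑ i ∈ Finset.range (cnt d N), lam⁻¹ ^ d i * d i * 1) := by
    rw [← hd.sum_range, Finset.mul_sum, ← Finset.sum_sub_distrib, Finset.mul_sum,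
      ← Finset.sum_sub_distrib]
    refine Finset.sum_congr rfl fun i hi => ?_
    have hi' := hd.lt_cnt_iff.1 (Finset.mem_range.1 hi)
    rw [Nat.cast_sub hi']
    ring
  have h5 : |(N : ℝ) * R (cnt d N)| ≤ K₅ * q ^ N := by
    rw [abs_of_nonneg (mul_nonneg (Nat.cast_nonneg _) (hd.pos _).le)]
    refine le_trans ?_ (hK₅ N)
    rw [pow_one]
    exact mul_le_mul (by linarith) (hd.remainder_cnt_le N) (hd.pos _).le (by positivity)
  rw [one_mul] at h4
  change |_ - stepMean lam⁻¹ d| ≤ _ at h4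
  rw [e2]
  have e3 : secondMoment Z a lam c N - c₂ * N -
      (∑ i ∈ Finset.range (cnt d N), lam⁻¹ ^ d i * secondMoment Z a lam c (N - d i) -
      c₂ * (N * (1 - R (cnt d N)) - ∑ i ∈ Finset.range (cnt d N), lam⁻¹ ^ d i * d i * 1)) =
      (secondMoment Z a lam c N -
        (∑ i ∈ Finset.range (cnt d N), lam⁻¹ ^ d i * secondMoment Z a lam c (N - d i) +
        2 * ∑ i ∈ Finset.range (cnt d N),
          lam⁻¹ ^ d i * excess lam⁻¹ d i * firstMoment Z a lam c (N - d i) +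
        ∑ i ∈ Finset.range (cnt d N),
          lam⁻¹ ^ d i * excess lam⁻¹ d i ^ 2 * massRatio Z a lam (N - d i))) +
      2 * ∑ i ∈ Finset.range (cnt d N),
          lam⁻¹ ^ d i * excess lam⁻¹ d i * firstMoment Z a lam c (N - d i) +
      (∑ i ∈ Finset.range (cnt d N),
          lam⁻¹ ^ d i * excess lam⁻¹ d i ^ 2 * massRatio Z a lam (N - d i) -
        c₂ * stepMean lam⁻¹ d) -
      c₂ * ((∑ i ∈ Finset.range (cnt d N), lam⁻¹ ^ d i * d i * 1 - stepMean lam⁻¹ d) +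
        N * R (cnt d N)) := by ring
  have h6 : |c₂ * ((∑ i ∈ Finset.range (cnt d N), lam⁻¹ ^ d i * d i * 1 - stepMean lam⁻¹ d) +
        N * R (cnt d N))| ≤ |c₂| * ((K₄ + K₅) * q ^ N) := by
    rw [abs_mul, add_mul]
    gcongr
    exact (abs_add_le _ _).trans (add_le_add h4 h5)
  rw [e3]
  simp only [secondMoment] at h1 ⊢
  rw [abs_le] at h1 h2 h3 h6 ⊢
  constructor <;> linarith [h1.1, h1.2, h2.1, h2.2, h3.1, h3.2, h6.1, h6.2]

end Moments

/-! ### Gaussian approximation of the characteristic function -/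

theorem norm_exp_mul_I_sub_le (x : ℝ) :
    ‖Complex.exp (x * Complex.I) - (1 + x * Complex.I - (x : ℂ) ^ 2 / 2)‖ ≤ 4 * |x| ^ 3 := by
  have hn : ‖(x : ℂ) * Complex.I‖ = |x| := by simp
  have hsq : ((x : ℂ) * Complex.I) ^ 2 = -(x : ℂ) ^ 2 := by rw [mul_pow, Complex.I_sq]; ring
  by_cases hx : |x| ≤ 1
  · have h := Complex.exp_bound (x := x * Complex.I) (by rwa [hn]) (n := 3) (by norm_num)
    rw [hn] at h
    have e : ∑ m ∈ Finset.range 3, ((x : ℂ) * Complex.I) ^ m / (m.factorial : ℂ) =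
        1 + x * Complex.I - (x : ℂ) ^ 2 / 2 := by
      simp only [Finset.sum_range_succ, Finset.sum_range_zero, hsq]
      norm_num [Nat.factorial]; ring
    rw [e] at h
    refine h.trans ?_
    have : (0 : ℝ) ≤ |x| ^ 3 := by positivity
    norm_num [Nat.factorial]
    linarith
  · have hx' : 1 < |x| := not_le.1 hx
    have h1 : ‖Complex.exp (x * Complex.I)‖ = 1 := Complex.norm_exp_ofReal_mul_I x
    have h2 : ‖(1 : ℂ) + x * Complex.I - (x : ℂ) ^ 2 / 2‖ ≤ 1 + |x| + |x| ^ 2 / 2 := by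
      refine (norm_sub_le _ _).trans (add_le_add ((norm_add_le _ _).trans ?_) ?_)
      · rw [hn, norm_one]
      · rw [norm_div, norm_pow, Complex.norm_real, Real.norm_eq_abs]; simp
    refine (norm_sub_le _ _).trans ?_
    rw [h1]
    have h3 : 1 ≤ |x| ^ 3 := one_le_pow₀ hx'.le
    have h4 : |x| ≤ |x| ^ 3 := le_self_pow₀ hx'.le (by norm_num)
    have h5 : |x| ^ 2 ≤ |x| ^ 3 := pow_le_pow_right₀ hx'.le (by norm_num)
    linarith

/-- Uniformity in n comes from d ≤ n: the factor exp(-τ n) ≤ exp(-τ d) compensates the growth of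
exp(τ d). -/
theorem abs_exp_neg_sub_le {τ n d : ℝ} (hτ : 0 ≤ τ) (hd : 0 ≤ d) (hdn : d ≤ n) :
    |Real.exp (-(τ * (n - d))) - Real.exp (-(τ * n)) * (1 + τ * d)| ≤ (τ * d) ^ 2 := by
  set u := τ * d with hu
  have hu0 : 0 ≤ u := by positivity
  have e1 : Real.exp (-(τ * (n - d))) = Real.exp (-(τ * n)) * Real.exp u := by
    rw [← Real.exp_add]; congr 1; rw [hu]; ring
  have h1 : Real.exp (-(τ * n)) ≤ Real.exp (-u) := by
    rw [hu]
    gcongr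
  have h2 : 0 ≤ Real.exp u - (1 + u) := by linarith [Real.add_one_le_exp u]
  have h3 : Real.exp (-u) * Real.exp u = 1 := by rw [← Real.exp_add]; simp
  have h4 : 1 - u ≤ Real.exp (-u) := by linarith [Real.add_one_le_exp (-u)]
  rw [e1, ← mul_sub, abs_of_nonneg (mul_nonneg (Real.exp_pos _).le h2)]
  calc _ ≤ Real.exp (-u) * (Real.exp u - (1 + u)) := by gcongr
    _ = 1 - Real.exp (-u) * (1 + u) := by rw [mul_sub, h3]
    _ ≤ 1 - (1 - u) * (1 + u) := by gcongr
    _ = u ^ 2 := by ring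

/-- One renewal step expanded to second order in θ: lowering the index by d contributes τ d, and the
phase contributes iθξ - (θξ)^2/2. Everything else is cubic in θ, and the weight d^4 is summable
against b^{d_i}. -/
theorem norm_gaussian_step_le {c₂ A θ ξ n d : ℝ} (hc : 0 ≤ c₂) (hA : 0 ≤ A) (hθ : |θ| ≤ 1)
    (hd : 1 ≤ d) (hdn : d ≤ n) (hξ : |ξ| ≤ A * d) :
    ‖Complex.exp ((θ * ξ : ℝ) * Complex.I) * (Real.exp (-(c₂ * θ ^ 2 / 2 * (n - d))) : ℂ) -
      (Real.exp (-(c₂ * θ ^ 2 / 2 * n)) : ℂ) * (1 + (c₂ * θ ^ 2 / 2 * d : ℝ) +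
        (θ * ξ : ℝ) * Complex.I - ((θ * ξ : ℝ) : ℂ) ^ 2 / 2)‖ ≤
      (c₂ ^ 2 + 4 * (1 + c₂) * A ^ 3 + c₂ * (A + A ^ 2)) * |θ| ^ 3 * d ^ 4 := by
  set τ := c₂ * θ ^ 2 / 2 with hτ
  set x := θ * ξ with hx
  have hτ0 : 0 ≤ τ := by positivity
  have hd0 : 0 ≤ d := by linarith
  have hn0 : 0 ≤ n := by linarith
  have hθ0 := abs_nonneg θ
  have hxA : |x| ≤ A * (|θ| * d) := by
    rw [hx, abs_mul]
    calc |θ| * |ξ| ≤ |θ| * (A * d) := by gcongr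
      _ = _ := by ring
  have hτθ : τ ≤ c₂ * |θ| ^ 2 := by
    rw [hτ, sq_abs]; nlinarith [mul_nonneg hc (sq_nonneg θ)]
  have hθ2 : |θ| ^ 2 ≤ 1 := pow_le_one₀ hθ0 hθ
  have hθ43 : |θ| ^ 4 ≤ |θ| ^ 3 := pow_le_pow_of_le_one hθ0 hθ (by norm_num)
  have hd24 : d ^ 2 ≤ d ^ 4 := pow_le_pow_right₀ hd (by norm_num)
  have hd34 : d ^ 3 ≤ d ^ 4 := pow_le_pow_right₀ hd (by norm_num)
  have hψ1 : Real.exp (-(τ * n)) ≤ 1 := by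
    rw [Real.exp_le_one_iff]; have : 0 ≤ τ * n := by positivity
    linarith
  have hψ0 := (Real.exp_pos (-(τ * n))).le
  -- Three error sources: the expansion of the Gaussian factor, the expansion of the phase, and the
  -- product of their nonconstant parts.
  have e : Complex.exp (x * Complex.I) * (Real.exp (-(τ * (n - d))) : ℂ) -
      (Real.exp (-(τ * n)) : ℂ) * (1 + (τ * d : ℝ) + x * Complex.I - (x : ℂ) ^ 2 / 2) =
      Complex.exp (x * Complex.I) *
        ((Real.exp (-(τ * (n - d))) - Real.exp (-(τ * n)) * (1 + τ * d) : ℝ) : ℂ) +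
      ((Real.exp (-(τ * n)) * (1 + τ * d) : ℝ) : ℂ) *
        (Complex.exp (x * Complex.I) - (1 + x * Complex.I - (x : ℂ) ^ 2 / 2)) +
      ((Real.exp (-(τ * n)) * (τ * d) : ℝ) : ℂ) * (x * Complex.I - (x : ℂ) ^ 2 / 2) := by
    push_cast; ring
  rw [e]
  have h1 : ‖Complex.exp (x * Complex.I) *
        ((Real.exp (-(τ * (n - d))) - Real.exp (-(τ * n)) * (1 + τ * d) : ℝ) : ℂ)‖ ≤
      c₂ ^ 2 * |θ| ^ 3 * d ^ 4 := by
    rw [norm_mul, Complex.norm_exp_ofReal_mul_I, one_mul, Complex.norm_real]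
    refine (abs_exp_neg_sub_le hτ0 hd0 hdn).trans ?_
    calc (τ * d) ^ 2 ≤ (c₂ * |θ| ^ 2 * d) ^ 2 := by gcongr
      _ = c₂ ^ 2 * |θ| ^ 4 * d ^ 2 := by ring
      _ ≤ _ := by gcongr
  have h2 : ‖((Real.exp (-(τ * n)) * (1 + τ * d) : ℝ) : ℂ) *
        (Complex.exp (x * Complex.I) - (1 + x * Complex.I - (x : ℂ) ^ 2 / 2))‖ ≤
      4 * (1 + c₂) * A ^ 3 * |θ| ^ 3 * d ^ 4 := by
    have h3 : |Real.exp (-(τ * n)) * (1 + τ * d)| ≤ (1 + c₂) * d := by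
      rw [abs_of_nonneg (by positivity)]
      have h4 : τ ≤ c₂ := hτθ.trans (mul_le_of_le_one_right hc hθ2)
      calc Real.exp (-(τ * n)) * (1 + τ * d) ≤ 1 * (1 * d + c₂ * d) := by
            gcongr; linarith
        _ = _ := by ring
    rw [norm_mul, Complex.norm_real, Real.norm_eq_abs]
    calc _ ≤ ((1 + c₂) * d) * (4 * |x| ^ 3) := by
          gcongr; exact norm_exp_mul_I_sub_le x
      _ ≤ ((1 + c₂) * d) * (4 * (A * (|θ| * d)) ^ 3) := by gcongr
      _ = _ := by ring
  have h3 : ‖((Real.exp (-(τ * n)) * (τ * d) : ℝ) : ℂ) * (x * Complex.I - (x : ℂ) ^ 2 / 2)‖ ≤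
      c₂ * (A + A ^ 2) * |θ| ^ 3 * d ^ 4 := by
    have h4 : ‖(x : ℂ) * Complex.I - (x : ℂ) ^ 2 / 2‖ ≤ |x| + |x| ^ 2 := by
      refine (norm_sub_le _ _).trans (add_le_add (by simp) ?_)
      rw [norm_div, norm_pow, Complex.norm_real, Real.norm_eq_abs]
      simp only [Complex.norm_ofNat]
      linarith [sq_nonneg |x|]
    have h5 : |x| + |x| ^ 2 ≤ (A + A ^ 2) * |θ| * d ^ 2 := by
      calc |x| + |x| ^ 2 ≤ A * (|θ| * d) + (A * (|θ| * d)) ^ 2 := by gcongr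
        _ = A * |θ| * d + A ^ 2 * (|θ| * |θ|) * d ^ 2 := by ring
        _ ≤ A * |θ| * d ^ 2 + A ^ 2 * (|θ| * 1) * d ^ 2 := by
            gcongr
            exact le_self_pow₀ hd (by norm_num)
        _ = _ := by ring
    rw [norm_mul, Complex.norm_real, Real.norm_eq_abs, abs_of_nonneg (by positivity)]
    calc _ ≤ (1 * (c₂ * |θ| ^ 2 * d)) * ((A + A ^ 2) * |θ| * d ^ 2) := by
          gcongr; exact h4.trans h5
      _ = c₂ * (A + A ^ 2) * |θ| ^ 3 * d ^ 3 := by ring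
      _ ≤ _ := by gcongr
  refine (norm_add₃_le).trans ((add_le_add (add_le_add h1 h2) h3).trans_eq ?_)
  ring

section CharFun

variable {Z : ℕ → ℕ} {a lam r C q : ℝ} {d : ℕ → ℕ} {R : ℕ → ℝ}

/-- The normalized sum of `exp (i θ (k(m) - c * n))` over `m < Z n`. -/
noncomputable def charMean (Z : ℕ → ℕ) (a lam c θ : ℝ) (n : ℕ) : ℂ :=
  greedyMean Z a lam (fun l => Complex.exp ((θ * ((l.length : ℝ) - c * n) : ℝ) * Complex.I)) n

theorem ExpGrowth.exists_charMean_renewal (hZ : ExpGrowth Z a lam r C)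
    (hd : QuasiGreedy lam⁻¹ d R) (hq : r / lam < q) :
    ∃ K, ∀ (θ : ℝ) (N : ℕ), ‖charMean Z a lam (meanRate lam⁻¹ d) θ N -
      ∑ i ∈ Finset.range (cnt d N), ((lam⁻¹ ^ d i : ℝ) : ℂ) *
        (Complex.exp ((θ * excess lam⁻¹ d i : ℝ) * Complex.I) *
          charMean Z a lam (meanRate lam⁻¹ d) θ (N - d i))‖ ≤ K * q ^ N := by
  set c := meanRate lam⁻¹ d with hc
  obtain ⟨K, L, hK⟩ := hZ.exists_renewal_of_le (E := ℂ) hd hq 0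
  refine ⟨K, fun θ N => ?_⟩
  have h1 := hK N 1 (fun l => Complex.exp ((θ * ((l.length : ℝ) - c * N) : ℝ) * Complex.I))
    fun l _ => by rw [Complex.norm_exp_ofReal_mul_I]; simp
  rw [mul_one] at h1
  have e : ∀ i ∈ Finset.range (cnt d N), lam⁻¹ ^ d i •
      greedyMean Z a lam (fun l => Complex.exp
        ((θ * (((expPrefix d N i ++ l).length : ℝ) - c * N) : ℝ) * Complex.I)) (N - d i) =
      ((lam⁻¹ ^ d i : ℝ) : ℂ) * (Complex.exp ((θ * excess lam⁻¹ d i : ℝ) * Complex.I) *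
          charMean Z a lam c θ (N - d i)) := fun i hi => by
    have hi' := hd.lt_cnt_iff.1 (Finset.mem_range.1 hi)
    simp_rw [length_prefix_sub c hi']
    rw [Complex.real_smul]
    congr 1
    rw [charMean, greedyMean, greedyMean, mul_smul_comm, greedySum, greedySum, Finset.mul_sum]
    congr 1
    refine Finset.sum_congr rfl fun m _ => ?_
    rw [← Complex.exp_add, excess, ← hc]
    congr 1
    push_cast; ring
  rw [Finset.sum_congr rfl e] at h1
  exact h1

/-- The second-order expansions average to 1 because Σ b^{d_i} = 1, Σ b^{d_i} ξ_i = 0 and Σ b^{d_i}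
ξ_i^2 = c₂ Σ b^{d_i} d_i. The choice of `varRate` cancels the θ^2 terms. -/
theorem ExpGrowth.exists_gaussian_renewal (hZ : ExpGrowth Z a lam r C)
    (hd : QuasiGreedy lam⁻¹ d R) (hq : r / lam < q) (hq1 : q < 1) :
    ∃ K, ∀ (θ : ℝ), |θ| ≤ 1 → ∀ N : ℕ,
      ‖((massRatio Z a lam N * Real.exp (-(varRate lam⁻¹ d * θ ^ 2 / 2 * N)) : ℝ) : ℂ) -
      ∑ i ∈ Finset.range (cnt d N), ((lam⁻¹ ^ d i : ℝ) : ℂ) *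
        (Complex.exp ((θ * excess lam⁻¹ d i : ℝ) * Complex.I) *
          ((massRatio Z a lam (N - d i) *
            Real.exp (-(varRate lam⁻¹ d * θ ^ 2 / 2 * (N - d i : ℕ))) : ℝ) : ℂ))‖ ≤
        K * q ^ N + K * |θ| ^ 3 := by
  have hbq := inv_lt_of_expGrowth hZ hq
  have hb0 := hd.b_pos
  have hq0 : 0 < q := hb0.trans hbq
  set c₂ := varRate lam⁻¹ d with hc₂
  have hc0 : 0 ≤ c₂ := hd.varRate_pos.le
  set ξ := excess lam⁻¹ d with hξ
  set σ := massRatio Z a lam with hσ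
  obtain ⟨A, hA, hA'⟩ := hd.exists_excess_le
  obtain ⟨A₂, hA₂⟩ := hd.exists_excess_sq_le
  obtain ⟨K₁, hK₁⟩ := hZ.exists_massRatio_sub_le hq
  obtain ⟨K₂, hK₂⟩ := hd.exists_abs_sum_sub_le (f := fun _ => 1) (k := 0) (A := 1)
    (y := fun n => |σ n - 1|) (y₀ := 0) (D := K₁) hbq hq1.le (by simp) (by simpa using hK₁)
  obtain ⟨M₀, hM₀⟩ := hd.exists_abs_sum_sub_le (f := fun _ => 1) (k := 0) (A := 1)
    (y := fun _ => 1) (y₀ := 1) (D := 0) hbq hq1.le (by simp) (by simp)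
  obtain ⟨M₁, hM₁⟩ := hd.exists_abs_sum_sub_le (f := fun i => (d i : ℝ)) (k := 1) (A := 1)
    (y := fun _ => 1) (y₀ := 1) (D := 0) hbq hq1.le (by simp) (by simp)
  obtain ⟨M₂, hM₂⟩ := hd.exists_abs_sum_sub_le (f := ξ) (k := 1)
    (y := fun _ => 1) (y₀ := 1) (D := 0) hbq hq1.le (by simpa using hA') (by simp)
  obtain ⟨M₃, hM₃⟩ := hd.exists_abs_sum_sub_le (f := fun i => ξ i ^ 2) (k := 2)
    (y := fun _ => 1) (y₀ := 1) (D := 0) hbq hq1.le hA₂ (by simp)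
  simp only [mul_one, one_mul, zero_mul, sub_zero] at hK₂ hM₀ hM₁ hM₂ hM₃
  rw [hd.hasSum.tsum_eq] at hM₀
  rw [hd.tsum_excess] at hM₂
  rw [hd.varRate_mul_stepMean, ← hc₂] at hM₃
  change ∀ N, |_ - stepMean lam⁻¹ d| ≤ _ at hM₁
  set S := ∑' i, lam⁻¹ ^ d i * (d i : ℝ) ^ 4 with hS
  set G := c₂ ^ 2 + 4 * (1 + c₂) * A ^ 3 + c₂ * (A + A ^ 2) with hG
  have hS0 : 0 ≤ S := tsum_nonneg fun i => by positivity
  have hG0 : 0 ≤ G := by positivity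
  set Q := K₁ + K₂ + (M₀ + c₂ * M₁ + M₂ + M₃) with hQ
  refine ⟨max Q (G * S), fun θ hθ N => ?_⟩
  set τ := c₂ * θ ^ 2 / 2 with hτ
  have hτ0 : 0 ≤ τ := by positivity
  have hψ : ∀ n : ℕ, |Real.exp (-(τ * n))| ≤ 1 := fun n => by
    rw [abs_of_pos (Real.exp_pos _), Real.exp_le_one_iff]
    have : 0 ≤ τ * n := by positivity
    linarith
  set s := Finset.range (cnt d N) with hs
  set p : ℕ → ℝ := fun i => lam⁻¹ ^ d i with hp
  have hp0 : ∀ i, 0 < p i := fun i => pow_pos hb0 _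
  set X : ℕ → ℂ := fun i => Complex.exp ((θ * ξ i : ℝ) * Complex.I) with hX
  have hX1 : ∀ i, ‖X i‖ = 1 := fun i => Complex.norm_exp_ofReal_mul_I _
  set P : ℕ → ℂ := fun i => 1 + (τ * d i : ℝ) + (θ * ξ i : ℝ) * Complex.I -
    ((θ * ξ i : ℝ) : ℂ) ^ 2 / 2 with hP
  have h1 : ‖((σ N - 1) * Real.exp (-(τ * N)) : ℝ)‖ ≤ K₁ * q ^ N := by
    rw [norm_mul]
    exact (mul_le_of_le_one_right (norm_nonneg _) (hψ N)).trans (hK₁ N)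
  have h2 : ‖∑ i ∈ s, (p i : ℂ) * (X i * (((σ (N - d i) - 1) *
      Real.exp (-(τ * (N - d i : ℕ))) : ℝ) : ℂ))‖ ≤ K₂ * q ^ N := by
    refine le_trans ?_ ((le_abs_self _).trans (hK₂ N))
    refine norm_sum_le_of_le _ fun i _ => ?_
    rw [norm_mul, norm_mul, hX1, one_mul, Complex.norm_real, Complex.norm_real, norm_mul,
      Real.norm_eq_abs, abs_of_pos (hp0 i)]
    gcongr
    exact mul_le_of_le_one_right (norm_nonneg _) (hψ _)
  have h3 : ‖∑ i ∈ s, (p i : ℂ) * (X i * (Real.exp (-(τ * (N - d i : ℕ))) : ℂ) -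
      (Real.exp (-(τ * N)) : ℂ) * P i)‖ ≤ G * S * |θ| ^ 3 := by
    have h4 : ∀ i ∈ s, ‖(p i : ℂ) * (X i * (Real.exp (-(τ * (N - d i : ℕ))) : ℂ) -
      (Real.exp (-(τ * N)) : ℂ) * P i)‖ ≤ G * |θ| ^ 3 * (p i * (d i : ℝ) ^ 4) := fun i hi => by
      have hi' := hd.lt_cnt_iff.1 (Finset.mem_range.1 hi)
      have h5 := norm_gaussian_step_le (n := N) hc0 hA hθ (by exact_mod_cast hd.one_le i)
        (by exact_mod_cast hi') (hA' i)
      rw [norm_mul, Complex.norm_real, Real.norm_eq_abs, abs_of_pos (hp0 i), Nat.cast_sub hi']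
      calc _ ≤ p i * (G * |θ| ^ 3 * (d i : ℝ) ^ 4) := by
            refine mul_le_mul_of_nonneg_left ?_ (hp0 i).le
            exact h5
        _ = _ := by ring
    refine (norm_sum_le_of_le _ h4).trans ?_
    rw [← Finset.mul_sum]
    have h6 : ∑ i ∈ s, p i * (d i : ℝ) ^ 4 ≤ S :=
      (hd.summable_pow_mul hb0.le hd.b_lt 4).sum_le_tsum _ fun i _ => by positivity
    calc _ ≤ G * |θ| ^ 3 * S := by gcongr
      _ = _ := by ring
  have h4 : ‖(Real.exp (-(τ * N)) : ℂ) * (∑ i ∈ s, (p i : ℂ) * P i - 1)‖ ≤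
      (M₀ + c₂ * M₁ + M₂ + M₃) * q ^ N := by
    rw [norm_mul, Complex.norm_real]
    refine (mul_le_of_le_one_left (norm_nonneg _) (hψ N)).trans ?_
    have e : ∑ i ∈ s, (p i : ℂ) * P i - 1 = ((∑ i ∈ s, p i - 1 : ℝ) : ℂ) +
        ((τ * (∑ i ∈ s, p i * d i - stepMean lam⁻¹ d) : ℝ) : ℂ) +
        (θ * (∑ i ∈ s, p i * ξ i - 0) : ℝ) * Complex.I -
        ((θ ^ 2 / 2 * (∑ i ∈ s, p i * ξ i ^ 2 - c₂ * stepMean lam⁻¹ d) : ℝ) : ℂ) := by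
      have e1 : ∑ i ∈ s, (p i : ℂ) * P i = (∑ i ∈ s, (p i : ℂ)) + τ * (∑ i ∈ s, (p i : ℂ) * d i) +
          θ * (∑ i ∈ s, (p i : ℂ) * ξ i) * Complex.I -
          θ ^ 2 / 2 * (∑ i ∈ s, (p i : ℂ) * (ξ i : ℂ) ^ 2) := by
        rw [Finset.mul_sum, Finset.mul_sum, Finset.mul_sum, Finset.sum_mul,
          ← Finset.sum_add_distrib, ← Finset.sum_add_distrib, ← Finset.sum_sub_distrib]
        refine Finset.sum_congr rfl fun i _ => ?_
        simp only [hP]; push_cast; ring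
      rw [e1]; simp only [hτ]; push_cast; ring
    rw [e]
    have hθ2 : θ ^ 2 ≤ 1 := by rw [← sq_abs]; exact pow_le_one₀ (abs_nonneg _) hθ
    have b1 : ‖((∑ i ∈ s, p i - 1 : ℝ) : ℂ)‖ ≤ M₀ * q ^ N := by
      rw [Complex.norm_real]; exact hM₀ N
    have b2 : ‖((τ * (∑ i ∈ s, p i * d i - stepMean lam⁻¹ d) : ℝ) : ℂ)‖ ≤ c₂ * M₁ * q ^ N := by
      rw [Complex.norm_real, norm_mul, Real.norm_eq_abs, abs_of_nonneg hτ0, mul_assoc]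
      have : τ ≤ c₂ := by rw [hτ]; nlinarith
      gcongr
      exact hM₁ N
    have b3 : ‖((θ * (∑ i ∈ s, p i * ξ i - 0) : ℝ) : ℂ) * Complex.I‖ ≤ M₂ * q ^ N := by
      rw [norm_mul, Complex.norm_I, mul_one, Complex.norm_real, norm_mul]
      exact (mul_le_of_le_one_left (norm_nonneg _) hθ).trans (hM₂ N)
    have b4 : ‖((θ ^ 2 / 2 * (∑ i ∈ s, p i * ξ i ^ 2 - c₂ * stepMean lam⁻¹ d) : ℝ) : ℂ)‖ ≤
        M₃ * q ^ N := by
      rw [Complex.norm_real, norm_mul]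
      refine (mul_le_of_le_one_left (norm_nonneg _) ?_).trans (hM₃ N)
      rw [Real.norm_eq_abs, abs_of_nonneg (by positivity)]; linarith
    refine (norm_sub_le _ _).trans ((add_le_add (norm_add₃_le.trans
      (add_le_add (add_le_add b1 b2) b3)) b4).trans_eq ?_)
    ring
  -- The defect splits into the deviation of `massRatio` from 1, outside and inside the sum, the
  -- cubic step errors, and the truncation of the averaged expansion.
  have e : ((σ N * Real.exp (-(τ * N)) : ℝ) : ℂ) -
      ∑ i ∈ s, (p i : ℂ) * (X i * ((σ (N - d i) * Real.exp (-(τ * (N - d i : ℕ))) : ℝ) : ℂ)) =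
      (((σ N - 1) * Real.exp (-(τ * N)) : ℝ) : ℂ) -
      ∑ i ∈ s, (p i : ℂ) * (X i * (((σ (N - d i) - 1) *
      Real.exp (-(τ * (N - d i : ℕ))) : ℝ) : ℂ)) -
      ∑ i ∈ s, (p i : ℂ) * (X i * (Real.exp (-(τ * (N - d i : ℕ))) : ℂ) -
      (Real.exp (-(τ * N)) : ℂ) * P i) -
      (Real.exp (-(τ * N)) : ℂ) * (∑ i ∈ s, (p i : ℂ) * P i - 1) := by
    have e1 : ∑ i ∈ s, (p i : ℂ) * (X i * ((σ (N - d i) *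
          Real.exp (-(τ * (N - d i : ℕ))) : ℝ) : ℂ)) =
        ∑ i ∈ s, (p i : ℂ) * (X i * (((σ (N - d i) - 1) *
          Real.exp (-(τ * (N - d i : ℕ))) : ℝ) : ℂ)) +
        ∑ i ∈ s, (p i : ℂ) * (X i * (Real.exp (-(τ * (N - d i : ℕ))) : ℂ) -
          (Real.exp (-(τ * N)) : ℂ) * P i) +
        (Real.exp (-(τ * N)) : ℂ) * ∑ i ∈ s, (p i : ℂ) * P i := by
      rw [Finset.mul_sum, ← Finset.sum_add_distrib, ← Finset.sum_add_distrib]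
      refine Finset.sum_congr rfl fun i _ => ?_
      push_cast; ring
    rw [e1]; push_cast; ring
  rw [e]
  rw [← Complex.norm_real] at h1
  have h5 := (norm_sub_le_of_le (norm_sub_le_of_le (norm_sub_le_of_le h1 h2) h3) h4)
  refine h5.trans ?_
  have h6 : 0 ≤ q ^ N := by positivity
  have h7 := mul_le_mul_of_nonneg_right (le_max_left Q (G * S)) h6
  have h8 : 0 ≤ |θ| ^ 3 := by positivity
  have h9 := mul_le_mul_of_nonneg_right (le_max_right Q (G * S)) h8
  have h10 : Q * q ^ N = K₁ * q ^ N + K₂ * q ^ N + (M₀ + c₂ * M₁ + M₂ + M₃) * q ^ N := by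
    rw [hQ]; ring
  linarith

end CharFun

/-! ### Convergence of characteristic functions -/

section Limit

variable {Z : ℕ → ℕ} {a lam r C q : ℝ} {d : ℕ → ℕ} {R : ℕ → ℝ}

theorem greedyMean_complex (Z : ℕ → ℕ) (a lam : ℝ) (Φ : List ℕ → ℂ) (n : ℕ) :
    greedyMean Z a lam Φ n =
      (∑ m ∈ Finset.range (Z n), Φ (greedy Z m)) / ((a * lam ^ n : ℝ) : ℂ) := by
  rw [greedyMean, greedySum, Complex.real_smul, div_eq_inv_mul, Complex.ofReal_inv]

/-- The deviation of `charMean` from the Gaussian profile. -/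
noncomputable def charDiff (Z : ℕ → ℕ) (a lam c c₂ θ : ℝ) (n : ℕ) : ℂ :=
  charMean Z a lam c θ n -
    ((massRatio Z a lam n * Real.exp (-(c₂ * θ ^ 2 / 2 * n)) : ℝ) : ℂ)

theorem tendsto_charDiff_zero (Z : ℕ → ℕ) (a lam c c₂ : ℝ) (n : ℕ) :
    Tendsto (fun θ => charDiff Z a lam c c₂ θ n) (𝓝 0) (𝓝 0) := by
  have hc : Continuous fun θ => charDiff Z a lam c c₂ θ n := by
    simp only [charDiff, charMean, greedyMean_complex]
    fun_prop
  have h0 : charDiff Z a lam c c₂ 0 n = 0 := by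
    simp [charDiff, charMean, greedyMean_complex, massRatio]
  have := hc.tendsto 0
  rwa [h0] at this

/-- The phases have modulus one, so the norm of the difference is a subsolution of the renewal
equation and is bounded by accumulated forcing. The cut-off n₀ separates finitely many initial
terms, which are small only because θ is, from a uniformly small geometric tail. -/
theorem ExpGrowth.exists_charDiff_bound (hZ : ExpGrowth Z a lam r C)
    (hd : QuasiGreedy lam⁻¹ d R) :
    ∃ K s, 0 ≤ K ∧ 0 < s ∧ s < 1 ∧ ∀ (n₀ : ℕ) (θ : ℝ), |θ| ≤ 1 → ∀ N : ℕ,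
      ‖charDiff Z a lam (meanRate lam⁻¹ d) (varRate lam⁻¹ d) θ N‖ ≤
        ∑ k ∈ Finset.range n₀, ‖charDiff Z a lam (meanRate lam⁻¹ d) (varRate lam⁻¹ d) θ k‖ +
          K * s ^ n₀ + K * (|θ| ^ 3 * ((N : ℝ) + 1)) := by
  have hl := hZ.one_lt
  obtain ⟨q, hq, hq1⟩ := exists_between ((div_lt_one (by linarith)).2 hZ.r_lt)
  have hb0 := hd.b_pos
  have hq0 : 0 < q := hb0.trans (inv_lt_of_expGrowth hZ hq)
  obtain ⟨K₁, hK₁⟩ := hZ.exists_charMean_renewal hd hq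
  obtain ⟨K₂, hK₂⟩ := hZ.exists_gaussian_renewal hd hq hq1
  set c := meanRate lam⁻¹ d with hc
  set c₂ := varRate lam⁻¹ d with hc₂
  set D := charDiff Z a lam c c₂ with hD
  have hstep : ∀ θ : ℝ, |θ| ≤ 1 → ∀ N, ‖D θ N‖ ≤
      ∑ i ∈ Finset.range (cnt d N), lam⁻¹ ^ d i * ‖D θ (N - d i)‖ +
        ((|K₁| + |K₂|) * q ^ N + |K₂| * |θ| ^ 3) := by
    intro θ hθ N
    have h1 := hK₁ θ N
    have h2 := hK₂ θ hθ N
    have h3 : ‖∑ i ∈ Finset.range (cnt d N), ((lam⁻¹ ^ d i : ℝ) : ℂ) *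
        (Complex.exp ((θ * excess lam⁻¹ d i : ℝ) * Complex.I) * D θ (N - d i))‖ ≤
        ∑ i ∈ Finset.range (cnt d N), lam⁻¹ ^ d i * ‖D θ (N - d i)‖ := by
      refine norm_sum_le_of_le _ fun i _ => ?_
      rw [norm_mul, norm_mul, Complex.norm_exp_ofReal_mul_I, one_mul, Complex.norm_real,
        Real.norm_eq_abs, abs_of_pos (pow_pos hb0 _)]
    have h4 := norm_add_le_of_le h3 (norm_sub_le_of_le h1 h2)
    have e : ∑ i ∈ Finset.range (cnt d N), ((lam⁻¹ ^ d i : ℝ) : ℂ) *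
        (Complex.exp ((θ * excess lam⁻¹ d i : ℝ) * Complex.I) * D θ (N - d i)) =
        ∑ i ∈ Finset.range (cnt d N), ((lam⁻¹ ^ d i : ℝ) : ℂ) *
          (Complex.exp ((θ * excess lam⁻¹ d i : ℝ) * Complex.I) *
            charMean Z a lam c θ (N - d i)) -
        ∑ i ∈ Finset.range (cnt d N), ((lam⁻¹ ^ d i : ℝ) : ℂ) *
          (Complex.exp ((θ * excess lam⁻¹ d i : ℝ) * Complex.I) *
            ((massRatio Z a lam (N - d i) *
              Real.exp (-(c₂ * θ ^ 2 / 2 * (N - d i : ℕ))) : ℝ) : ℂ)) := by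
      rw [← Finset.sum_sub_distrib]
      refine Finset.sum_congr rfl fun i _ => ?_
      simp only [hD, charDiff]; ring
    rw [e, sub_add_sub_comm, add_sub_cancel, add_sub_cancel] at h4
    refine h4.trans ?_
    have h5 := mul_le_mul_of_nonneg_right (le_abs_self K₁) (pow_pos hq0 N).le
    have h6 := mul_le_mul_of_nonneg_right (le_abs_self K₂) (pow_pos hq0 N).le
    have h7 := mul_le_mul_of_nonneg_right (le_abs_self K₂) (pow_nonneg (abs_nonneg θ) 3)
    linarith
  set K := |K₁| + |K₂| with hK
  -- For k ≥ n₀, q^k = s^k s^k ≤ s^{n₀} s^k: one factor is small and the other summable.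
  set s := √q with hs
  have hs0 : 0 < s := Real.sqrt_pos.2 hq0
  have hs1 : s < 1 := by rw [hs, Real.sqrt_lt' one_pos]; simpa using hq1
  have hss : s * s = q := Real.mul_self_sqrt hq0.le
  have hK0 : 0 ≤ K := by positivity
  refine ⟨K * (1 - s)⁻¹ + K, s, ?_, hs0, hs1, fun n₀ θ hθ N => ?_⟩
  · have : 0 < 1 - s := by linarith
    positivity
  -- Below n₀ the difference itself is declared to be forcing, so the renewal estimate is needed
  -- only from n₀ on.
  have hmain := hd.le_sum_of_renewal (x := fun n => ‖D θ n‖)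
    (e := fun k => (if k < n₀ then ‖D θ k‖ else 0) + K * (s ^ n₀ * s ^ k) + |K₂| * |θ| ^ 3)
    (fun k => by
      have : 0 ≤ (if k < n₀ then ‖D θ k‖ else 0) := by split_ifs <;> positivity
      positivity)
    (fun k => by
      have h0 : 0 ≤ ∑ i ∈ Finset.range (cnt d k), lam⁻¹ ^ d i * ‖D θ (k - d i)‖ :=
        Finset.sum_nonneg fun i _ => by positivity
      have h1 : 0 ≤ K * (s ^ n₀ * s ^ k) := by positivity
      have h2 : 0 ≤ |K₂| * |θ| ^ 3 := by positivity
      by_cases hk : k < n₀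
      · simp only [if_pos hk]; linarith
      · simp only [if_neg hk]
        have h3 : q ^ k ≤ s ^ n₀ * s ^ k := by
          rw [← hss, mul_pow]
          exact mul_le_mul_of_nonneg_right
            (pow_le_pow_of_le_one hs0.le hs1.le (not_lt.1 hk)) (by positivity)
        have := hstep θ hθ k
        have := mul_le_mul_of_nonneg_left h3 hK0
        linarith) N
  refine hmain.trans ?_
  rw [Finset.sum_add_distrib, Finset.sum_add_distrib]
  have g1 : ∑ k ∈ Finset.range (N + 1), (if k < n₀ then ‖D θ k‖ else 0) ≤
      ∑ k ∈ Finset.range n₀, ‖D θ k‖ := by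
    rw [← Finset.sum_filter]
    refine Finset.sum_le_sum_of_subset_of_nonneg (fun k hk => ?_) fun k _ _ => norm_nonneg _
    exact Finset.mem_range.2 (Finset.mem_filter.1 hk).2
  have g2 : ∑ k ∈ Finset.range (N + 1), K * (s ^ n₀ * s ^ k) ≤
      (K * (1 - s)⁻¹ + K) * s ^ n₀ := by
    rw [← Finset.mul_sum, ← Finset.mul_sum]
    have h1 : ∑ k ∈ Finset.range (N + 1), s ^ k ≤ (1 - s)⁻¹ := by
      rw [← tsum_geometric_of_lt_one hs0.le hs1]
      exact (summable_geometric_of_lt_one hs0.le hs1).sum_le_tsum _ fun i _ => by positivity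
    calc K * (s ^ n₀ * ∑ k ∈ Finset.range (N + 1), s ^ k) ≤ K * (s ^ n₀ * (1 - s)⁻¹) := by gcongr
      _ ≤ K * (s ^ n₀ * (1 - s)⁻¹) + K * s ^ n₀ := le_add_of_nonneg_right (by positivity)
      _ = _ := by ring
  have g3 : ∑ k ∈ Finset.range (N + 1), |K₂| * |θ| ^ 3 ≤
      (K * (1 - s)⁻¹ + K) * (|θ| ^ 3 * ((N : ℝ) + 1)) := by
    rw [Finset.sum_const, Finset.card_range, nsmul_eq_mul]
    have h1 : |K₂| ≤ K * (1 - s)⁻¹ + K := by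
      have : 0 ≤ K * (1 - s)⁻¹ := mul_nonneg hK0 (inv_nonneg.2 (by linarith))
      have := abs_nonneg K₁
      linarith
    push_cast
    calc ((N : ℝ) + 1) * (|K₂| * |θ| ^ 3) = |K₂| * (|θ| ^ 3 * ((N : ℝ) + 1)) := by ring
      _ ≤ _ := by gcongr
  linarith

/-- The characteristic function of `k(m)` for `m` uniform in `U`, centred at `c`. -/
noncomputable def charAvg (Z : ℕ → ℕ) (U : Finset ℕ) (c θ : ℝ) : ℂ :=
  (∑ m ∈ U, Complex.exp ((θ * ((numSummands Z m : ℝ) - c) : ℝ) * Complex.I)) / U.card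

theorem tendsto_zero_of_mul_sqrt {θ : ℕ → ℝ} {n : ℕ → ℕ} {t : ℝ} (hn : Tendsto n atTop atTop)
    (hθ : Tendsto (fun k => θ k * √(n k)) atTop (𝓝 t)) : Tendsto θ atTop (𝓝 0) := by
  have hs : Tendsto (fun k => √(n k : ℝ)) atTop atTop :=
    Real.tendsto_sqrt_atTop.comp (tendsto_natCast_atTop_atTop.comp hn)
  refine (hθ.div_atTop hs).congr' ?_
  filter_upwards [hs.eventually_gt_atTop 0] with k hk
  field_simp

/-- After n₀ is fixed to make K s^{n₀} small, the initial terms vanish as θ → 0, and |θ|^3 n = |θ|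
(θ√n)^2 → 0. -/
theorem ExpGrowth.tendsto_charDiff (hZ : ExpGrowth Z a lam r C)
    (hd : QuasiGreedy lam⁻¹ d R) {θ : ℕ → ℝ} {n : ℕ → ℕ} {t : ℝ} (hn : Tendsto n atTop atTop)
    (hθ : Tendsto (fun k => θ k * √(n k)) atTop (𝓝 t)) :
    Tendsto (fun k => charDiff Z a lam (meanRate lam⁻¹ d) (varRate lam⁻¹ d) (θ k) (n k)) atTop
      (𝓝 0) := by
  obtain ⟨K, s, hK, hs0, hs1, hb⟩ := hZ.exists_charDiff_bound hd
  set c := meanRate lam⁻¹ d with hc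
  set c₂ := varRate lam⁻¹ d with hc₂
  have hθ0 := tendsto_zero_of_mul_sqrt hn hθ
  have h3 : Tendsto (fun k => K * (|θ k| ^ 3 * ((n k : ℝ) + 1))) atTop (𝓝 0) := by
    have h1 : Tendsto (fun k => K * (|θ k| * (|θ k * √(n k)| ^ 2 + |θ k| ^ 2))) atTop
        (𝓝 (K * (|0| * (|t| ^ 2 + |0| ^ 2)))) :=
      ((hθ0.abs).mul ((hθ.abs.pow 2).add (hθ0.abs.pow 2))).const_mul K
    simp only [abs_zero, zero_mul, mul_zero] at h1
    refine h1.congr fun k => ?_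
    rw [abs_mul, mul_pow, sq_abs (√(n k : ℝ)), Real.sq_sqrt (Nat.cast_nonneg _)]
    ring
  rw [tendsto_zero_iff_norm_tendsto_zero]
  rw [Metric.tendsto_atTop]
  intro ε hε
  have hsn : Tendsto (fun m : ℕ => K * s ^ m) atTop (𝓝 (K * 0)) :=
    (tendsto_pow_atTop_nhds_zero_of_lt_one hs0.le hs1).const_mul K
  rw [mul_zero] at hsn
  obtain ⟨n₀, hn₀⟩ := (hsn.eventually (gt_mem_nhds (show 0 < ε / 3 by linarith))).exists
  have h1 : Tendsto (fun k => ∑ j ∈ Finset.range n₀, ‖charDiff Z a lam c c₂ (θ k) j‖) atTop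
      (𝓝 0) := by
    have : Tendsto (fun k => ∑ j ∈ Finset.range n₀, ‖charDiff Z a lam c c₂ (θ k) j‖) atTop
        (𝓝 (∑ j ∈ Finset.range n₀, ‖(0 : ℂ)‖)) :=
      tendsto_finsetSum _ fun j _ => ((tendsto_charDiff_zero Z a lam c c₂ j).comp hθ0).norm
    simpa using this
  have h4 : ∀ᶠ k in atTop, |θ k| ≤ 1 := by
    have := hθ0.abs
    rw [abs_zero] at this
    exact (this.eventually (gt_mem_nhds one_pos)).mono fun k hk => le_of_lt hk
  have h5 : ∀ᶠ k in atTop, ‖charDiff Z a lam c c₂ (θ k) (n k)‖ < ε := by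
    filter_upwards [h1.eventually (gt_mem_nhds (show 0 < ε / 3 by linarith)),
      h3.eventually (gt_mem_nhds (show 0 < ε / 3 by linarith)), h4] with k e1 e2 e3
    have := hb n₀ (θ k) e3 (n k)
    linarith
  obtain ⟨k₀, hk₀⟩ := eventually_atTop.1 h5
  exact ⟨k₀, fun k hk => by rw [Real.dist_eq, sub_zero, abs_norm]; exact hk₀ k hk⟩

theorem ExpGrowth.tendsto_massRatio (hZ : ExpGrowth Z a lam r C) :
    Tendsto (massRatio Z a lam) atTop (𝓝 1) := by
  have hl := hZ.one_lt
  have hr := hZ.one_lt_r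
  obtain ⟨q, hq, hq1⟩ := exists_between ((div_lt_one (by linarith)).2 hZ.r_lt)
  have hq0 : 0 < q := lt_trans (div_pos (by linarith) (by linarith)) hq
  obtain ⟨K, hK⟩ := hZ.exists_massRatio_sub_le hq
  rw [tendsto_iff_norm_sub_tendsto_zero]
  have := (tendsto_pow_atTop_nhds_zero_of_lt_one hq0.le hq1).const_mul K
  rw [mul_zero] at this
  exact squeeze_zero (fun n => norm_nonneg _) hK this

theorem ExpGrowth.tendsto_charAvg (hZ : ExpGrowth Z a lam r C)
    (hd : QuasiGreedy lam⁻¹ d R) {θ : ℕ → ℝ} {n : ℕ → ℕ} {t : ℝ} (hn : Tendsto n atTop atTop)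
    (hθ : Tendsto (fun k => θ k * √(n k)) atTop (𝓝 t)) :
    Tendsto (fun k => charAvg Z (Finset.range (Z (n k))) (meanRate lam⁻¹ d * n k) (θ k)) atTop
      (𝓝 (Real.exp (-(varRate lam⁻¹ d * t ^ 2 / 2)) : ℂ)) := by
  have h1 := hZ.tendsto_charDiff hd hn hθ
  have hσ := hZ.tendsto_massRatio.comp hn
  set c := meanRate lam⁻¹ d with hc
  set c₂ := varRate lam⁻¹ d with hc₂
  have ha := hZ.a_pos
  have hl := hZ.one_lt
  have h2 : Tendsto (fun k => Real.exp (-(c₂ * θ k ^ 2 / 2 * n k))) atTop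
      (𝓝 (Real.exp (-(c₂ * t ^ 2 / 2)))) := by
    refine (Real.continuous_exp.tendsto _).comp ?_
    have h3 := (((hθ.pow 2).const_mul c₂).div_const 2).neg
    refine h3.congr fun k => ?_
    rw [mul_pow, Real.sq_sqrt (Nat.cast_nonneg _)]; ring
  have hσ' : Tendsto (fun k => ((massRatio Z a lam (n k) : ℝ) : ℂ)) atTop (𝓝 ((1 : ℝ) : ℂ)) :=
    (Complex.continuous_ofReal.tendsto _).comp hσ
  have h2' := (Complex.continuous_ofReal.tendsto _).comp h2
  have h4 := (h1.div hσ' (by simp)).add h2'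
  rw [zero_div, zero_add] at h4
  refine h4.congr fun k => ?_
  have hm : ((massRatio Z a lam (n k) : ℝ) : ℂ) ≠ 0 := by
    exact_mod_cast (hZ.massRatio_pos (n k)).ne'
  have hZk : (Z (n k) : ℂ) ≠ 0 := by exact_mod_cast (hZ.pos (n k)).ne'
  have hak : ((a * lam ^ n k : ℝ) : ℂ) ≠ 0 := by
    have : a * lam ^ n k ≠ 0 := by positivity
    exact_mod_cast this
  have e1 : charDiff Z a lam c c₂ (θ k) (n k) / (massRatio Z a lam (n k) : ℝ) +
      (Real.exp (-(c₂ * θ k ^ 2 / 2 * n k)) : ℂ) =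
      charMean Z a lam c (θ k) (n k) / (massRatio Z a lam (n k) : ℝ) := by
    rw [charDiff]
    push_cast
    field_simp
    ring
  refine e1.trans ?_
  rw [charMean, greedyMean_complex, massRatio, charAvg, Finset.card_range]
  simp only [numSummands]
  rw [Complex.ofReal_div, Complex.ofReal_natCast, div_div_div_cancel_right₀ hak]

end Limit

/-! ### From characteristic functions to the central limit theorem -/

/-- Lévy's continuity theorem for the empirical measures, together with the fact that a
nondegenerate Gaussian has no atom at x. -/
theorem tendsto_cdf_of_tendsto_char {U : ℕ → Finset ℕ} (hU : ∀ N, (U N).Nonempty)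
    (X : ℕ → ℕ → ℝ)
    (h : ∀ t : ℝ, Tendsto (fun N => (∑ m ∈ U N, Complex.exp ((t * X N m : ℝ) * Complex.I)) /
      ((U N).card : ℂ)) atTop (𝓝 (Real.exp (-(t ^ 2 / 2)) : ℂ))) (x : ℝ) :
    Tendsto (fun N => (((U N).filter fun m => X N m ≤ x).card : ℝ) / (U N).card) atTop
      (𝓝 (cdf (gaussianReal 0 1) x)) := by
  classical
  let μ : ℕ → MeasureTheory.Measure ℝ := fun N =>
    ((U N).card : ENNReal)⁻¹ • ∑ m ∈ U N, MeasureTheory.Measure.dirac (X N m)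
  have hcard : ∀ N, ((U N).card : ENNReal) ≠ 0 := fun N => by
    exact_mod_cast (hU N).card_pos.ne'
  have hprob : ∀ N, MeasureTheory.IsProbabilityMeasure (μ N) := fun N => by
    constructor
    simp only [μ, MeasureTheory.Measure.smul_apply, MeasureTheory.Measure.finsetSum_apply,
      MeasureTheory.measure_univ, Finset.sum_const, nsmul_eq_mul, mul_one, smul_eq_mul]
    exact ENNReal.inv_mul_cancel (hcard N) (ENNReal.natCast_ne_top _)
  let ν : ℕ → MeasureTheory.ProbabilityMeasure ℝ := fun N => ⟨μ N, hprob N⟩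
  let g : MeasureTheory.ProbabilityMeasure ℝ := ⟨gaussianReal 0 1, inferInstance⟩
  have hchar : ∀ N t, MeasureTheory.charFun (μ N) t =
      (∑ m ∈ U N, Complex.exp ((t * X N m : ℝ) * Complex.I)) / ((U N).card : ℂ) := by
    intro N t
    rw [MeasureTheory.charFun_apply_real]
    simp only [μ]
    rw [MeasureTheory.integral_smul_measure, MeasureTheory.integral_finsetSum_measure]
    · simp only [MeasureTheory.integral_dirac, ENNReal.toReal_inv, ENNReal.toReal_natCast]
      rw [Complex.real_smul, div_eq_inv_mul]
      push_cast
      rfl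
    · intro m _
      exact MeasureTheory.integrable_dirac (by simp)
  have hconv : Tendsto ν atTop (𝓝 g) := by
    rw [MeasureTheory.ProbabilityMeasure.tendsto_iff_tendsto_charFun]
    intro t
    change Tendsto (fun N => MeasureTheory.charFun (μ N) t) atTop
      (𝓝 (MeasureTheory.charFun (gaussianReal 0 1) t))
    rw [charFun_gaussianReal]
    simp_rw [hchar]
    convert h t using 2
    push_cast
    congr 1
    simp
  have hnull : g (frontier (Set.Iic x)) = 0 := by
    rw [frontier_Iic]
    change ((gaussianReal 0 1) {x}).toNNReal = 0
    have := nullSingletonClass_gaussianReal (μ := 0) (v := 1) one_ne_zero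
    rw [MeasureTheory.measure_singleton]; rfl
  have hlim := MeasureTheory.ProbabilityMeasure.tendsto_measure_of_null_frontier_of_tendsto
    hconv hnull
  have hlim' := (NNReal.continuous_coe.tendsto _).comp hlim
  have e2 : ((g (Set.Iic x) : NNReal) : ℝ) = cdf (gaussianReal 0 1) x := by
    rw [cdf_eq_real]; rfl
  rw [e2] at hlim'
  refine hlim'.congr fun N => ?_
  change ((μ N) (Set.Iic x)).toReal = _
  simp only [μ, MeasureTheory.Measure.smul_apply, MeasureTheory.Measure.finsetSum_apply,
    smul_eq_mul]
  have e3 : ∀ m ∈ U N, MeasureTheory.Measure.dirac (X N m) (Set.Iic x) =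
      if X N m ≤ x then (1 : ENNReal) else 0 := fun m _ => by
    rw [MeasureTheory.Measure.dirac_apply' _ measurableSet_Iic, Set.indicator_apply]
    simp
  rw [Finset.sum_congr rfl e3, Finset.sum_boole, ENNReal.toReal_mul, ENNReal.toReal_inv,
    ENNReal.toReal_natCast, ENNReal.toReal_natCast, div_eq_inv_mul]

/-- Centring at C₁ N suffices: the true mean differs by a bounded δ. It changes the variance by δ^2
= O(1), and the characteristic function by a phase θδ → 0. -/
theorem gaussianSummands_of {Z : ℕ → ℕ} {U : ℕ → Finset ℕ} {C₁ C₂ M₁ M₂ : ℝ} (hC₂ : 0 < C₂)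
    (hne : ∀ᶠ N in atTop, (U N).Nonempty)
    (h1 : ∀ᶠ N : ℕ in atTop,
      |(∑ m ∈ U N, ((numSummands Z m : ℝ) - C₁ * N)) / (U N).card| ≤ M₁)
    (h2 : ∀ᶠ N : ℕ in atTop,
      |(∑ m ∈ U N, ((numSummands Z m : ℝ) - C₁ * N) ^ 2) / (U N).card - C₂ * N| ≤ M₂)
    (h3 : ∀ (θ : ℕ → ℝ) (t : ℝ), Tendsto (fun N : ℕ => θ N * √N) atTop (𝓝 t) →
      Tendsto (fun N : ℕ => charAvg Z (U N) (C₁ * N) (θ N)) atTop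
        (𝓝 (Real.exp (-(C₂ * t ^ 2 / 2)) : ℂ))) :
    GaussianSummands Z U C₁ C₂ := by
  set δ : ℕ → ℝ := fun N => (∑ m ∈ U N, ((numSummands Z m : ℝ) - C₁ * N)) / (U N).card with hδ
  have hmean : ∀ᶠ N : ℕ in atTop, meanSummands Z (U N) = C₁ * N + δ N := by
    filter_upwards [hne] with N hN
    have hc : ((U N).card : ℝ) ≠ 0 := by exact_mod_cast hN.card_pos.ne'
    simp only [hδ, meanSummands]
    rw [Finset.sum_sub_distrib, Finset.sum_const, nsmul_eq_mul]
    field_simp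
    ring
  have hvar : ∀ᶠ N : ℕ in atTop, varSummands Z (U N) =
      (∑ m ∈ U N, ((numSummands Z m : ℝ) - C₁ * N) ^ 2) / (U N).card - δ N ^ 2 := by
    filter_upwards [hne, hmean] with N hN hm
    have hc : ((U N).card : ℝ) ≠ 0 := by exact_mod_cast hN.card_pos.ne'
    have e1 : ∀ m ∈ U N, ((numSummands Z m : ℝ) - meanSummands Z (U N)) ^ 2 =
        ((numSummands Z m : ℝ) - C₁ * N) ^ 2 - 2 * δ N * ((numSummands Z m : ℝ) - C₁ * N) +
          δ N ^ 2 := fun m _ => by rw [hm]; ring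
    have e2 : ∑ m ∈ U N, ((numSummands Z m : ℝ) - C₁ * N) = δ N * (U N).card := by
      simp only [hδ]; rw [div_mul_cancel₀ _ hc]
    rw [varSummands, Finset.sum_congr rfl e1, Finset.sum_add_distrib, Finset.sum_sub_distrib,
      ← Finset.mul_sum, e2, Finset.sum_const, nsmul_eq_mul]
    field_simp
    ring
  have hvarO : ∀ᶠ N : ℕ in atTop, |varSummands Z (U N) - C₂ * N| ≤ M₂ + M₁ ^ 2 := by
    filter_upwards [h1, h2, hvar] with N e1 e2 e3
    have e4 : |δ N| ^ 2 ≤ M₁ ^ 2 := pow_le_pow_left₀ (abs_nonneg _) e1 2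
    rw [sq_abs] at e4
    rw [e3]
    rw [abs_le] at e2 ⊢
    constructor <;> linarith [sq_nonneg (δ N), e2.1, e2.2]
  refine ⟨?_, ?_, ?_⟩
  · refine IsBigO.of_bound M₁ ?_
    filter_upwards [h1, hmean] with N e1 e2
    rw [e2, add_sub_cancel_left, norm_one, mul_one]
    exact e1
  · refine IsBigO.of_bound (M₂ + M₁ ^ 2) ?_
    filter_upwards [hvarO] with N e1
    rw [norm_one, mul_one]
    exact e1
  · have hratio : Tendsto (fun N : ℕ => varSummands Z (U N) / N) atTop (𝓝 C₂) := by
      rw [tendsto_iff_norm_sub_tendsto_zero]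
      have hz : Tendsto (fun N : ℕ => (M₂ + M₁ ^ 2) / (N : ℝ)) atTop (𝓝 0) :=
        tendsto_const_nhds.div_atTop tendsto_natCast_atTop_atTop
      refine squeeze_zero' (Eventually.of_forall fun N => norm_nonneg _) ?_ hz
      filter_upwards [hvarO, eventually_gt_atTop 0] with N e1 e2
      have hN : (0 : ℝ) < N := by exact_mod_cast e2
      have e3 : varSummands Z (U N) / N - C₂ = (varSummands Z (U N) - C₂ * N) / N := by
        field_simp
      rw [e3, norm_div, Real.norm_eq_abs, Real.norm_eq_abs, abs_of_pos hN]
      gcongr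
    have hsq : Tendsto (fun N : ℕ => √(varSummands Z (U N) / N)) atTop (𝓝 (√C₂)) :=
      (Real.continuous_sqrt.tendsto _).comp hratio
    have hs0 : √C₂ ≠ 0 := (Real.sqrt_pos.2 hC₂).ne'
    have hchar : ∀ t : ℝ, Tendsto (fun N => (∑ m ∈ U N, Complex.exp
        ((t * (((numSummands Z m : ℝ) - meanSummands Z (U N)) / √(varSummands Z (U N))) : ℝ) *
          Complex.I)) / ((U N).card : ℂ)) atTop (𝓝 (Real.exp (-(t ^ 2 / 2)) : ℂ)) := by
      intro t
      set θ : ℕ → ℝ := fun N => t / √(varSummands Z (U N)) with hθ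
      have hθt : Tendsto (fun N : ℕ => θ N * √N) atTop (𝓝 (t / √C₂)) := by
        refine ((tendsto_const_nhds (x := t)).div hsq hs0).congr' ?_
        filter_upwards [eventually_gt_atTop 0] with N e2
        have hN : 0 < √(N : ℝ) := Real.sqrt_pos.2 (by exact_mod_cast e2)
        simp only [hθ, Pi.div_apply]
        rw [Real.sqrt_div' _ (Nat.cast_nonneg _), div_div_eq_mul_div]
        ring
      have hθ0 := tendsto_zero_of_mul_sqrt (n := fun N => N) tendsto_id hθt
      have hθδ : Tendsto (fun N => θ N * δ N) atTop (𝓝 0) := by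
        have hb := hθ0.abs.mul_const M₁
        rw [abs_zero, zero_mul] at hb
        refine squeeze_zero_norm' ?_ hb
        filter_upwards [h1] with N e1
        rw [norm_mul, Real.norm_eq_abs, Real.norm_eq_abs]
        exact mul_le_mul_of_nonneg_left e1 (abs_nonneg _)
      have hexp : Tendsto (fun N => Complex.exp (-((θ N * δ N : ℝ) : ℂ) * Complex.I)) atTop
          (𝓝 1) := by
        have hc : Continuous fun x : ℝ => Complex.exp (-(x : ℂ) * Complex.I) := by fun_prop
        have := (hc.tendsto 0).comp hθδ
        simpa [Function.comp_def] using this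
      have hlim := hexp.mul (h3 θ _ hθt)
      rw [one_mul, div_pow, Real.sq_sqrt hC₂.le, mul_div_cancel₀ _ hC₂.ne'] at hlim
      refine hlim.congr' ?_
      filter_upwards [hmean] with N hm
      rw [charAvg, ← mul_div_assoc, Finset.mul_sum]
      congr 1
      refine Finset.sum_congr rfl fun m _ => ?_
      rw [← Complex.exp_add, hm]
      congr 1
      simp only [hθ]
      push_cast
      ring
    obtain ⟨n₀, hn₀⟩ := eventually_atTop.1 hne
    intro x
    rw [← tendsto_add_atTop_iff_nat n₀]
    have := tendsto_cdf_of_tendsto_char (U := fun N => U (N + n₀))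
      (fun N => hn₀ _ (Nat.le_add_left _ _))
      (fun N m => ((numSummands Z m : ℝ) - meanSummands Z (U (N + n₀))) /
        √(varSummands Z (U (N + n₀))))
      (fun t => (hchar t).comp (tendsto_add_atTop_nat n₀)) x
    refine this.congr fun N => ?_
    rw [normalizedCDF]

/-! ### Initial intervals and windows -/

variable {Z : ℕ → ℕ} {a lam r C q : ℝ} {d : ℕ → ℕ} {R : ℕ → ℝ}

theorem ExpGrowth.exists_inv_massRatio_le (hZ : ExpGrowth Z a lam r C) :
    ∃ M, 0 ≤ M ∧ ∀ n, (massRatio Z a lam n)⁻¹ ≤ M := by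
  obtain ⟨M, hM⟩ := (hZ.tendsto_massRatio.inv₀ one_ne_zero).bddAbove_range
  have hM' : ∀ n, (massRatio Z a lam n)⁻¹ ≤ M := fun n => hM ⟨n, rfl⟩
  exact ⟨M, (inv_nonneg.2 (hZ.massRatio_pos 0).le).trans (hM' 0), hM'⟩

/-- The average of `k(m) - c * n` over `m < Z n`. -/
noncomputable def avgDev (Z : ℕ → ℕ) (c : ℝ) (n : ℕ) : ℝ :=
  (∑ m ∈ Finset.range (Z n), ((numSummands Z m : ℝ) - c * n)) / Z n

/-- The average of `(k(m) - c * n) ^ 2` over `m < Z n`. -/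
noncomputable def avgSqDev (Z : ℕ → ℕ) (c : ℝ) (n : ℕ) : ℝ :=
  (∑ m ∈ Finset.range (Z n), ((numSummands Z m : ℝ) - c * n) ^ 2) / Z n

theorem ExpGrowth.div_massRatio (hZ : ExpGrowth Z a lam r C) (x : ℝ) (n : ℕ) :
    x / (a * lam ^ n) / massRatio Z a lam n = x / Z n := by
  have ha := hZ.a_pos
  have hl := hZ.one_lt
  rw [massRatio, div_div_div_cancel_right₀ (by positivity)]

theorem ExpGrowth.exists_avgDev_bound (hZ : ExpGrowth Z a lam r C)
    (hd : QuasiGreedy lam⁻¹ d R) :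
    ∃ M, ∀ n, |avgDev Z (meanRate lam⁻¹ d) n| ≤ M := by
  obtain ⟨x₀, D, s, hs0, hs1, hD⟩ := hZ.exists_firstMoment_limit hd
  obtain ⟨M, hM, hM'⟩ := hZ.exists_inv_massRatio_le
  have hD0 : 0 ≤ D := by have := (abs_nonneg _).trans (hD 0); simpa using this
  refine ⟨(D + |x₀|) * M, fun n => ?_⟩
  have e : avgDev Z (meanRate lam⁻¹ d) n =
      firstMoment Z a lam (meanRate lam⁻¹ d) n * (massRatio Z a lam n)⁻¹ := by
    rw [← div_eq_mul_inv, firstMoment, greedyMean_real, hZ.div_massRatio]; rfl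
  rw [e, abs_mul, abs_of_pos (inv_pos.2 (hZ.massRatio_pos n))]
  have h1 : |firstMoment Z a lam (meanRate lam⁻¹ d) n| ≤ D + |x₀| := by
    have h2 := abs_add_le (firstMoment Z a lam (meanRate lam⁻¹ d) n - x₀) x₀
    rw [sub_add_cancel] at h2
    have h3 : D * s ^ n ≤ D := mul_le_of_le_one_right hD0 (pow_le_one₀ hs0.le hs1.le)
    linarith [hD n]
  exact mul_le_mul h1 (hM' n) (inv_nonneg.2 (hZ.massRatio_pos n).le) (by positivity)

theorem ExpGrowth.exists_avgSqDev_bound (hZ : ExpGrowth Z a lam r C)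
    (hd : QuasiGreedy lam⁻¹ d R) :
    ∃ M, ∀ n : ℕ, |avgSqDev Z (meanRate lam⁻¹ d) n - varRate lam⁻¹ d * n| ≤ M := by
  have hl := hZ.one_lt
  obtain ⟨M₂, hM₂⟩ := hZ.exists_secondMoment_bound hd
  obtain ⟨M, hM, hM'⟩ := hZ.exists_inv_massRatio_le
  obtain ⟨q, hq, hq1⟩ := exists_between ((div_lt_one (by linarith)).2 hZ.r_lt)
  have hq0 : 0 < q := hd.b_pos.trans (inv_lt_of_expGrowth hZ hq)
  obtain ⟨K, hK⟩ := hZ.exists_massRatio_sub_le hq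
  obtain ⟨K', hK'⟩ := exists_pow_mul_pow_le hq0 hq1 1
  have hK0 : 0 ≤ K := by have := (abs_nonneg _).trans (hK 0); simpa using this
  have hv := hd.varRate_pos
  have hM₂0 : 0 ≤ M₂ := (abs_nonneg _).trans (hM₂ 0)
  refine ⟨(M₂ + varRate lam⁻¹ d * (K * K')) * M, fun n => ?_⟩
  have hm := hZ.massRatio_pos n
  have e : avgSqDev Z (meanRate lam⁻¹ d) n - varRate lam⁻¹ d * n =
      ((secondMoment Z a lam (meanRate lam⁻¹ d) n - varRate lam⁻¹ d * n) -
        varRate lam⁻¹ d * (n * (massRatio Z a lam n - 1))) * (massRatio Z a lam n)⁻¹ := by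
    have e1 : avgSqDev Z (meanRate lam⁻¹ d) n =
        secondMoment Z a lam (meanRate lam⁻¹ d) n / massRatio Z a lam n := by
      rw [secondMoment, greedyMean_real, hZ.div_massRatio]; rfl
    rw [e1]; field_simp; ring
  rw [e, abs_mul, abs_of_pos (inv_pos.2 hm)]
  have h1 : |varRate lam⁻¹ d * (n * (massRatio Z a lam n - 1))| ≤
      varRate lam⁻¹ d * (K * K') := by
    rw [abs_mul, abs_mul, abs_of_pos hv, abs_of_nonneg (Nat.cast_nonneg (α := ℝ) n)]
    refine mul_le_mul_of_nonneg_left ?_ hv.le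
    have h2 := hK' n
    rw [pow_one, one_pow, mul_one] at h2
    calc (n : ℝ) * |massRatio Z a lam n - 1| ≤ ((n : ℝ) + 1) * (K * q ^ n) := by
          gcongr
          · linarith
          · exact hK n
      _ = K * (((n : ℝ) + 1) * q ^ n) := by ring
      _ ≤ K * K' := by gcongr
  have h3 := (abs_sub _ _).trans (add_le_add (hM₂ n) h1)
  exact mul_le_mul h3 (hM' n) (inv_nonneg.2 hm.le) ((abs_nonneg _).trans h3)

theorem ExpGrowth.gaussianSummands_initial (hZ : ExpGrowth Z a lam r C)
    (hd : QuasiGreedy lam⁻¹ d R) :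
    GaussianSummands Z (fun N => Finset.Ico 0 (Z N)) (meanRate lam⁻¹ d) (varRate lam⁻¹ d) := by
  obtain ⟨M₁, hM₁⟩ := hZ.exists_avgDev_bound hd
  obtain ⟨M₂, hM₂⟩ := hZ.exists_avgSqDev_bound hd
  simp only [← Finset.range_eq_Ico]
  refine gaussianSummands_of (M₁ := M₁) (M₂ := M₂) hd.varRate_pos
    (Eventually.of_forall fun N => Finset.nonempty_range_iff.2 (hZ.pos N).ne')
    (Eventually.of_forall fun N => ?_) (Eventually.of_forall fun N => ?_) fun θ t h => ?_
  · rw [Finset.card_range]; exact hM₁ N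
  · rw [Finset.card_range]; exact hM₂ N
  · exact hZ.tendsto_charAvg hd (n := fun N => N) tendsto_id h

theorem ExpGrowth.tendsto_ratio (hZ : ExpGrowth Z a lam r C) :
    Tendsto (fun n => (Z (n + 1) : ℝ) / Z n) atTop (𝓝 lam) := by
  have ha := hZ.a_pos
  have hl := hZ.one_lt
  have h1 := ((hZ.tendsto_massRatio.comp (tendsto_add_atTop_nat 1)).div hZ.tendsto_massRatio
    one_ne_zero).mul_const lam
  rw [div_one, one_mul] at h1
  refine h1.congr fun n => ?_
  have := hZ.pos n
  simp only [Pi.div_apply, Function.comp, massRatio, pow_succ]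
  field_simp

theorem ExpGrowth.eventually_lt (hZ : ExpGrowth Z a lam r C) :
    ∀ᶠ n in atTop, Z n < Z (n + 1) := by
  filter_upwards [hZ.tendsto_ratio.eventually (lt_mem_nhds hZ.one_lt)] with n hn
  rw [one_lt_div (by exact_mod_cast hZ.pos n)] at hn
  exact_mod_cast hn

theorem ExpGrowth.tendsto_weight (hZ : ExpGrowth Z a lam r C) :
    Tendsto (fun n => (Z (n + 1) : ℝ) / (Z (n + 1) - Z n)) atTop (𝓝 (lam / (lam - 1))) := by
  have hl := hZ.one_lt
  have h1 := hZ.tendsto_ratio.div (hZ.tendsto_ratio.sub_const 1) (by linarith)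
  refine h1.congr fun n => ?_
  have : (0 : ℝ) < Z n := by exact_mod_cast hZ.pos n
  simp only [Pi.div_apply]
  rw [div_sub_one this.ne', div_div_div_cancel_right₀ this.ne']

/-- A window average is an affine combination of the averages over two initial intervals. The
weights sum to 1 and, under exponential growth, stay bounded, so limits and O(1) bounds pass over.
-/
theorem sum_Ico_div {F : Type*} [Field F] [CharZero F] {Z : ℕ → ℕ} {N : ℕ} (hpos : 0 < Z N)
    (hN : Z N < Z (N + 1)) (f : ℕ → F) :
    (∑ m ∈ Finset.Ico (Z N) (Z (N + 1)), f m) / ((Finset.Ico (Z N) (Z (N + 1))).card : F) =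
      (Z (N + 1) : F) / (Z (N + 1) - Z N) *
        ((∑ m ∈ Finset.range (Z (N + 1)), f m) / Z (N + 1)) -
      ((Z (N + 1) : F) / (Z (N + 1) - Z N) - 1) * ((∑ m ∈ Finset.range (Z N), f m) / Z N) := by
  have h1 : (Z (N + 1) : F) ≠ 0 := by exact_mod_cast (hpos.trans hN).ne'
  have h2 : (Z N : F) ≠ 0 := by exact_mod_cast hpos.ne'
  have h3 : (Z (N + 1) : F) - Z N ≠ 0 := by
    rw [sub_ne_zero]; exact_mod_cast hN.ne'
  rw [Finset.sum_Ico_eq_sub _ hN.le, Nat.card_Ico, Nat.cast_sub hN.le]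
  field_simp
  ring

theorem ExpGrowth.gaussianSummands_window (hZ : ExpGrowth Z a lam r C)
    (hd : QuasiGreedy lam⁻¹ d R) :
    GaussianSummands Z (fun N => Finset.Ico (Z N) (Z (N + 1))) (meanRate lam⁻¹ d)
      (varRate lam⁻¹ d) := by
  have hl := hZ.one_lt
  obtain ⟨M₁, hM₁⟩ := hZ.exists_avgDev_bound hd
  obtain ⟨M₂, hM₂⟩ := hZ.exists_avgSqDev_bound hd
  have hchar := fun θ t n => hZ.tendsto_charAvg hd (θ := θ) (n := n) (t := t)
  set c := meanRate lam⁻¹ d with hc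
  set c₂ := varRate lam⁻¹ d with hc₂
  have hc0 : 0 < c := hd.meanRate_pos
  have hc₂0 : 0 < c₂ := hd.varRate_pos
  set ρ : ℕ → ℝ := fun n => (Z (n + 1) : ℝ) / (Z (n + 1) - Z n) with hρ
  have hρlim := hZ.tendsto_weight
  obtain ⟨P, hP⟩ := hρlim.abs.bddAbove_range
  have hP' : ∀ n, |ρ n| ≤ P := fun n => hP ⟨n, rfl⟩
  have hP1 : ∀ n, |ρ n - 1| ≤ P + 1 := fun n =>
    (abs_sub _ _).trans (by rw [abs_one]; linarith [hP' n])
  have hP0 : 0 ≤ P := (abs_nonneg _).trans (hP' 0)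
  have hM₁0 : 0 ≤ M₁ := (abs_nonneg _).trans (hM₁ 0)
  have hM₂0 : 0 ≤ M₂ := (abs_nonneg _).trans (hM₂ 0)
  refine gaussianSummands_of (M₁ := P * (M₁ + c) + (P + 1) * M₁)
    (M₂ := P * (M₂ + (c₂ + (2 * c * M₁ + c ^ 2))) + (P + 1) * M₂) hc₂0
    (hZ.eventually_lt.mono fun N hN => Finset.nonempty_Ico.2 hN) ?_ ?_ fun θ t h => ?_
  · filter_upwards [hZ.eventually_lt] with N hN
    rw [sum_Ico_div (hZ.pos N) hN]
    have hZ1 : (Z (N + 1) : ℝ) ≠ 0 := by exact_mod_cast (hZ.pos (N + 1)).ne'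
    have e1 : (∑ m ∈ Finset.range (Z (N + 1)), ((numSummands Z m : ℝ) - c * N)) / Z (N + 1) =
        avgDev Z c (N + 1) + c := by
      rw [avgDev]
      simp only [Finset.sum_sub_distrib, Finset.sum_const, Finset.card_range, nsmul_eq_mul]
      push_cast
      field_simp
      ring
    rw [e1]
    refine (abs_sub _ _).trans ?_
    rw [abs_mul, abs_mul]
    have h1 : |avgDev Z c (N + 1) + c| ≤ M₁ + c :=
      (abs_add_le _ _).trans (by rw [abs_of_pos hc0]; linarith [hM₁ (N + 1)])
    exact add_le_add (mul_le_mul (hP' N) h1 (abs_nonneg _) hP0)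
      (mul_le_mul (hP1 N) (hM₁ N) (abs_nonneg _) (by linarith))
  · filter_upwards [hZ.eventually_lt] with N hN
    rw [sum_Ico_div (hZ.pos N) hN]
    have hZ1 : (Z (N + 1) : ℝ) ≠ 0 := by exact_mod_cast (hZ.pos (N + 1)).ne'
    have e1 : (∑ m ∈ Finset.range (Z (N + 1)), ((numSummands Z m : ℝ) - c * N) ^ 2) / Z (N + 1) =
        avgSqDev Z c (N + 1) + (2 * c * avgDev Z c (N + 1) + c ^ 2) := by
      have e2 : ∀ m ∈ Finset.range (Z (N + 1)), ((numSummands Z m : ℝ) - c * N) ^ 2 =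
          ((numSummands Z m : ℝ) - c * (N + 1 : ℕ)) ^ 2 +
            2 * c * ((numSummands Z m : ℝ) - c * (N + 1 : ℕ)) + c ^ 2 := fun m _ => by
        push_cast; ring
      rw [Finset.sum_congr rfl e2, avgDev, avgSqDev, Finset.sum_add_distrib,
        Finset.sum_add_distrib, ← Finset.mul_sum, Finset.sum_const, Finset.card_range,
        nsmul_eq_mul]
      field_simp
      ring
    rw [e1]
    have e3 : (Z (N + 1) : ℝ) / (Z (N + 1) - Z N) *
          (avgSqDev Z c (N + 1) + (2 * c * avgDev Z c (N + 1) + c ^ 2)) -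
        ((Z (N + 1) : ℝ) / (Z (N + 1) - Z N) - 1) *
          ((∑ m ∈ Finset.range (Z N), ((numSummands Z m : ℝ) - c * N) ^ 2) / Z N) - c₂ * N =
        ρ N * ((avgSqDev Z c (N + 1) - c₂ * (N + 1 : ℕ)) +
          (c₂ + (2 * c * avgDev Z c (N + 1) + c ^ 2))) -
        (ρ N - 1) * (avgSqDev Z c N - c₂ * N) := by
      simp only [hρ, avgSqDev]; push_cast; ring
    rw [e3]
    refine (abs_sub _ _).trans ?_
    rw [abs_mul, abs_mul]
    have h1 : |(avgSqDev Z c (N + 1) - c₂ * (N + 1 : ℕ)) +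
          (c₂ + (2 * c * avgDev Z c (N + 1) + c ^ 2))| ≤
        M₂ + (c₂ + (2 * c * M₁ + c ^ 2)) := by
      refine (abs_add_le _ _).trans (add_le_add (hM₂ _) ((abs_add_le _ _).trans
        (add_le_add (abs_of_pos hc₂0).le ((abs_add_le _ _).trans (add_le_add ?_ ?_)))))
      · rw [abs_mul, abs_of_pos (show 0 < 2 * c by linarith)]
        exact mul_le_mul_of_nonneg_left (hM₁ _) (by linarith)
      · rw [abs_of_nonneg (sq_nonneg c)]
    exact add_le_add (mul_le_mul (hP' N) h1 (abs_nonneg _) hP0)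
      (mul_le_mul (hP1 N) (hM₂ N) (abs_nonneg _) (by linarith))
  · have hθ0 := tendsto_zero_of_mul_sqrt (n := fun N => N) tendsto_id h
    have h0 := hchar θ t (fun N => N) tendsto_id h
    -- The longer interval lives at index N + 1. Since √(N+1) - √N ≤ 1 and θ → 0, the scaling is
    -- unaffected; the shift of centre by c is the phase treated in `hexp`.
    have hs : Tendsto (fun N : ℕ => θ N * √((N + 1 : ℕ) : ℝ)) atTop (𝓝 t) := by
      have h1 : Tendsto (fun N : ℕ => θ N * √((N + 1 : ℕ) : ℝ) - θ N * √(N : ℝ)) atTop (𝓝 0) := by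
        have h2 := hθ0.abs
        rw [abs_zero] at h2
        refine squeeze_zero_norm (fun N => ?_) h2
        rw [← mul_sub, norm_mul, Real.norm_eq_abs, Real.norm_eq_abs]
        refine mul_le_of_le_one_right (abs_nonneg _) ?_
        have h3 : √(N : ℝ) ≤ √((N + 1 : ℕ) : ℝ) := Real.sqrt_le_sqrt (by push_cast; linarith)
        have h4 : √((N + 1 : ℕ) : ℝ) ≤ √(N : ℝ) + 1 := by
          rw [Real.sqrt_le_left (by positivity)]
          have := Real.sq_sqrt (Nat.cast_nonneg (α := ℝ) N)
          push_cast
          nlinarith [Real.sqrt_nonneg (N : ℝ)]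
        rw [abs_of_nonneg (by linarith)]; linarith
      have h2 := h1.add h
      rw [zero_add] at h2
      exact h2.congr fun N => by ring
    have h1 := hchar θ t (fun N => N + 1) (tendsto_add_atTop_nat 1) hs
    have hexp : Tendsto (fun N => Complex.exp (((θ N * c : ℝ) : ℂ) * Complex.I)) atTop (𝓝 1) := by
      have hcont : Continuous fun x : ℝ => Complex.exp (((x * c : ℝ) : ℂ) * Complex.I) := by
        fun_prop
      have := (hcont.tendsto 0).comp hθ0
      simpa [Function.comp_def] using this
    have hρc : Tendsto (fun N => ((ρ N : ℝ) : ℂ)) atTop (𝓝 ((lam / (lam - 1) : ℝ) : ℂ)) :=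
      (Complex.continuous_ofReal.tendsto _).comp hρlim
    have hlim := (hρc.mul (hexp.mul h1)).sub ((hρc.sub_const 1).mul h0)
    rw [one_mul, ← sub_mul, sub_sub_cancel, one_mul] at hlim
    refine hlim.congr' ?_
    filter_upwards [hZ.eventually_lt] with N hN
    rw [charAvg, charAvg, charAvg, sum_Ico_div (hZ.pos N) hN, Finset.card_range,
      Finset.card_range, ← mul_div_assoc (Complex.exp _), Finset.mul_sum]
    have e1 : ((ρ N : ℝ) : ℂ) = (Z (N + 1) : ℂ) / (Z (N + 1) - Z N) := by
      simp only [hρ]; push_cast; rfl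
    rw [e1]
    congr 3
    refine Finset.sum_congr rfl fun m _ => ?_
    rw [← Complex.exp_add]
    congr 1
    push_cast; ring

/-! ### Counting gaps by a renewal equation -/

/-- The linear profile (κ/μ)N has asymptotic forcing κ. After subtracting it the forcing tends to 0,
and the accumulated forcing is o(N) by Cesàro averaging. -/
theorem QuasiGreedy.tendsto_div_of_renewal {b : ℝ} {d : ℕ → ℕ} {R : ℕ → ℝ}
    (h : QuasiGreedy b d R) {x : ℕ → ℝ} {κ : ℝ}
    (hx : Tendsto (fun N => x N - ∑ i ∈ Finset.range (cnt d N), b ^ d i * x (N - d i)) atTop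
      (𝓝 κ)) :
    Tendsto (fun N => x N / N) atTop (𝓝 (κ / stepMean b d)) := by
  have hb0 := h.b_pos
  have hμ := h.stepMean_pos
  set μ := stepMean b d with hμdef
  obtain ⟨q, hq, hq1⟩ := exists_between h.b_lt
  have hq0 : 0 < q := hb0.trans hq
  have hqlim := tendsto_pow_atTop_nhds_zero_of_lt_one hq0.le hq1
  obtain ⟨M, hM⟩ := h.exists_abs_sum_sub_le (f := fun i => (d i : ℝ)) (k := 1) (A := 1)
    (y := fun _ => 1) (y₀ := 1) (D := 0) hq hq1.le (by simp) (by simp)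
  simp only [mul_one, one_mul] at hM
  change ∀ N, |_ - μ| ≤ _ at hM
  have h1 : Tendsto (fun N => ∑ i ∈ Finset.range (cnt d N), b ^ d i * (d i : ℝ)) atTop (𝓝 μ) := by
    rw [tendsto_iff_norm_sub_tendsto_zero]
    have := hqlim.const_mul M
    rw [mul_zero] at this
    exact squeeze_zero (fun n => norm_nonneg _) hM this
  have h2 : Tendsto (fun N : ℕ => (N : ℝ) * R (cnt d N)) atTop (𝓝 0) :=
    squeeze_zero (fun N => mul_nonneg (Nat.cast_nonneg _) (h.pos _).le)
      (fun N => mul_le_mul_of_nonneg_left (h.remainder_cnt_le N) (Nat.cast_nonneg _))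
      (tendsto_self_mul_const_pow_of_lt_one hb0.le h.b_lt)
  set y : ℕ → ℝ := fun N => x N - κ / μ * N with hy
  set e : ℕ → ℝ := fun N =>
    |y N - ∑ i ∈ Finset.range (cnt d N), b ^ d i * y (N - d i)| with he
  have he0 : Tendsto e atTop (𝓝 0) := by
    have h3 := (hx.sub ((h2.add h1).const_mul (κ / μ))).abs
    rw [zero_add, div_mul_cancel₀ _ hμ.ne', sub_self, abs_zero] at h3
    refine h3.congr fun N => ?_
    simp only [he]
    congr 1
    have e1 : ∑ i ∈ Finset.range (cnt d N), b ^ d i * y (N - d i) =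
        ∑ i ∈ Finset.range (cnt d N), b ^ d i * x (N - d i) -
          κ / μ * (N * (1 - R (cnt d N)) -
            ∑ i ∈ Finset.range (cnt d N), b ^ d i * (d i : ℝ)) := by
      rw [← h.sum_range, Finset.mul_sum, ← Finset.sum_sub_distrib, Finset.mul_sum,
        ← Finset.sum_sub_distrib]
      refine Finset.sum_congr rfl fun i hi => ?_
      simp only [hy]
      rw [Nat.cast_sub (h.lt_cnt_iff.1 (Finset.mem_range.1 hi))]
      ring
    rw [e1]
    simp only [hy]
    ring
  have hbound : ∀ N, |y N| ≤ ∑ k ∈ Finset.range (N + 1), e k := by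
    refine h.le_sum_of_renewal (x := fun n => |y n|) (fun n => abs_nonneg _) fun N => ?_
    have h3 := abs_sub_abs_le_abs_sub (y N) (∑ i ∈ Finset.range (cnt d N), b ^ d i * y (N - d i))
    have h4 : |∑ i ∈ Finset.range (cnt d N), b ^ d i * y (N - d i)| ≤
        ∑ i ∈ Finset.range (cnt d N), b ^ d i * |y (N - d i)| := by
      refine (Finset.abs_sum_le_sum_abs _ _).trans_eq (Finset.sum_congr rfl fun i _ => ?_)
      rw [abs_mul, abs_of_pos (pow_pos hb0 _)]
    simp only [he]
    linarith
  have hces := (he0.cesaro.comp (tendsto_add_atTop_nat 1)).const_mul 2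
  rw [mul_zero] at hces
  have hy0 : Tendsto (fun N : ℕ => y N / N) atTop (𝓝 0) := by
    refine squeeze_zero_norm' ?_ hces
    filter_upwards [eventually_ge_atTop 1] with N hN
    have hN' : (1 : ℝ) ≤ N := by exact_mod_cast hN
    rw [norm_div, Real.norm_eq_abs, Real.norm_eq_abs, abs_of_nonneg (by linarith : (0 : ℝ) ≤ N)]
    have hs : 0 ≤ ∑ k ∈ Finset.range (N + 1), e k := Finset.sum_nonneg fun k _ => abs_nonneg _
    have h5 : (N : ℝ)⁻¹ ≤ 2 * ((N + 1 : ℕ) : ℝ)⁻¹ := by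
      push_cast
      rw [← div_eq_mul_inv, inv_eq_one_div, div_le_div_iff₀ (by linarith) (by linarith)]
      linarith
    simp only [Function.comp]
    calc |y N| / N ≤ (∑ k ∈ Finset.range (N + 1), e k) / N := by gcongr; exact hbound N
      _ = (N : ℝ)⁻¹ * ∑ k ∈ Finset.range (N + 1), e k := by rw [div_eq_inv_mul]
      _ ≤ (2 * ((N + 1 : ℕ) : ℝ)⁻¹) * ∑ k ∈ Finset.range (N + 1), e k := by gcongr
      _ = _ := by ring
  have h6 := hy0.add_const (κ / μ)
  rw [zero_add] at h6
  refine h6.congr' ?_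
  filter_upwards [eventually_ge_atTop 1] with N hN
  have hN' : (N : ℝ) ≠ 0 := by positivity
  simp only [hy]
  field_simp
  ring

theorem gaps_append (l₁ : List ℕ) (a : ℕ) (l₂ : List ℕ) :
    gaps (l₁ ++ a :: l₂) = gaps (l₁ ++ [a]) ++ gaps (a :: l₂) := by
  induction l₁ with
  | nil => simp [gaps]
  | cons x l₁ ih =>
    cases l₁ with
    | nil => simp [gaps]
    | cons y l₁ => simpa [gaps] using ih

theorem length_gaps (l : List ℕ) : (gaps l).length = l.length - 1 := by
  simp [gaps]

/-- Indicator that the `l`-th gap of the quasi-greedy expansion equals `g` (there is no `0`-th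
gap). -/
def gapInd (d : ℕ → ℕ) (g : ℕ) : ℕ → ℝ
  | 0 => 0
  | l + 1 => if d (l + 1) - d l = g then 1 else 0

/-- Indicator that the gap between the last entry of `expPrefix d N i` and the head of a list equals
`g`. -/
def joinInd (d : ℕ → ℕ) (g N : ℕ) : ℕ → List ℕ → ℝ
  | k + 1, h :: _ => if N - d k - h = g then 1 else 0
  | _, _ => 0

theorem gapInd_nonneg (d : ℕ → ℕ) (g l : ℕ) : 0 ≤ gapInd d g l := by
  cases l with
  | zero => simp [gapInd]
  | succ l => simp only [gapInd]; split_ifs <;> simp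

theorem gapInd_le_one (d : ℕ → ℕ) (g l : ℕ) : gapInd d g l ≤ 1 := by
  cases l with
  | zero => simp [gapInd]
  | succ l => simp only [gapInd]; split_ifs <;> simp

theorem joinInd_nonneg (d : ℕ → ℕ) (g N i : ℕ) (l : List ℕ) : 0 ≤ joinInd d g N i l := by
  cases i <;> cases l <;> simp only [joinInd, le_refl]
  split_ifs <;> simp

theorem joinInd_le_one (d : ℕ → ℕ) (g N i : ℕ) (l : List ℕ) : joinInd d g N i l ≤ 1 := by
  cases i <;> cases l <;> simp only [joinInd, zero_le_one]
  split_ifs <;> simp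

theorem count_gaps_expPrefix (d : ℕ → ℕ) (g N i : ℕ) (hi : ∀ l < i, d l ≤ N) :
    ((gaps (expPrefix d N i)).count g : ℝ) = ∑ l ∈ Finset.range i, gapInd d g l := by
  induction i with
  | zero => simp [expPrefix, gaps]
  | succ i ih =>
    rw [Finset.sum_range_succ, ← ih fun l hl => hi l (by omega)]
    cases i with
    | zero => simp [expPrefix, gaps, gapInd]
    | succ i =>
      rw [expPrefix_succ d N (i + 1), expPrefix_succ d N i, List.append_assoc, List.singleton_append,
        gaps_append, List.count_append]
      push_cast
      congr 1
      have h1 := hi i (by omega)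
      have h2 := hi (i + 1) (by omega)
      have h3 : N - d i - (N - d (i + 1)) = d (i + 1) - d i := by omega
      simp [gaps, gapInd, h3, List.count_singleton]

theorem count_gaps_append (d : ℕ → ℕ) (g N i : ℕ) (hi : ∀ l < i, d l ≤ N) (l : List ℕ) :
    ((gaps (expPrefix d N i ++ l)).count g : ℝ) =
      (gaps l).count g + (∑ l ∈ Finset.range i, gapInd d g l + joinInd d g N i l) := by
  rw [← count_gaps_expPrefix d g N i hi]
  cases i with
  | zero => simp [expPrefix, gaps, joinInd]
  | succ i =>
    cases l with
    | nil => simp [joinInd, gaps]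
    | cons h l =>
      rw [expPrefix_succ, List.append_assoc, List.singleton_append, gaps_append]
      have : gaps ((N - d i) :: h :: l) = (N - d i - h) :: gaps (h :: l) := by simp [gaps]
      rw [this, List.count_append, List.count_cons]
      simp only [joinInd, beq_iff_eq]
      push_cast
      ring

/-- The limiting contribution of the gaps between consecutive blocks. -/
noncomputable def joinLim (lam : ℝ) (d : ℕ → ℕ) (g : ℕ) : ℕ → ℝ
  | 0 => 0
  | k + 1 => if d (k + 1) - d k < g then (lam - 1) * lam⁻¹ ^ (d k + g) else 0

section Join

variable {Z : ℕ → ℕ} {a lam r C q : ℝ} {d : ℕ → ℕ} {R : ℕ → ℝ}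

/-- The joining gap is g exactly when the greedy head is t = N - d k - g, that is, when Z t ≤ m < Z
(t+1). This whole interval lies in the block if g > d (k+1) - d k; otherwise the block ends before
it. -/
theorem sum_joinInd (hmono : Monotone Z) (hpos : ∀ n, 0 < Z n)
    {g N k : ℕ} (hN1 : d k + g ≤ N) (hdk : d k ≤ d (k + 1)) (hN : d (k + 1) ≤ N) :
    ∑ m ∈ Finset.range (Z (N - d (k + 1))), joinInd d g N (k + 1) (greedy Z m) =
      if d (k + 1) - d k < g then (Z (N - (d k + g) + 1) : ℝ) - Z (N - (d k + g)) else 0 := by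
  set t := N - (d k + g) with ht
  have h1 : ∀ m ∈ Finset.range (Z (N - d (k + 1))), joinInd d g N (k + 1) (greedy Z m) =
      if Z t ≤ m ∧ m < Z (t + 1) then 1 else 0 := by
    intro m hm
    have hm' := Finset.mem_range.1 hm
    by_cases h0 : m < Z 0
    · rw [greedy_of_lt hmono h0, if_neg]
      · rfl
      · rintro ⟨h2, -⟩
        exact absurd (h0.trans_le (hmono (Nat.zero_le t))) (not_lt.2 h2)
    · obtain ⟨n, hn, h2, h3⟩ := exists_index (not_lt.1 h0) hm'
      rw [greedy_of_le hmono hpos h2 h3]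
      simp only [joinInd]
      by_cases hnt : n = t
      · subst hnt
        rw [if_pos (by omega), if_pos ⟨h2, h3⟩]
      · rw [if_neg (by omega), if_neg]
        rintro ⟨h4, h5⟩
        have h6 := topIndex_eq hmono h2 h3
        have h7 := topIndex_eq hmono h4 h5
        omega
  rw [Finset.sum_congr rfl h1, Finset.sum_boole]
  split_ifs with hg
  · have h2 : (Finset.range (Z (N - d (k + 1)))).filter (fun m => Z t ≤ m ∧ m < Z (t + 1)) =
        Finset.Ico (Z t) (Z (t + 1)) := by
      have h3 : Z (t + 1) ≤ Z (N - d (k + 1)) := hmono (by omega)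
      ext m
      simp only [Finset.mem_filter, Finset.mem_range, Finset.mem_Ico]
      constructor
      · exact fun h => h.2
      · exact fun h => ⟨h.2.trans_le h3, h⟩
    rw [h2, Nat.card_Ico, Nat.cast_sub (hmono (Nat.le_succ t))]
  · have h3 : Z (N - d (k + 1)) ≤ Z t := hmono (by omega)
    rw [Nat.cast_eq_zero, Finset.card_eq_zero, Finset.filter_eq_empty_iff]
    intro m hm h4
    have := Finset.mem_range.1 hm
    omega

theorem ExpGrowth.tendsto_join (hZ : ExpGrowth Z a lam r C) (hd : QuasiGreedy lam⁻¹ d R)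
    (g i : ℕ) :
    Tendsto (fun N => lam⁻¹ ^ d i * greedyMean Z a lam (joinInd d g N i) (N - d i)) atTop
      (𝓝 (joinLim lam d g i)) := by
  have ha := hZ.a_pos
  have hl := hZ.one_lt
  have hl0 : lam ≠ 0 := by positivity
  cases i with
  | zero =>
    have : ∀ N l, joinInd d g N 0 l = 0 := fun N l => by simp [joinInd]
    simp [greedyMean, greedySum, joinLim, this]
  | succ k =>
    by_cases hg : d (k + 1) - d k < g
    · rw [joinLim, if_pos hg]
      have h1 : Tendsto (fun N => N - (d k + g)) atTop atTop := tendsto_sub_atTop_nat _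
      have hσ := hZ.tendsto_massRatio.comp h1
      have hσ' := hZ.tendsto_massRatio.comp ((tendsto_add_atTop_nat 1).comp h1)
      have h2 := ((hσ'.const_mul lam).sub hσ).mul_const (lam⁻¹ ^ (d k + g))
      rw [mul_one] at h2
      refine h2.congr' ?_
      filter_upwards [eventually_ge_atTop (d k + g), eventually_ge_atTop (d (k + 1))] with N h3 h4
      rw [greedyMean_real, sum_joinInd hZ.mono hZ.pos h3 (hd.monotone (Nat.le_succ k)) h4,
        if_pos hg]
      simp only [Function.comp, massRatio]
      have e1 : lam ^ (N - (d k + g)) = lam ^ N * lam⁻¹ ^ (d k + g) := by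
        rw [inv_pow, pow_sub₀ _ hl0 h3]
      have e2 : lam ^ (N - d (k + 1)) = lam ^ N * lam⁻¹ ^ d (k + 1) := by
        rw [inv_pow, pow_sub₀ _ hl0 h4]
      rw [pow_succ, e1, e2]
      field_simp
    · rw [joinLim, if_neg hg]
      refine tendsto_const_nhds.congr' ?_
      filter_upwards [eventually_ge_atTop (d k + g), eventually_ge_atTop (d (k + 1))] with N h3 h4
      rw [greedyMean_real, sum_joinInd hZ.mono hZ.pos h3 (hd.monotone (Nat.le_succ k)) h4,
        if_neg hg]
      simp

theorem ExpGrowth.exists_massRatio_le (hZ : ExpGrowth Z a lam r C) :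
    ∃ M, 0 ≤ M ∧ ∀ n, massRatio Z a lam n ≤ M := by
  obtain ⟨M, hM⟩ := hZ.tendsto_massRatio.bddAbove_range
  have hM' : ∀ n, massRatio Z a lam n ≤ M := fun n => hM ⟨n, rfl⟩
  exact ⟨M, (hZ.massRatio_pos 0).le.trans (hM' 0), hM'⟩

/-- The normalized number of gaps of length `g` in the decompositions of all `m < Z n`. -/
noncomputable def gapMean (Z : ℕ → ℕ) (a lam : ℝ) (g n : ℕ) : ℝ :=
  greedyMean Z a lam (fun l => ((gaps l).count g : ℝ)) n

/-- The limiting mean number of gaps of length `g` per renewal step. -/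
noncomputable def gapRate (lam : ℝ) (d : ℕ → ℕ) (g : ℕ) : ℝ :=
  ∑' i, (lam⁻¹ ^ d i * ∑ l ∈ Finset.range i, gapInd d g l + joinLim lam d g i)

/-- The i-th block forces the gaps inside its prefix and the joining gap. Each contribution
converges, and there are at most i + 1 of these gaps per integer, so b^{d_i}(i+1) dominates up to a
constant. -/
theorem ExpGrowth.tendsto_gapMean_renewal (hZ : ExpGrowth Z a lam r C)
    (hd : QuasiGreedy lam⁻¹ d R) (g : ℕ) :
    Tendsto (fun N => gapMean Z a lam g N - ∑ i ∈ Finset.range (cnt d N),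
      lam⁻¹ ^ d i * gapMean Z a lam g (N - d i)) atTop (𝓝 (gapRate lam d g)) := by
  have hl := hZ.one_lt
  have ha := hZ.a_pos
  have hb0 := hd.b_pos
  obtain ⟨q, hq, hq1⟩ := exists_between ((div_lt_one (by linarith)).2 hZ.r_lt)
  have hq0 : 0 < q := hb0.trans (inv_lt_of_expGrowth hZ hq)
  obtain ⟨K, L, hK⟩ := hZ.exists_renewal_of_le (E := ℝ) hd hq 1
  obtain ⟨M, hM, hM'⟩ := hZ.exists_massRatio_le
  set T : ℕ → ℝ := fun i => ∑ l ∈ Finset.range i, gapInd d g l with hT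
  have hT0 : ∀ i, 0 ≤ T i := fun i => Finset.sum_nonneg fun l _ => gapInd_nonneg d g l
  have hTi : ∀ i, T i ≤ i := fun i =>
    (Finset.sum_le_card_nsmul _ _ 1 fun l _ => gapInd_le_one d g l).trans (by simp)
  set J : ℕ → ℕ → ℝ := fun N i => greedyMean Z a lam (joinInd d g N i) (N - d i) with hJ
  have hJ0 : ∀ N i, 0 ≤ J N i := fun N i => by
    simp only [hJ, greedyMean_real]
    have := Finset.sum_nonneg fun m (_ : m ∈ Finset.range (Z (N - d i))) =>
      joinInd_nonneg d g N i (greedy Z m)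
    positivity
  have hJ1 : ∀ N i, J N i ≤ massRatio Z a lam (N - d i) := fun N i => by
    simp only [hJ, greedyMean_real, massRatio]
    have := Finset.sum_le_card_nsmul (Finset.range (Z (N - d i)))
      (fun m => joinInd d g N i (greedy Z m)) 1 fun m _ => joinInd_le_one d g N i _
    rw [Finset.card_range, nsmul_eq_mul, mul_one] at this
    gcongr
  set F : ℕ → ℕ → ℝ := fun N i => if i < cnt d N then
    lam⁻¹ ^ d i * (T i * massRatio Z a lam (N - d i) + J N i) else 0 with hF
  have hFlim : Tendsto (fun N => ∑' i, F N i) atTop (𝓝 (gapRate lam d g)) := by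
    have hsum : Summable fun i => lam⁻¹ ^ d i * ((i : ℝ) + 1) * M := by
      have := (hd.summable_index.add hd.hasSum.summable).mul_right M
      refine this.congr fun i => ?_
      ring
    refine tendsto_tsum_of_dominated_convergence hsum (fun i => ?_)
      (Eventually.of_forall fun N i => ?_)
    · have h1 : Tendsto (fun N => N - d i) atTop atTop := tendsto_sub_atTop_nat _
      have h2 := (((hZ.tendsto_massRatio.comp h1).const_mul (T i)).const_mul (lam⁻¹ ^ d i)).add
        (hZ.tendsto_join hd g i)
      rw [mul_one] at h2
      refine h2.congr' ?_
      filter_upwards [eventually_ge_atTop (d i)] with N hN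
      simp only [hF]
      rw [if_pos (hd.lt_cnt_iff.2 hN)]
      simp only [Function.comp, hJ]
      ring
    · simp only [hF]
      split_ifs
      · have h3 := hM' (N - d i)
        have h4 := (hZ.massRatio_pos (N - d i)).le
        rw [Real.norm_eq_abs, abs_of_nonneg (mul_nonneg (pow_pos hb0 _).le
          (add_nonneg (mul_nonneg (hT0 i) h4) (hJ0 N i))), mul_assoc]
        gcongr
        have h5 : T i * massRatio Z a lam (N - d i) ≤ i * M :=
          mul_le_mul (hTi i) h3 h4 (Nat.cast_nonneg _)
        linarith [hJ1 N i]
      · rw [norm_zero]; positivity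
  have hq' : Tendsto (fun N : ℕ => K * L * q ^ N) atTop (𝓝 0) := by
    have := (tendsto_pow_atTop_nhds_zero_of_lt_one hq0.le hq1).const_mul (K * L)
    rwa [mul_zero] at this
  have hdiff : ∀ N, |gapMean Z a lam g N - ∑ i ∈ Finset.range (cnt d N),
      lam⁻¹ ^ d i * gapMean Z a lam g (N - d i) - ∑' i, F N i| ≤ K * L * q ^ N := by
    intro N
    have h1 := hK N L (fun l => ((gaps l).count g : ℝ)) fun l hl' => by
      rw [Real.norm_eq_abs, abs_of_nonneg (Nat.cast_nonneg _), pow_one]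
      have h2 : (gaps l).count g ≤ L * (N + 1) :=
        List.count_le_length.trans ((length_gaps l).le.trans (by omega))
      exact_mod_cast h2
    have e1 : ∑' i, F N i = ∑ i ∈ Finset.range (cnt d N),
        lam⁻¹ ^ d i * (T i * massRatio Z a lam (N - d i) + J N i) := by
      rw [tsum_eq_sum (s := Finset.range (cnt d N))]
      · exact Finset.sum_congr rfl fun i hi => if_pos (Finset.mem_range.1 hi)
      · intro i hi
        exact if_neg (by rwa [Finset.mem_range] at hi)
    have e2 : ∀ i ∈ Finset.range (cnt d N), lam⁻¹ ^ d i • greedyMean Z a lam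
        (fun l => ((gaps (expPrefix d N i ++ l)).count g : ℝ)) (N - d i) =
        lam⁻¹ ^ d i * gapMean Z a lam g (N - d i) +
          lam⁻¹ ^ d i * (T i * massRatio Z a lam (N - d i) + J N i) := fun i hi => by
      have hi' := Finset.mem_range.1 hi
      have h2 : ∀ l < i, d l ≤ N := fun l hl' => hd.lt_cnt_iff.1 (hl'.trans hi')
      simp_rw [count_gaps_append d g N i h2]
      simp only [gapMean, hJ, greedyMean_real, Finset.sum_add_distrib, Finset.sum_const,
        Finset.card_range, nsmul_eq_mul, massRatio, smul_eq_mul, hT]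
      ring
    rw [Finset.sum_congr rfl e2, Finset.sum_add_distrib, ← e1, ← sub_sub] at h1
    exact h1
  have h5 : Tendsto (fun N => gapMean Z a lam g N - ∑ i ∈ Finset.range (cnt d N),
      lam⁻¹ ^ d i * gapMean Z a lam g (N - d i) - ∑' i, F N i) atTop (𝓝 0) :=
    squeeze_zero_norm hdiff hq'
  have h6 := h5.add hFlim
  rw [zero_add] at h6
  exact h6.congr fun N => by ring

theorem ExpGrowth.tendsto_window (hZ : ExpGrowth Z a lam r C) {f : ℕ → ℝ} {s : ℝ}
    (hf : Tendsto (fun n : ℕ => (∑ m ∈ Finset.range (Z n), f m) / Z n / n) atTop (𝓝 s)) :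
    Tendsto (fun N : ℕ => (∑ m ∈ Finset.Ico (Z N) (Z (N + 1)), f m) /
      ((Finset.Ico (Z N) (Z (N + 1))).card : ℝ) / N) atTop (𝓝 s) := by
  have hl := hZ.one_lt
  have hρ := hZ.tendsto_weight
  have h1 : Tendsto (fun n : ℕ => ((n + 1 : ℕ) : ℝ) / n) atTop (𝓝 1) := by
    have h2 : Tendsto (fun n : ℕ => 1 + 1 / (n : ℝ)) atTop (𝓝 (1 + 0)) :=
      tendsto_one_div_atTop_nhds_zero_nat.const_add 1
    rw [add_zero] at h2
    refine h2.congr' ?_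
    filter_upwards [eventually_ge_atTop 1] with n hn
    have : (n : ℝ) ≠ 0 := by positivity
    push_cast
    field_simp
  have h3 := (hρ.mul ((hf.comp (tendsto_add_atTop_nat 1)).mul h1)).sub ((hρ.sub_const 1).mul hf)
  rw [mul_one, ← sub_mul, sub_sub_cancel, one_mul] at h3
  refine h3.congr' ?_
  filter_upwards [hZ.eventually_lt, eventually_ge_atTop 1] with N hN hN1
  have : (N : ℝ) ≠ 0 := by positivity
  have : ((N + 1 : ℕ) : ℝ) ≠ 0 := by positivity
  rw [sum_Ico_div (hZ.pos N) hN]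
  simp only [Function.comp]
  field_simp

/-- Each integer of the window has one gap fewer than summands. The total number of gaps per integer
is thus asymptotic to `meanRate` · N, and `stepMean` cancels in the quotient. -/
theorem ExpGrowth.tendsto_gapProb (hZ : ExpGrowth Z a lam r C) (hd : QuasiGreedy lam⁻¹ d R)
    (g : ℕ) :
    Tendsto (fun N => gapProb Z N g) atTop (𝓝 (gapRate lam d g / indexMean lam⁻¹ d)) := by
  have hμ := hd.stepMean_pos
  have h1 := hd.tendsto_div_of_renewal (hZ.tendsto_gapMean_renewal hd g)
  have h2 : Tendsto (fun n : ℕ =>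
      (∑ m ∈ Finset.range (Z n), ((gaps (greedy Z m)).count g : ℝ)) / Z n / n) atTop
      (𝓝 (gapRate lam d g / stepMean lam⁻¹ d)) := by
    have h3 := h1.div hZ.tendsto_massRatio one_ne_zero
    rw [div_one] at h3
    refine h3.congr fun n => ?_
    simp only [Pi.div_apply]
    rw [div_right_comm, gapMean, greedyMean_real, hZ.div_massRatio]
  have h4 := hZ.tendsto_window h2
  have h5 : Tendsto (fun n : ℕ =>
      (∑ m ∈ Finset.range (Z n), (numSummands Z m : ℝ)) / Z n / n) atTop
      (𝓝 (meanRate lam⁻¹ d)) := by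
    obtain ⟨M, hM⟩ := hZ.exists_avgDev_bound hd
    have h6 : Tendsto (fun n : ℕ => avgDev Z (meanRate lam⁻¹ d) n / n) atTop (𝓝 0) := by
      refine squeeze_zero_norm (a := fun n : ℕ => M / (n : ℝ)) (fun n => ?_)
        (tendsto_const_nhds.div_atTop tendsto_natCast_atTop_atTop)
      rw [norm_div, Real.norm_eq_abs, Real.norm_natCast]
      gcongr
      exact hM n
    have h7 := h6.add_const (meanRate lam⁻¹ d)
    rw [zero_add] at h7
    refine h7.congr' ?_
    filter_upwards [eventually_ge_atTop 1] with n hn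
    have hn0 : (n : ℝ) ≠ 0 := by positivity
    have hz0 : (Z n : ℝ) ≠ 0 := by exact_mod_cast (hZ.pos n).ne'
    rw [avgDev, Finset.sum_sub_distrib, Finset.sum_const, Finset.card_range, nsmul_eq_mul]
    field_simp
    ring
  have h8 := (hZ.tendsto_window h5).sub tendsto_one_div_atTop_nhds_zero_nat
  rw [sub_zero] at h8
  have h9 := h4.div h8 hd.meanRate_pos.ne'
  have e : gapRate lam d g / stepMean lam⁻¹ d / meanRate lam⁻¹ d =
      gapRate lam d g / indexMean lam⁻¹ d := by
    rw [meanRate, div_div_div_cancel_right₀ hμ.ne']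
  rw [e] at h9
  refine h9.congr' ?_
  filter_upwards [hZ.eventually_lt, eventually_ge_atTop 1] with N hN hN1
  have hN0 : (N : ℝ) ≠ 0 := by positivity
  have hcard : ((Finset.Ico (Z N) (Z (N + 1))).card : ℝ) ≠ 0 := by
    exact_mod_cast (Finset.card_pos.2 (Finset.nonempty_Ico.2 hN)).ne'
  have e2 : ∑ m ∈ Finset.Ico (Z N) (Z (N + 1)), ((gaps (greedy Z m)).length : ℝ) =
      ∑ m ∈ Finset.Ico (Z N) (Z (N + 1)), (numSummands Z m : ℝ) -
        (Finset.Ico (Z N) (Z (N + 1))).card := by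
    have e3 : ∀ m ∈ Finset.Ico (Z N) (Z (N + 1)), ((gaps (greedy Z m)).length : ℝ) =
        (numSummands Z m : ℝ) - 1 := fun m hm => by
      have hm' := Finset.mem_Ico.1 hm
      rw [length_gaps, numSummands, greedy_of_le hZ.mono hZ.pos hm'.1 hm'.2, List.length_cons]
      push_cast
      simp
    rw [Finset.sum_congr rfl e3, Finset.sum_sub_distrib, Finset.sum_const, nsmul_eq_mul, mul_one]
  have e4 : ∀ x : ℝ, x / ((Finset.Ico (Z N) (Z (N + 1))).card : ℝ) / N - 1 / N =
      (x - (Finset.Ico (Z N) (Z (N + 1))).card) / ((Finset.Ico (Z N) (Z (N + 1))).card : ℝ) / N :=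
    fun x => by field_simp
  simp only [Pi.div_apply]
  rw [gapProb, e2, e4, div_div_div_cancel_right₀ hN0, div_div_div_cancel_right₀ hcard]

end Join

/-! ### Total mass and decay of the limiting gap law -/

section GapLaw

variable {lam : ℝ} {d : ℕ → ℕ} {R : ℕ → ℝ}

/-- The contribution of the `(k + 1)`-st entry of the quasi-greedy expansion to `gapRate`. -/
noncomputable def gapTerm (lam : ℝ) (d : ℕ → ℕ) (R : ℕ → ℝ) (k g : ℕ) : ℝ :=
  gapInd d g (k + 1) * R (k + 2) + joinLim lam d g (k + 1)

theorem joinLim_nonneg (hl : 1 < lam) (g i : ℕ) : 0 ≤ joinLim lam d g i := by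
  cases i with
  | zero => simp [joinLim]
  | succ k =>
    rw [joinLim]
    have : 0 < lam - 1 := by linarith
    split_ifs <;> positivity

theorem joinLim_succ_le (hl : 1 < lam) (g k : ℕ) :
    joinLim lam d g (k + 1) ≤ (lam - 1) * lam⁻¹ ^ (d k + g) := by
  rw [joinLim]
  have : 0 < lam - 1 := by linarith
  split_ifs
  · exact le_rfl
  · positivity

theorem gapTerm_nonneg (hl : 1 < lam) (hd : QuasiGreedy lam⁻¹ d R) (k g : ℕ) :
    0 ≤ gapTerm lam d R k g :=
  add_nonneg (mul_nonneg (gapInd_nonneg _ _ _) (hd.pos _).le) (joinLim_nonneg hl _ _)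

theorem summable_joinLim (hl : 1 < lam) (hd : QuasiGreedy lam⁻¹ d R) (g : ℕ) :
    Summable (joinLim lam d g) := by
  rw [← summable_nat_add_iff 1]
  refine Summable.of_nonneg_of_le (fun k => joinLim_nonneg hl g (k + 1))
    (fun k => joinLim_succ_le hl g k) ?_
  refine (hd.hasSum.summable.mul_left ((lam - 1) * lam⁻¹ ^ g)).congr fun k => ?_
  rw [pow_add]; ring

/-- Summation by parts collects the prefix gaps by their position: the gap at position l occurs in
all blocks i > l, of total weight R (l+1). -/
theorem hasSum_gapTerm (hl : 1 < lam) (hd : QuasiGreedy lam⁻¹ d R) (g : ℕ) :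
    HasSum (fun k => gapTerm lam d R k g) (gapRate lam d g) := by
  have hs1 : Summable fun i => lam⁻¹ ^ d i * ∑ l ∈ Finset.range i, gapInd d g l := by
    have hb0 := hd.b_pos
    refine Summable.of_nonneg_of_le (fun i => ?_) (fun i => ?_) hd.summable_index
    · exact mul_nonneg (pow_pos hb0 _).le (Finset.sum_nonneg fun l _ => gapInd_nonneg d g l)
    · gcongr
      exact (Finset.sum_le_card_nsmul _ _ 1 fun l _ => gapInd_le_one d g l).trans (by simp)
  have hs2 := summable_joinLim hl hd g
  have h1 := hd.hasSum_mul_partial_sum (gapInd_nonneg d g) (gapInd_le_one d g) hs1.hasSum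
  have h2 := h1.add hs2.hasSum
  rw [← hs1.tsum_add hs2] at h2
  change HasSum _ (gapRate lam d g) at h2
  rw [← hasSum_nat_add_iff' 1] at h2
  simpa [gapInd, joinLim, gapTerm] using h2

/-- A step with i > k has exactly one gap after its k-th entry, and R (k+1) is the probability of
such a step. The joining gaps g > d (k+1) - d k form a geometric series with sum b^{d_{k+1}}. -/
theorem hasSum_gapTerm_right (hl : 1 < lam) (hd : QuasiGreedy lam⁻¹ d R) (k : ℕ) :
    HasSum (fun g => gapTerm lam d R k g) (R (k + 1)) := by
  have hl0 : lam ≠ 0 := by positivity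
  have hmono := hd.monotone (Nat.le_succ k)
  set D := d (k + 1) - d k with hD
  have h1 : HasSum (fun g => gapInd d g (k + 1) * R (k + 2)) (R (k + 2)) := by
    have := hasSum_ite_eq D (R (k + 2))
    refine this.congr_fun fun g => ?_
    simp only [gapInd, ← hD, eq_comm (a := D)]
    split_ifs <;> simp
  have h2 : HasSum (fun g => joinLim lam d g (k + 1)) (lam⁻¹ ^ d (k + 1)) := by
    rw [← hasSum_nat_add_iff' (D + 1)]
    have h3 : ∑ g ∈ Finset.range (D + 1), joinLim lam d g (k + 1) = 0 :=
      Finset.sum_eq_zero fun g hg => by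
        have := Finset.mem_range.1 hg
        rw [joinLim, if_neg (by omega)]
    rw [h3, sub_zero]
    have h4 := (hasSum_geometric_of_lt_one hd.b_pos.le hd.b_lt).mul_left
      ((lam - 1) * lam⁻¹ ^ (d (k + 1) + 1))
    have e : (lam - 1) * lam⁻¹ ^ (d (k + 1) + 1) * (1 - lam⁻¹)⁻¹ = lam⁻¹ ^ d (k + 1) := by
      have : lam - 1 ≠ 0 := by linarith
      have h5 : 1 - lam⁻¹ = (lam - 1) * lam⁻¹ := by field_simp
      rw [h5, pow_succ]
      field_simp
    rw [e] at h4
    refine h4.congr_fun fun g => ?_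
    rw [joinLim, if_pos (by omega), mul_assoc, ← pow_add]
    congr 2
    have : d k ≤ d (k + 1) := hmono
    omega
  have h6 := h1.add h2
  have e : R (k + 2) + lam⁻¹ ^ d (k + 1) = R (k + 1) := by
    rw [hd.succ (k + 1)]; ring
  rw [e] at h6
  exact h6

theorem QuasiGreedy.hasSum_remainder {b : ℝ} (h : QuasiGreedy b d R) :
    HasSum (fun k => R (k + 1)) (indexMean b d) := by
  have h1 := h.hasSum_mul_partial_sum (u := fun _ => 1) (fun _ => zero_le_one) (fun _ => le_rfl)
    (s := indexMean b d) (by simpa [indexMean] using h.summable_index.hasSum)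
  simpa using h1

/-- Interchanging the nonnegative double sum leaves Σ_k P(i > k), the mean of i. -/
theorem hasSum_gapRate (hl : 1 < lam) (hd : QuasiGreedy lam⁻¹ d R) :
    HasSum (gapRate lam d) (indexMean lam⁻¹ d) := by
  have hsum : Summable fun x : ℕ × ℕ => gapTerm lam d R x.1 x.2 := by
    rw [summable_prod_of_nonneg fun x => gapTerm_nonneg hl hd x.1 x.2]
    refine ⟨fun k => (hasSum_gapTerm_right hl hd k).summable, ?_⟩
    simp_rw [fun k => (hasSum_gapTerm_right hl hd k).tsum_eq]
    exact hd.hasSum_remainder.summable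
  have h1 : ∑' x : ℕ × ℕ, gapTerm lam d R x.1 x.2 = indexMean lam⁻¹ d :=
    (hsum.hasSum.prod_fiberwise fun k => hasSum_gapTerm_right hl hd k).unique hd.hasSum_remainder
  have hs : HasSum (fun x : ℕ × ℕ => gapTerm lam d R x.1 x.2) (indexMean lam⁻¹ d) :=
    h1 ▸ hsum.hasSum
  have h2 : HasSum ((fun x : ℕ × ℕ => gapTerm lam d R x.1 x.2) ∘ (Equiv.prodComm ℕ ℕ))
      (indexMean lam⁻¹ d) := (Equiv.hasSum_iff (Equiv.prodComm ℕ ℕ)).2 hs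
  exact HasSum.prod_fiberwise (g := gapRate lam d) h2 fun g => hasSum_gapTerm hl hd g

/-- For fixed k and large g no prefix gap equals g, and the joining term times λ^g is exactly (λ-1)
b^{d_k}; these sum to λ-1. Domination holds because a prefix gap equal to g forces R (k+2) ≤ λ
b^{d_{k+1}} = λ b^{d_k+g}. -/
theorem tendsto_gapRate_mul_pow (hl : 1 < lam) (hd : QuasiGreedy lam⁻¹ d R) :
    Tendsto (fun g => gapRate lam d g * lam ^ g) atTop (𝓝 (lam - 1)) := by
  have hl0 : 0 < lam := by linarith
  have hb0 := hd.b_pos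
  have hpow : ∀ g : ℕ, lam⁻¹ ^ g * lam ^ g = 1 := fun g => by
    rw [← mul_pow, inv_mul_cancel₀ hl0.ne', one_pow]
  have hbound : Summable fun k => (lam + (lam - 1)) * lam⁻¹ ^ d k :=
    hd.hasSum.summable.mul_left _
  have hlim : Tendsto (fun g => ∑' k, gapTerm lam d R k g * lam ^ g) atTop
      (𝓝 (∑' k, (lam - 1) * lam⁻¹ ^ d k)) := by
    refine tendsto_tsum_of_dominated_convergence hbound (fun k => ?_)
      (Eventually.of_forall fun g k => ?_)
    · refine tendsto_const_nhds.congr' ?_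
      filter_upwards [eventually_gt_atTop (d (k + 1) - d k)] with g hg
      rw [gapTerm, gapInd, if_neg (by omega), joinLim, if_pos hg, zero_mul, zero_add, pow_add,
        mul_assoc, mul_assoc, hpow, mul_one]
    · rw [Real.norm_eq_abs, abs_of_nonneg (mul_nonneg (gapTerm_nonneg hl hd k g) (by positivity)),
        gapTerm, add_mul, add_mul]
      refine add_le_add ?_ ?_
      · rw [gapInd]
        split_ifs with hg
        · have h1 : R (k + 2) ≤ lam⁻¹ ^ d (k + 1) * lam := by
            refine (hd.antitone (Nat.le_succ (k + 1))).trans ?_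
            have := hd.le (k + 1)
            rwa [← div_eq_mul_inv, div_le_iff₀ hl0] at this
          have h2 : d (k + 1) = d k + g := by
            have := hd.monotone (Nat.le_succ k)
            rw [Nat.succ_eq_add_one] at this
            omega
          rw [h2, pow_add] at h1
          calc 1 * R (k + 2) * lam ^ g ≤ 1 * (lam⁻¹ ^ d k * lam⁻¹ ^ g * lam) * lam ^ g := by gcongr
            _ = lam * lam⁻¹ ^ d k * (lam⁻¹ ^ g * lam ^ g) := by ring
            _ = lam * lam⁻¹ ^ d k := by rw [hpow, mul_one]
        · rw [zero_mul, zero_mul]; positivity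
      · calc joinLim lam d g (k + 1) * lam ^ g ≤ (lam - 1) * lam⁻¹ ^ (d k + g) * lam ^ g := by
              gcongr; exact joinLim_succ_le hl g k
          _ = (lam - 1) * lam⁻¹ ^ d k * (lam⁻¹ ^ g * lam ^ g) := by rw [pow_add]; ring
          _ = (lam - 1) * lam⁻¹ ^ d k := by rw [hpow, mul_one]
  rw [tsum_mul_left, hd.hasSum.tsum_eq, mul_one] at hlim
  refine hlim.congr fun g => ?_
  rw [tsum_mul_right, (hasSum_gapTerm hl hd g).tsum_eq]

end GapLaw

end GreedyZLRR

theorem mainTheorem4 (E : LinearRecurrence ℤ) (Z : ℕ → ℕ) (lam : ℝ)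
    (hZ : GreedyZLRR.IsZLRR E Z)
    (hlam : GreedyZLRR.IsDominantRoot E lam)
    (hgrowth : ¬ Tendsto (fun n : ℕ => (Z n : ℝ) / lam ^ n) atTop (𝓝 0))
    (hcomplete : GreedyZLRR.CompleteGreedy Z) :
    (∃ C₁ C₂ : ℝ, 0 < C₁ ∧ 0 < C₂ ∧
      GreedyZLRR.GaussianSummands Z (fun N => Finset.Ico 0 (Z N)) C₁ C₂ ∧
      GreedyZLRR.GaussianSummands Z (fun N => Finset.Ico (Z N) (Z (N + 1))) C₁ C₂) ∧
    (∃ p : ℕ → ℝ,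
      (∀ g : ℕ, Tendsto (fun N => GreedyZLRR.gapProb Z N g) atTop (𝓝 (p g))) ∧
      HasSum p 1 ∧
      1 < lam ∧
      ∃ C : ℝ, 0 < C ∧ Tendsto (fun g : ℕ => p g * lam ^ g) atTop (𝓝 C)) := by
  obtain ⟨a, r, C, hG⟩ := hZ.exists_expGrowth hlam hgrowth
  have hl := hG.one_lt
  obtain ⟨d, R, hd⟩ := GreedyZLRR.exists_quasiGreedy (b := lam⁻¹) (by positivity)
    (inv_lt_one_of_one_lt₀ hl)
  have hι := hd.indexMean_pos
  refine ⟨⟨_, _, hd.meanRate_pos, hd.varRate_pos, hG.gaussianSummands_initial hd,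
    hG.gaussianSummands_window hd⟩,
    fun g => GreedyZLRR.gapRate lam d g / GreedyZLRR.indexMean lam⁻¹ d,
    fun g => hG.tendsto_gapProb hd g, ?_, hl,
    (lam - 1) / GreedyZLRR.indexMean lam⁻¹ d, div_pos (by linarith) hι, ?_⟩
  · have := (GreedyZLRR.hasSum_gapRate hl hd).div_const (GreedyZLRR.indexMean lam⁻¹ d)
    rwa [div_self hι.ne'] at this
  · refine ((GreedyZLRR.tendsto_gapRate_mul_pow hl hd).div_const _).congr fun g => ?_
    ring
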